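/- Let $n\ge 1$ and let $W=B_n$ act on $\mathbb{R}^n$ by signed permutations of the coordinates, with simple roots $-e_1,\ e_1-e_2,\ \dots,\ e_{n-1}-e_n$, positive roots $\Phi^+=\{-e_i\}\cup\{e_i-e_j,\ -e_i-e_j : i<j\}$, simple reflections $s_1,\dots,s_n$, and set $R$ of reflections (the reflections in the positive roots). Let $c=s_{\sigma(1)}\cdots s_{\sigma(n)}$, $\sigma\in\mathfrak{S}_n$, be any standard Coxeter element. Let $\mathcal{P}(B_n)$ be the set of intersections of reflecting hyperplanes, ordered by reverse inclusion; $\pi\in\mathcal P(B_n)$ is identified with the set partition of $\{\pm1,\dots,\pm n\}$ in which two elements are in the same block when the corresponding signed coordinates ($x_{-i}=-x_i$) agree on $\pi$. A block $b$ with $b=-b$ is called the $0$-block. A partition $\pi$ is noncrossing with respect to $c$ if $\pi=\mathrm{Fix}(w)$ for some $w\in W$ with $w\le_{abs}c$, meaning that some reduced word of $w$ in the letters $R$ is a subword of some reduced word of $c$ in the letters $R$. Let $\mathcal{M}(B_n)$ and $\mathcal{M}^{NC}(B_n,c)$ be the sets of maximal chains $(\pi_0,\dots,\pi_n)$ of partitions,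 respectively of noncrossing partitions. A partition $\pi_2$ is an interval refinement of $\pi_1$ if the simple roots of the pointwise stabilizer of $\pi_2$ (those of the positive system $\Phi^+\cap\pi_2^\perp$) are among those of the pointwise stabilizer of $\pi_1$; $\mathrm{nir}(\Omega)$ is the number of $i$ such that $\omega_i$ is not an interval refinement of $\omega_{i+1}$. For $\Pi\in\mathcal{M}(B_n)$ put \[ [\Pi]=\{w(\Pi): w\in W\}\cap\mathcal{M}^{NC}(B_n,c),\qquad M([\Pi],q)=\sum_{\Omega\in[\Pi]}q^{\mathrm{nir}(\Omega)}. \] A pointed André tree on $n$ vertices is a rooted tree with vertices labeled $1,\dots,n$, labels decreasing from the root to the leaves, each vertex having at most two (unordered) sons, with a distinguished vertex having at most one son. For $\Pi=(\pi_0,\dots,\pi_n)\in\mathcal{M}(B_n)$, its image under the adapted Stanley map is the pointed André tree $T$ in which the vertex with label $i$ represents the $0$-block, or the pair $\{b,-b\}$ of distinct opposite blocks of cardinality at least $2$, that appears in $\pi_i$ but not in $\pi_{i-1}$; $v_1$ is below or equal to $v_2$ when the blocks represented by $v_1$ are included in blocks represented by $v_2$; and the distinguished vertex has label $i$ when $\pi_i$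 has a $0$-block and $\pi_{i-1}$ has none. For a vertex $v$ of $T$, let the hook length $h_v$ be the number of vertices of the subtree with root $v$, and let $\beta(v)=1+q(h_v-1)$ if $v$ lies on the path joining the root to the distinguished vertex (both included), and $\beta(v)=2+q(h_v-1)$ otherwise. Proposition. For every $\Pi\in\mathcal{M}(B_n)$ (in particular for every noncrossing maximal chain), there is exactly one pointed André tree $T$ on $n$ vertices that is the image of $\Pi$ under the adapted Stanley map, and \[ M([\Pi],q)=\prod_{v\in T,\ h_v\neq1}\beta(v) \] as polynomials in $q$. -/

import Mathlib

namespace TypeB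

noncomputable section

open Polynomial

/-! ### The reflection group of type `B_n` -/

/-- The standard geometric representation of `B_n`. -/
abbrev V (n : ℕ) : Type := EuclideanSpace ℝ (Fin n)

/-- The standard basis vectors. -/
def e {n : ℕ} (i : Fin n) : V n := EuclideanSpace.single i (1 : ℝ)

/-- The simple roots `-e_1, e_1 - e_2, …, e_{n-1} - e_n` (indexed from `0`). -/
def simpleRoot {n : ℕ} (i : Fin n) : V n :=
  if i.val = 0 then -e i else e (⟨i.val - 1, by omega⟩ : Fin n) - e i

/-- The positive roots for this choice of simple roots. -/
def posRoots (n : ℕ) : Set (V n) :=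
  {α | (∃ i : Fin n, α = -e i) ∨
    ∃ i j : Fin n, i < j ∧ (α = e i - e j ∨ α = -e i - e j)}

/-- The orthogonal reflection through the hyperplane orthogonal to `α`. -/
def refl {n : ℕ} (α : V n) : V n ≃ₗᵢ[ℝ] V n := (ℝ ∙ α)ᗮ.reflection

/-- The Coxeter group `B_n`, generated by the simple reflections. -/
def W (n : ℕ) : Subgroup (V n ≃ₗᵢ[ℝ] V n) :=
  Subgroup.closure (Set.range fun i : Fin n => refl (simpleRoot i))

/-- The set `T` of reflections of `B_n`. -/
def reflections (n : ℕ) : Set (V n ≃ₗᵢ[ℝ] V n) := refl '' posRoots n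

/-- The standard Coxeter element `s_{σ(1)} ⋯ s_{σ(n)}`. -/
def coxeterElement {n : ℕ} (σ : Equiv.Perm (Fin n)) : V n ≃ₗᵢ[ℝ] V n :=
  (List.ofFn fun i => refl (simpleRoot (σ i))).prod

/-- `l` is a reduced `T`-word of `w`: a factorization of `w` into reflections of minimal length. -/
def IsReducedTWord {n : ℕ} (l : List (V n ≃ₗᵢ[ℝ] V n)) (w : V n ≃ₗᵢ[ℝ] V n) : Prop :=
  (∀ t ∈ l, t ∈ reflections n) ∧ l.prod = w ∧
    ∀ l' : List (V n ≃ₗᵢ[ℝ] V n), (∀ t ∈ l', t ∈ reflections n) → l'.prod = w →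
      l.length ≤ l'.length

/-- The (weak) absolute order: some reduced `T`-word of `u` is a subword of some reduced `T`-word
of `v`. -/
def AbsLE {n : ℕ} (u v : V n ≃ₗᵢ[ℝ] V n) : Prop :=
  ∃ l l' : List (V n ≃ₗᵢ[ℝ] V n), IsReducedTWord l u ∧ IsReducedTWord l' v ∧ l.Sublist l'

/-! ### Set partitions and noncrossing partitions, as subspaces

The order on set partitions is reverse inclusion of subspaces, so the minimal partition is the
whole space `⊤` and the maximal partition is `⊥ = {0}`. -/

/-- Generalized set partitions: intersections of reflecting hyperplanes. -/
def setPartitions (n : ℕ) : Set (Submodule ℝ (V n)) :=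
  {π | ∃ A ⊆ posRoots n, π = ⨅ α ∈ A, (ℝ ∙ α)ᗮ}

/-- Set partitions that are noncrossing with respect to `c`: the fixed spaces of the elements of
the group below `c` in the absolute order. -/
def noncrossing {n : ℕ} (c : V n ≃ₗᵢ[ℝ] V n) : Set (Submodule ℝ (V n)) :=
  {π | π ∈ setPartitions n ∧ ∃ w ∈ W n, AbsLE w c ∧ ∀ x : V n, x ∈ π ↔ w x = x}

/-- The positive roots of the pointwise stabilizer of `π`. -/
def stabPosRoots {n : ℕ} (π : Submodule ℝ (V n)) : Set (V n) :=
  {α | α ∈ posRoots n ∧ α ∈ πᗮ}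

/-- The simple roots of the pointwise stabilizer of `π`: the indecomposable positive roots, i.e.
those that are not a sum of two positive roots. -/
def stabSimpleRoots {n : ℕ} (π : Submodule ℝ (V n)) : Set (V n) :=
  {α | α ∈ stabPosRoots π ∧ ∀ β ∈ stabPosRoots π, ∀ γ ∈ stabPosRoots π, α ≠ β + γ}

/-- `π₂` is an interval refinement of `π₁`. -/
def IsIntervalRefinement {n : ℕ} (π₂ π₁ : Submodule ℝ (V n)) : Prop :=
  stabSimpleRoots π₂ ⊆ stabSimpleRoots π₁

/-- `p = (π_0, …, π_n)` is a maximal chain, from the minimal to the maximal partition, in the set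
`S` of partitions ordered by reverse inclusion. -/
def IsMaximalChain {n : ℕ} (S : Set (Submodule ℝ (V n)))
    (p : Fin (n + 1) → Submodule ℝ (V n)) : Prop :=
  p 0 = ⊤ ∧ p (Fin.last n) = ⊥ ∧ (∀ i, p i ∈ S) ∧
    ∀ i : Fin n, p i.succ < p i.castSucc ∧
      ∀ ρ ∈ S, ¬ (p i.succ < ρ ∧ ρ < p i.castSucc)

/-- The number of `i` such that `π_i` is not an interval refinement of `π_{i+1}`. -/
def nir {n : ℕ} (p : Fin (n + 1) → Submodule ℝ (V n)) : ℕ :=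
  {i : Fin n | ¬ IsIntervalRefinement (p i.castSucc) (p i.succ)}.ncard

/-- The noncrossing maximal chains in the orbit of `p` under the group. -/
def chainClass {n : ℕ} (c : V n ≃ₗᵢ[ℝ] V n) (p : Fin (n + 1) → Submodule ℝ (V n)) :
    Set (Fin (n + 1) → Submodule ℝ (V n)) :=
  {Ω | IsMaximalChain (noncrossing c) Ω ∧
    ∃ w ∈ W n, ∀ i, Ω i = (p i).map (w.toLinearEquiv : V n →ₗ[ℝ] V n)}

theorem posRoots_finite (n : ℕ) : (posRoots n).Finite := by
  have h : posRoots n ⊆ (Set.range fun i : Fin n => -e i) ∪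
      ((Set.range fun p : Fin n × Fin n => e p.1 - e p.2) ∪
        Set.range fun p : Fin n × Fin n => -e p.1 - e p.2) := by
    rintro α (⟨i, rfl⟩ | ⟨i, j, -, rfl | rfl⟩)
    · exact Or.inl ⟨i, rfl⟩
    · exact Or.inr (Or.inl ⟨(i, j), rfl⟩)
    · exact Or.inr (Or.inr ⟨(i, j), rfl⟩)
  exact ((Set.finite_range _).union ((Set.finite_range _).union (Set.finite_range _))).subset h

theorem setPartitions_finite (n : ℕ) : (setPartitions n).Finite := by
  refine ((posRoots_finite n).finite_subsets.image
    (fun A : Set (V n) => ⨅ α ∈ A, (ℝ ∙ α)ᗮ)).subset ?_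
  rintro π ⟨A, hA, rfl⟩
  exact ⟨A, hA, rfl⟩

theorem chainClass_finite {n : ℕ} (c : V n ≃ₗᵢ[ℝ] V n)
    (p : Fin (n + 1) → Submodule ℝ (V n)) : (chainClass c p).Finite := by
  refine (Set.Finite.pi' (fun _ : Fin (n + 1) => setPartitions_finite n)).subset ?_
  intro Ω hΩ i
  exact (hΩ.1.2.2.1 i).1

/-- The class generating function `M([p], q)`, as a polynomial in `q`. -/
def classGenFun {n : ℕ} (c : V n ≃ₗᵢ[ℝ] V n) (p : Fin (n + 1) → Submodule ℝ (V n)) : ℤ[X] :=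
  ∑ Ω ∈ (chainClass_finite c p).toFinset, X ^ nir Ω

/-! ### Blocks of a set partition of type `B` -/

/-- The set `{-n, …, -1} ∪ {1, …, n}`: the pair `(i, ε)` stands for `ε (i + 1)`. -/
abbrev SIdx (n : ℕ) : Type := Fin n × ℤˣ

/-- Sign change. -/
def negIdx {n : ℕ} (a : SIdx n) : SIdx n := (a.1, -a.2)

/-- The signed coordinate of `x` at `±i`, namely `±x_i`. -/
def coord {n : ℕ} (a : SIdx n) (x : V n) : ℝ := ((a.2 : ℤ) : ℝ) * x a.1

/-- `b` is a block of the type `B` set partition corresponding to the subspace `π`: two elements are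
in the same block when their signed coordinates agree on `π`. -/
def IsBlock {n : ℕ} (π : Submodule ℝ (V n)) (b : Set (SIdx n)) : Prop :=
  ∃ a : SIdx n, b = {a' | ∀ x ∈ π, coord a' x = coord a x}

/-- The opposite of a block. -/
def negBlock {n : ℕ} (b : Set (SIdx n)) : Set (SIdx n) := negIdx '' b

/-- `π` has a `0`-block, i.e. a block equal to its opposite. -/
def HasZeroBlock {n : ℕ} (π : Submodule ℝ (V n)) : Prop :=
  ∃ b, IsBlock π b ∧ negBlock b = b

/-- `B = {b, -b}` is either the `0`-block of `π`, or a pair of distinct opposite blocks of `π` of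
cardinality at least `2`. -/
def IsVertexBlock {n : ℕ} (π : Submodule ℝ (V n)) (B : Set (Set (SIdx n))) : Prop :=
  ∃ b, IsBlock π b ∧ B = {b, negBlock b} ∧ (negBlock b = b ∨ 2 ≤ b.ncard)

/-! ### Pointed André trees and the adapted Stanley map -/

/-- Pointed André trees on `n` vertices. As the labels are distinct, a vertex is identified with its
label, and `i : Fin n` stands for the label `i + 1`. -/
@[ext]
structure PointedAndreTree (n : ℕ) where
  /-- the vertex of which `v` is a son (`none` for the root) -/
  parent : Fin n → Option (Fin n)
  /-- the distinguished vertex -/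
  pt : Fin n
  existsUnique_root : ∃! v, parent v = none
  /-- labels decrease from the root to the leaves -/
  lt_of_parent : ∀ u v, parent u = some v → u < v
  /-- each vertex has at most two sons -/
  sons_le_two : ∀ v, {u | parent u = some v}.ncard ≤ 2
  /-- the distinguished vertex has at most one son -/
  pt_sons_le_one : {u | parent u = some pt}.ncard ≤ 1

namespace PointedAndreTree

variable {n : ℕ}

/-- `u` is equal to `v` or below `v`. -/
def Below (T : PointedAndreTree n) (u v : Fin n) : Prop :=
  Relation.ReflTransGen (fun a b => T.parent a = some b) u v

/-- The hook length of `v`: the number of vertices of the subtree with root `v`. -/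
def hook (T : PointedAndreTree n) (v : Fin n) : ℕ := {u | T.Below u v}.ncard

open Classical in
/-- The factor `β(v)`: the path from the root to the distinguished vertex consists of the vertices
that have the distinguished vertex in their subtree. -/
def beta (T : PointedAndreTree n) (v : Fin n) : ℤ[X] :=
  if T.Below T.pt v then 1 + X * ((T.hook v : ℤ[X]) - 1) else 2 + X * ((T.hook v : ℤ[X]) - 1)

end PointedAndreTree

/-- `T` is the image of the maximal chain `p` under Stanley's map adapted to type `B`; here `B i` is
the `0`-block or the pair of opposite blocks represented by the vertex of `T` with label `i`. -/
def IsStanleyImage {n : ℕ} (p : Fin (n + 1) → Submodule ℝ (V n)) (T : PointedAndreTree n) : Prop :=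
  ∃ B : Fin n → Set (Set (SIdx n)),
    (∀ (i : Fin n) (C : Set (Set (SIdx n))),
      (IsVertexBlock (p i.succ) C ∧ ¬ IsVertexBlock (p i.castSucc) C) ↔ C = B i) ∧
    (∀ u v : Fin n, T.Below u v ↔ ∀ b ∈ B u, ∃ b' ∈ B v, b ⊆ b') ∧
    ∀ i : Fin n, i = T.pt ↔ (HasZeroBlock (p i.succ) ∧ ¬ HasZeroBlock (p i.castSucc))

end

end TypeB

/-! A type B partition is encoded by the equivalence relation `rel` on signed indices, which are
ordered by the integers `sv` that they name. The positive roots of a stabilizer come from pairs a <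
b inside a class and its simple roots from consecutive pairs (`mem_stabSimpleRoots`), so an interval
refinement is one whose classes are order-convex in the classes of the coarser partition
(`isIntervalRefinement_iff`). A Coxeter element is a single cycle on the 2n signed indices that
crosses each threshold upwards at most once (`exists_isCoxEnum`), and a translate of a maximal chain
is noncrossing exactly when all its relations are noncrossing along this cycle
(`mapChain_mem_chainClass_iff`).

Passing from π_{k+1} to π_k breaks one class b_k, and its opposite, by separating a piece S_k and
its opposite. Let m = |b_k|. To keep the partition noncrossing, the piece must be one of the m
cyclic arcs of its size, and exactly two of these, the initial and the final segment for `sv`, give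
an interval refinement. The step therefore contributes 2 + q(m - 2), whatever the size of the piece
and whatever the Coxeter element (`sum_local_weight`).

The local contributions multiply by averaging over the group of signed permutations
(`card_mul_sum_prod`). The sum over the group counts each chain of the class as often as the order
of the stabilizer of the chain. The same averaging, applied to the indicator of that stabilizer,
computes its order: a step contributes 2 when b_k is a zero block or a pair of elements, and 1
otherwise. Comparing the two gives `classGenFun_mul_prod_symFactor`.

The vertices of the tree are the broken classes. A vertex of hook length h has m = 2h if its class
is a zero block and m = h + 1 otherwise (`numBroken_isCl`), and the zero blocks form the path from
the root to the distinguished vertex. So 2 + q(m - 2) equals 2(1 + q(h - 1)) or 2 + q(h - 1);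
dividing by the symmetry factor leaves β(v), or 1 when h = 1. -/

namespace TypeB
noncomputable section

variable {n : ℕ}

/-! ### Signed indices -/

@[simp] theorem negIdx_negIdx (a : SIdx n) : negIdx (negIdx a) = a := by
  simp [negIdx]

theorem negIdx_injective : Function.Injective (negIdx (n := n)) :=
  Function.LeftInverse.injective negIdx_negIdx

@[simp] theorem negIdx_inj {a b : SIdx n} : negIdx a = negIdx b ↔ a = b :=
  negIdx_injective.eq_iff

theorem negIdx_eq_iff {a b : SIdx n} : negIdx a = b ↔ a = negIdx b := by
  constructor <;> rintro rfl <;> simp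

theorem units_ne_neg (u : ℤˣ) : -u ≠ u := by
  rcases Int.units_eq_one_or u with rfl | rfl <;> decide

@[simp] theorem negIdx_ne (a : SIdx n) : negIdx a ≠ a := fun h =>
  units_ne_neg a.2 (congrArg Prod.snd h)

@[simp] theorem ne_negIdx (a : SIdx n) : a ≠ negIdx a := (negIdx_ne a).symm

theorem eq_or_eq_negIdx {a b : SIdx n} (h : a.1 = b.1) : a = b ∨ a = negIdx b := by
  obtain ⟨i, u⟩ := a
  obtain ⟨j, v⟩ := b
  obtain rfl : i = j := h
  rcases Int.units_eq_one_or u with rfl | rfl <;> rcases Int.units_eq_one_or v with rfl | rfl <;>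
    simp [negIdx]

theorem mem_negBlock {S : Set (SIdx n)} {a : SIdx n} : a ∈ negBlock S ↔ negIdx a ∈ S := by
  constructor
  · rintro ⟨b, hb, rfl⟩
    simpa using hb
  · exact fun h => ⟨_, h, by simp⟩

@[simp] theorem negBlock_negBlock (S : Set (SIdx n)) : negBlock (negBlock S) = S := by
  ext a
  simp [mem_negBlock]

/-- The integer named by a signed index. -/
def sv (a : SIdx n) : ℤ := (a.2 : ℤ) * ((a.1 : ℕ) + 1)

@[simp] theorem sv_negIdx (a : SIdx n) : sv (negIdx a) = -sv a := by
  simp [sv, negIdx]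

theorem sv_ne_zero (a : SIdx n) : sv a ≠ 0 := by
  rcases a with ⟨i, u⟩
  rcases Int.units_eq_one_or u with rfl | rfl <;> simp [sv] <;> omega

theorem sv_injective : Function.Injective (sv (n := n)) := by
  rintro ⟨i, u⟩ ⟨j, v⟩ h
  rcases Int.units_eq_one_or u with rfl | rfl <;> rcases Int.units_eq_one_or v with rfl | rfl <;>
    simp [sv] at h ⊢ <;> omega

/-- The signed basis vector. -/
def E (a : SIdx n) : V n := ((a.2 : ℤ) : ℝ) • e a.1

theorem coord_eq_inner (a : SIdx n) (x : V n) : coord a x = inner ℝ (E a) x := by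
  simp [coord, E, e, inner_smul_left, EuclideanSpace.inner_single_left]

@[simp] theorem coord_negIdx (a : SIdx n) (x : V n) : coord (negIdx a) x = -coord a x := by
  simp [coord, negIdx]

@[simp] theorem E_negIdx (a : SIdx n) : E (negIdx a) = -E a := by
  simp [E, negIdx]

@[simp] theorem coord_add (a : SIdx n) (x y : V n) : coord a (x + y) = coord a x + coord a y := by
  simp [coord, mul_add]

@[simp] theorem coord_sub (a : SIdx n) (x y : V n) : coord a (x - y) = coord a x - coord a y := by
  simp [coord, mul_sub]

@[simp] theorem coord_smul (a : SIdx n) (t : ℝ) (x : V n) : coord a (t • x) = t * coord a x := by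
  simp [coord, mul_left_comm]

@[simp] theorem coord_zero (a : SIdx n) : coord a (0 : V n) = 0 := by
  simp [coord]

theorem coord_sum {ι : Type*} (s : Finset ι) (f : ι → V n) (a : SIdx n) :
    coord a (∑ i ∈ s, f i) = ∑ i ∈ s, coord a (f i) := by
  classical
  induction s using Finset.induction_on with
  | empty => simp
  | insert i s hi ih => simp [Finset.sum_insert hi, ih]

open Classical in
theorem coord_E (a b : SIdx n) :
    coord a (E b) = (if a = b then 1 else 0) - (if a = negIdx b then 1 else 0) := by
  by_cases h : a.1 = b.1
  · rcases eq_or_eq_negIdx h with rfl | rfl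
    · rcases a with ⟨i, u⟩
      rcases Int.units_eq_one_or u with rfl | rfl <;> simp [coord, E, e]
    · rcases b with ⟨i, u⟩
      rcases Int.units_eq_one_or u with rfl | rfl <;> simp [coord, E, e, negIdx]
  · have h1 : a ≠ b := fun h' => h (congrArg Prod.fst h')
    have h2 : a ≠ negIdx b := fun h' => h (h' ▸ rfl)
    simp [coord, E, e, h1, h2, h]

theorem ext_coord {x y : V n} (h : ∀ a, coord a x = coord a y) : x = y := by
  ext i
  simpa [coord] using h (i, 1)

@[simp] theorem coord_E_self (a : SIdx n) : coord a (E a) = 1 := by simp [coord_E]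

theorem E_injective : Function.Injective (E (n := n)) := by
  intro a b h
  by_contra hab
  have h1 := coord_E a b
  rw [← h, coord_E_self, if_neg hab] at h1
  split_ifs at h1 <;> norm_num at h1

/-! ### The relation of a subspace -/

/-- Two signed indices are related when the signed coordinates agree on the subspace. -/
def rel (π : Submodule ℝ (V n)) (a b : SIdx n) : Prop := ∀ x ∈ π, coord a x = coord b x

/-- Set partitions of type `B`, as relations. -/
structure IsBPart (r : SIdx n → SIdx n → Prop) : Prop where
  equiv : Equivalence r
  neg : ∀ a b, r a b → r (negIdx a) (negIdx b)
  zero : ∀ a b, r a (negIdx a) → r b (negIdx b) → r a b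

theorem rel_negIdx_self_iff {π : Submodule ℝ (V n)} {a : SIdx n} :
    rel π a (negIdx a) ↔ ∀ x ∈ π, coord a x = 0 := by
  refine forall₂_congr fun x _ => ?_
  rw [coord_negIdx]
  constructor <;> intro h <;> linarith

theorem isBPart_rel (π : Submodule ℝ (V n)) : IsBPart (rel π) where
  equiv := ⟨fun _ _ _ => rfl, fun h x hx => (h x hx).symm, fun h h' x hx => (h x hx).trans (h' x hx)⟩
  neg a b h x hx := by simp [h x hx]
  zero a b ha hb x hx := by
    rw [rel_negIdx_self_iff] at ha hb
    rw [ha x hx, hb x hx]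

theorem rel_mono {π ρ : Submodule ℝ (V n)} (h : π ≤ ρ) {a b : SIdx n} (hr : rel ρ a b) :
    rel π a b := fun x hx => hr x (h hx)

theorem IsBPart.neg_iff {r : SIdx n → SIdx n → Prop} (h : IsBPart r) {a b : SIdx n} :
    r (negIdx a) (negIdx b) ↔ r a b :=
  ⟨fun h' => by simpa using h.neg _ _ h', h.neg a b⟩

/-- The order `sv` makes positivity uniform: E a - E b with a < b is always a positive root, except
that for b = -a it is twice the short root E a. -/
theorem exists_root_pair {α : V n} (h : α ∈ posRoots n) :
    ∃ a b : SIdx n, sv a < sv b ∧ ((b ≠ negIdx a ∧ α = E a - E b) ∨ (b = negIdx a ∧ α = E a)) := by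
  rcases h with ⟨i, rfl⟩ | ⟨i, j, hij, rfl | rfl⟩
  · exact ⟨(i, -1), (i, 1), by rw [sv, sv]; push_cast; omega, Or.inr ⟨by simp [negIdx], by simp [E]⟩⟩
  · refine ⟨(i, 1), (j, 1), by simpa [sv] using hij, Or.inl ⟨by simp [negIdx], by simp [E]⟩⟩
  · refine ⟨(i, -1), (j, 1), by simp [sv]; omega, Or.inl ⟨?_, by simp [E]⟩⟩
    simp [negIdx, hij.ne']

theorem root_pair_mem {a b : SIdx n} (h : sv a < sv b) :
    (b ≠ negIdx a → E a - E b ∈ posRoots n) ∧ (b = negIdx a → E a ∈ posRoots n) := by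
  rcases a with ⟨i, u⟩
  rcases b with ⟨j, v⟩
  constructor
  · intro hne
    right
    rcases Int.units_eq_one_or u with rfl | rfl <;> rcases Int.units_eq_one_or v with rfl | rfl
    · exact ⟨i, j, by simpa [sv] using h, Or.inl (by simp [E])⟩
    · simp [sv] at h; omega
    · have hij : i ≠ j := by rintro rfl; simp [negIdx] at hne
      rcases lt_or_gt_of_ne hij with h' | h'
      · exact ⟨i, j, h', Or.inr (by simp [E])⟩
      · exact ⟨j, i, h', Or.inr (by simp [E]; abel)⟩
    · exact ⟨j, i, by simp [sv] at h; omega, Or.inl (by simp [E]; abel)⟩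
  · intro hb
    left
    rcases Int.units_eq_one_or u with rfl | rfl
    · simp [hb] at h; simp [sv] at h; omega
    · exact ⟨i, by simp [E]⟩

theorem rel_iff_inner {π : Submodule ℝ (V n)} {a b : SIdx n} :
    rel π a b ↔ E a - E b ∈ πᗮ := by
  rw [Submodule.mem_orthogonal']
  refine forall₂_congr fun x _ => ?_
  rw [inner_sub_left, ← coord_eq_inner, ← coord_eq_inner, sub_eq_zero]

theorem rel_neg_iff_inner {π : Submodule ℝ (V n)} {a : SIdx n} :
    rel π a (negIdx a) ↔ E a ∈ πᗮ := by
  rw [Submodule.mem_orthogonal', rel_negIdx_self_iff]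
  refine forall₂_congr fun x _ => ?_
  rw [← coord_eq_inner]

/-- Each hyperplane cutting out π is an equation between two signed coordinates, and this equation
belongs to `rel π`. Hence a set partition is recovered from its relation. -/
theorem mem_setPartition {π : Submodule ℝ (V n)} (h : π ∈ setPartitions n) {x : V n} :
    x ∈ π ↔ ∀ a b, rel π a b → coord a x = coord b x := by
  refine ⟨fun hx a b hab => hab x hx, fun hx => ?_⟩
  obtain ⟨A, hA, rfl⟩ := h
  simp only [Submodule.mem_iInf]
  intro α hα
  have hle : (⨅ α ∈ A, (ℝ ∙ α)ᗮ) ≤ (ℝ ∙ α)ᗮ := iInf₂_le α hα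
  have hαmem : α ∈ (⨅ α ∈ A, (ℝ ∙ α)ᗮ)ᗮ :=
    Submodule.orthogonal_le hle (Submodule.le_orthogonal_orthogonal _
      (Submodule.mem_span_singleton_self α))
  rw [Submodule.mem_orthogonal_singleton_iff_inner_right]
  obtain ⟨a, b, -, ⟨-, rfl⟩ | ⟨hb, rfl⟩⟩ := exists_root_pair (hA hα)
  · rw [inner_sub_left, ← coord_eq_inner, ← coord_eq_inner, sub_eq_zero]
    exact hx a b (rel_iff_inner.2 hαmem)
  · rw [← coord_eq_inner]
    have := hx a (negIdx a) (rel_neg_iff_inner.2 hαmem)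
    rw [coord_negIdx] at this
    linarith

theorem eq_of_rel_eq {π ρ : Submodule ℝ (V n)} (hπ : π ∈ setPartitions n)
    (hρ : ρ ∈ setPartitions n) (h : rel π = rel ρ) : π = ρ := by
  ext x
  rw [mem_setPartition hπ, mem_setPartition hρ, h]

open Classical in
/-- The antisymmetrized indicator vector of a set of signed indices. -/
def indVec (S : Set (SIdx n)) : V n :=
  WithLp.toLp 2 fun i => (if (i, 1) ∈ S then 1 else 0) - (if (i, -1) ∈ S then 1 else 0)

open Classical in
theorem coord_indVec (S : Set (SIdx n)) (a : SIdx n) :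
    coord a (indVec S) = (if a ∈ S then 1 else 0) - (if negIdx a ∈ S then 1 else 0) := by
  rcases a with ⟨i, u⟩
  rcases Int.units_eq_one_or u with rfl | rfl <;> simp [coord, indVec, negIdx]; congr

theorem coord_indVec_congr {S : Set (SIdx n)} {a b : SIdx n} (h1 : a ∈ S ↔ b ∈ S)
    (h2 : negIdx a ∈ S ↔ negIdx b ∈ S) : coord a (indVec S) = coord b (indVec S) := by
  classical
  rw [coord_indVec, coord_indVec, if_congr h1 rfl rfl, if_congr h2 rfl rfl]

theorem indVec_mem {π : Submodule ℝ (V n)} (h : π ∈ setPartitions n) {S : Set (SIdx n)}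
    (hS : ∀ a b, rel π a b → (a ∈ S ↔ b ∈ S)) : indVec S ∈ π := by
  rw [mem_setPartition h]
  intro a b hab
  exact coord_indVec_congr (hS a b hab) (hS _ _ ((isBPart_rel π).neg a b hab))

end
end TypeB

namespace TypeB
noncomputable section

variable {n : ℕ}

/-! ### Signed permutations -/

/-- The group of signed permutations. -/
def G (n : ℕ) : Subgroup (Equiv.Perm (SIdx n)) where
  carrier := {g | ∀ a, g (negIdx a) = negIdx (g a)}
  mul_mem' := by
    intro g h hg hh a
    simp only [Set.mem_ofPred_eq] at hg hh
    simp [hh a, hg (h a)]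
  one_mem' := by simp
  inv_mem' := by
    intro g hg a
    simp only [Set.mem_ofPred_eq] at hg
    rw [Equiv.Perm.inv_eq_iff_eq, hg]
    simp

theorem G.apply_negIdx (g : G n) (a : SIdx n) : g.1 (negIdx a) = negIdx (g.1 a) := g.2 a

theorem G.inv_apply_negIdx (g : G n) (a : SIdx n) :
    g.1⁻¹ (negIdx a) = negIdx (g.1⁻¹ a) := (g⁻¹).2 a

instance : Fintype (G n) := Fintype.ofFinite _

/-- The action of a signed permutation on vectors, as a function. -/
def actFun (g : G n) (x : V n) : V n := WithLp.toLp 2 fun i => coord (g.1⁻¹ (i, 1)) x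

@[simp] theorem coord_actFun (g : G n) (x : V n) (a : SIdx n) :
    coord a (actFun g x) = coord (g.1⁻¹ a) x := by
  have h (i : Fin n) : coord (i, 1) (actFun g x) = coord (g.1⁻¹ (i, 1)) x := by
    simp [coord, actFun]
  rcases a with ⟨i, u⟩
  rcases Int.units_eq_one_or u with rfl | rfl
  · exact h i
  · have : ((i, -1) : SIdx n) = negIdx (i, 1) := by simp [negIdx]
    rw [this, G.inv_apply_negIdx, coord_negIdx, coord_negIdx, h]

theorem two_mul_norm_sq (x : V n) : 2 * ‖x‖ ^ 2 = ∑ a : SIdx n, coord a x ^ 2 := by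
  rw [EuclideanSpace.norm_sq_eq, Fintype.sum_prod_type, Finset.mul_sum]
  refine Finset.sum_congr rfl fun i _ => ?_
  have (u : ℤˣ) : coord (i, u) x ^ 2 = x i ^ 2 := by
    rcases Int.units_eq_one_or u with rfl | rfl <;> simp [coord]
  simp [this]

/-- The action of signed permutations on the standard representation. -/
def act : G n →* (V n ≃ₗᵢ[ℝ] V n) where
  toFun g :=
    { toFun := actFun g
      invFun := actFun g⁻¹
      map_add' := fun x y => ext_coord fun a => by simp
      map_smul' := fun t x => ext_coord fun a => by simp
      left_inv := fun x => ext_coord fun a => by simp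
      right_inv := fun x => ext_coord fun a => by simp
      norm_map' := fun x => by
        have h : 2 * ‖actFun g x‖ ^ 2 = 2 * ‖x‖ ^ 2 := by
          rw [two_mul_norm_sq, two_mul_norm_sq]
          simp only [coord_actFun]
          exact Equiv.sum_comp g.1⁻¹ fun a => coord a x ^ 2
        have h' : ‖actFun g x‖ ^ 2 = ‖x‖ ^ 2 := by linarith
        exact (sq_eq_sq₀ (norm_nonneg _) (norm_nonneg _)).1 h' }
  map_one' := LinearIsometryEquiv.ext fun x => ext_coord fun a => coord_actFun 1 x a
  map_mul' g h := LinearIsometryEquiv.ext fun x => ext_coord fun a => by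
    change coord a (actFun (g * h) x) = coord a (actFun g (actFun h x))
    simp

@[simp] theorem coord_act (g : G n) (x : V n) (a : SIdx n) :
    coord a (act g x) = coord (g.1⁻¹ a) x := coord_actFun g x a

theorem act_E (g : G n) (a : SIdx n) : act g (E a) = E (g.1 a) := by
  classical
  refine ext_coord fun b => ?_
  rw [coord_act, coord_E, coord_E, ← G.apply_negIdx]
  simp only [Equiv.Perm.inv_eq_iff_eq]

open Classical in
/-- The reflection exchanging `a` with `b` and `-a` with `-b`, as a signed permutation. -/
def sw (a b : SIdx n) : G n :=
  if h : b = negIdx a then ⟨Equiv.swap a b, fun c => by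
      subst h
      simp only [Equiv.swap_apply_def]
      split_ifs <;> simp_all [negIdx_eq_iff]⟩
  else if h' : a = b then 1
  else ⟨Equiv.swap a b * Equiv.swap (negIdx a) (negIdx b), fun c => by
      have h1 : a ≠ negIdx b := fun h1 => h (negIdx_eq_iff.1 h1.symm ▸ by simp)
      simp only [Equiv.Perm.mul_apply, Equiv.swap_apply_def]
      split_ifs <;> simp_all [negIdx_eq_iff]⟩

theorem sw_apply_left (a b : SIdx n) : (sw a b).1 a = b := by
  classical
  unfold sw
  split_ifs with h h'
  · simp
  · simp [h']
  · have h1 : a ≠ negIdx b := fun h1 => h (negIdx_eq_iff.1 h1.symm ▸ by simp)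
    simp [Equiv.swap_apply_of_ne_of_ne (ne_negIdx a) h1]

theorem sw_apply_right (a b : SIdx n) : (sw a b).1 b = a := by
  classical
  unfold sw
  split_ifs with h h'
  · simp
  · simp [h']
  · simp [Equiv.swap_apply_of_ne_of_ne h (ne_negIdx b)]

theorem sw_apply_of_ne {a b c : SIdx n} (h1 : c ≠ a) (h2 : c ≠ b) (h3 : c ≠ negIdx a)
    (h4 : c ≠ negIdx b) : (sw a b).1 c = c := by
  classical
  unfold sw
  split_ifs with h h'
  · simp [Equiv.swap_apply_of_ne_of_ne h1 h2]
  · simp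
  · simp [Equiv.swap_apply_of_ne_of_ne h1 h2, Equiv.swap_apply_of_ne_of_ne h3 h4]

theorem sw_inv (a b : SIdx n) : (sw a b)⁻¹ = sw a b := by
  rw [inv_eq_iff_mul_eq_one]
  ext1
  ext1 c
  change (sw a b).1 ((sw a b).1 c) = c
  by_cases h1 : c = a
  · rw [h1, sw_apply_left, sw_apply_right]
  by_cases h2 : c = b
  · rw [h2, sw_apply_right, sw_apply_left]
  by_cases h3 : c = negIdx a
  · rw [h3, G.apply_negIdx, G.apply_negIdx, sw_apply_left, sw_apply_right]
  by_cases h4 : c = negIdx b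
  · rw [h4, G.apply_negIdx, G.apply_negIdx, sw_apply_right, sw_apply_left]
  rw [sw_apply_of_ne h1 h2 h3 h4, sw_apply_of_ne h1 h2 h3 h4]

theorem refl_apply (α x : V n) : refl α x = x - (2 * (inner ℝ α x / ‖α‖ ^ 2)) • α := by
  rw [refl, Submodule.reflection_orthogonal_apply, Submodule.reflection_singleton_apply]
  rw [neg_sub, ← smul_assoc]
  simp

theorem refl_smul {t : ℝ} (ht : t ≠ 0) (α : V n) : refl (t • α) = refl α := by
  have : (ℝ ∙ (t • α)) = ℝ ∙ α := Submodule.span_singleton_smul_eq (IsUnit.mk0 t ht) α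
  ext1 x
  simp only [refl, this]

theorem refl_neg (α : V n) : refl (-α) = refl α := by
  have := refl_smul (n := n) (t := -1) (by norm_num) α
  simpa using this

theorem norm_E_sub_E_sq {a b : SIdx n} (hab : a ≠ b) (h : b ≠ negIdx a) :
    ‖E a - E b‖ ^ 2 = 2 := by
  have h' : a ≠ negIdx b := fun h1 => h (by rw [h1]; simp)
  rw [← real_inner_self_eq_norm_sq, inner_sub_left, ← coord_eq_inner, ← coord_eq_inner]
  simp [coord_E, hab, h, h', hab.symm]
  norm_num

theorem norm_E_sq (a : SIdx n) : ‖E a‖ ^ 2 = 1 := by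
  rw [← real_inner_self_eq_norm_sq, ← coord_eq_inner, coord_E_self]

/-- Both root lengths are covered at once: for b = -a the vector is 2 E a, whose reflection is that
of the short root. -/
theorem refl_E_sub_E {a b : SIdx n} (hab : a ≠ b) : refl (E a - E b) = act (sw a b) := by
  classical
  ext1 x
  refine ext_coord fun c => ?_
  rw [coord_act, ← Subgroup.coe_inv, sw_inv]
  by_cases h : b = negIdx a
  · have : E a - E b = (2 : ℝ) • E a := by rw [h, E_negIdx, two_smul]; abel
    rw [this, refl_smul two_ne_zero, refl_apply, norm_E_sq, ← coord_eq_inner, coord_sub,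
      coord_smul, coord_E]
    by_cases h1 : c = a
    · subst h1
      rw [sw_apply_left, h]
      simp
      ring
    by_cases h2 : c = negIdx a
    · rw [h2, ← h, sw_apply_right, h]
      simp
      ring
    rw [sw_apply_of_ne h1 (h ▸ h2) h2 (by simpa [h] using h1)]
    simp [h1, h2]
  · have h' : a ≠ negIdx b := fun h1 => h (by rw [h1]; simp)
    rw [refl_apply, norm_E_sub_E_sq hab h, inner_sub_left, ← coord_eq_inner, ← coord_eq_inner,
      coord_sub, coord_smul, coord_sub, coord_E, coord_E]
    by_cases h1 : c = a
    · subst h1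
      rw [sw_apply_left]
      simp [hab, h']
      try ring
    by_cases h2 : c = b
    · subst h2
      rw [sw_apply_right]
      simp [hab.symm, h]
      try ring
    by_cases h3 : c = negIdx a
    · subst h3
      rw [G.apply_negIdx, sw_apply_left]
      simp [negIdx_eq_iff, hab, h']
      try ring
    by_cases h4 : c = negIdx b
    · subst h4
      rw [G.apply_negIdx, sw_apply_right]
      simp [negIdx_eq_iff, hab.symm, h]
      try ring
    rw [sw_apply_of_ne h1 h2 h3 h4]
    simp [h1, h2, h3, h4]

theorem refl_E_sub_E_mem {a b : SIdx n} (hab : a ≠ b) : refl (E a - E b) ∈ reflections n := by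
  wlog h : sv a < sv b generalizing a b
  · have h' : sv b < sv a := lt_of_le_of_ne (not_lt.1 h) fun h => hab (sv_injective h.symm)
    have := this hab.symm h'
    rwa [← refl_neg, neg_sub] at this
  by_cases hb : b = negIdx a
  · have : E a - E b = (2 : ℝ) • E a := by rw [hb, E_negIdx, two_smul]; abel
    rw [this, refl_smul two_ne_zero]
    exact ⟨_, (root_pair_mem h).2 hb, rfl⟩
  · exact ⟨_, (root_pair_mem h).1 hb, rfl⟩

theorem reflections_subset_range_act {t : V n ≃ₗᵢ[ℝ] V n} (ht : t ∈ reflections n) :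
    ∃ a b : SIdx n, a ≠ b ∧ t = act (sw a b) ∧ t = refl (E a - E b) := by
  obtain ⟨α, hα, rfl⟩ := ht
  obtain ⟨a, b, hab, ⟨-, rfl⟩ | ⟨hb, rfl⟩⟩ := exists_root_pair hα
  · have h : a ≠ b := by rintro rfl; simp at hab
    exact ⟨a, b, h, refl_E_sub_E h, rfl⟩
  · have h : a ≠ b := by rintro rfl; simp at hab
    have : E a - E b = (2 : ℝ) • E a := by rw [hb, E_negIdx, two_smul]; abel
    have h2 : refl (E a) = refl (E a - E b) := by rw [this, refl_smul two_ne_zero]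
    exact ⟨a, b, h, h2.trans (refl_E_sub_E h), h2⟩

/-- The simple reflections as signed permutations. -/
def simpSw (i : Fin n) : G n :=
  if i.val = 0 then sw (i, -1) (i, 1) else sw (⟨i.val - 1, by omega⟩, 1) (i, 1)

theorem act_simpSw (i : Fin n) : act (simpSw i) = refl (simpleRoot i) := by
  unfold simpSw simpleRoot
  split_ifs with h
  · rw [← refl_E_sub_E (by simp)]
    have : E (i, (-1 : ℤˣ)) - E (i, 1) = (2 : ℝ) • (-e i) := by
      rw [two_smul]
      simp [E]
      abel
    rw [this, refl_smul two_ne_zero]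
  · rw [← refl_E_sub_E]
    · simp [E]
    · simp [Fin.ext_iff]
      omega

theorem sw_conj (g : G n) (a b : SIdx n) : g * sw a b * g⁻¹ = sw (g.1 a) (g.1 b) := by
  rw [mul_inv_eq_iff_eq_mul]
  ext1
  ext1 c
  change g.1 ((sw a b).1 c) = (sw (g.1 a) (g.1 b)).1 (g.1 c)
  by_cases h1 : c = a
  · rw [h1, sw_apply_left, sw_apply_left]
  by_cases h2 : c = b
  · rw [h2, sw_apply_right, sw_apply_right]
  by_cases h3 : c = negIdx a
  · rw [h3, G.apply_negIdx, sw_apply_left, G.apply_negIdx, G.apply_negIdx, G.apply_negIdx,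
      sw_apply_left]
  by_cases h4 : c = negIdx b
  · rw [h4, G.apply_negIdx, sw_apply_right, G.apply_negIdx, G.apply_negIdx, G.apply_negIdx,
      sw_apply_right]
  rw [sw_apply_of_ne h1 h2 h3 h4, sw_apply_of_ne] <;>
    simp [← G.apply_negIdx, h1, h2, h3, h4]

/-- Composing g with the reflection exchanging a and g a makes a fixed and moves no point that g
fixed, so induction on the number of moved points writes g as a product of reflections. -/
theorem closure_sw {H : Subgroup (G n)} (h : ∀ a b, a ≠ b → sw a b ∈ H) : H = ⊤ := by
  classical
  rw [eq_top_iff]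
  rintro g -
  induction hk : (Finset.univ.filter fun a => g.1 a ≠ a).card using Nat.strong_induction_on
    generalizing g with
  | _ k ih =>
    by_cases hg : ∀ a, g.1 a = a
    · have : g = 1 := by ext1; ext1 a; exact hg a
      rw [this]
      exact H.one_mem
    push Not at hg
    obtain ⟨a, ha⟩ := hg
    have hmem : sw a (g.1 a) * g ∈ H := by
      refine ih (Finset.univ.filter fun c => (sw a (g.1 a) * g).1 c ≠ c).card ?_ rfl
      rw [← hk]
      apply Finset.card_lt_card
      have hfix : (sw a (g.1 a) * g).1 a = a := sw_apply_right _ _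
      rw [Finset.ssubset_iff_of_subset]
      · exact ⟨a, by simpa using ha, by simp only [Finset.mem_filter, not_and, not_not]; exact fun _ => hfix⟩
      · intro c
        simp only [Finset.mem_filter, Finset.mem_univ, true_and]
        intro hc hgc
        apply hc
        change (sw a (g.1 a)).1 (g.1 c) = c
        rw [hgc]
        apply sw_apply_of_ne
        · rintro rfl; exact ha hgc
        · intro h'; apply ha; rw [h'] at hgc; exact g.1.injective hgc
        · rintro rfl; rw [G.apply_negIdx] at hgc; exact ha (by simpa using hgc)
        · intro h'
          apply ha
          rw [h', G.apply_negIdx] at hgc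
          exact g.1.injective (by simpa using hgc)
    have := H.mul_mem (H.inv_mem (h a (g.1 a) (Ne.symm ha))) hmem
    simpa using this

/-- Conjugating adjacent transpositions gives all transpositions of positive indices; conjugating
the first sign change by these gives every sign change; conjugating transpositions by sign changes
gives the mixed ones. -/
theorem sw_mem_of_simple {H : Subgroup (G n)} (h : ∀ i, simpSw i ∈ H) (a b : SIdx n) :
    sw a b ∈ H := by
  have hpos : ∀ d (i j : Fin n), j.val = i.val + d → sw (i, 1) (j, 1) ∈ H := by
    intro d
    induction d with
    | zero =>
      intro i j hij
      obtain rfl : i = j := by ext; omega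
      have : sw ((i, 1) : SIdx n) (i, 1) = 1 := by
        simp [sw]
      rw [this]; exact H.one_mem
    | succ d ih =>
      intro i j hij
      obtain ⟨j', hj'⟩ : ∃ j' : Fin n, j'.val = j.val - 1 := ⟨⟨j.val - 1, by omega⟩, rfl⟩
      have h1 := ih i j' (by omega)
      have h2 := h j
      rw [simpSw, if_neg (by omega)] at h2
      have hjj : (⟨j.val - 1, by omega⟩ : Fin n) = j' := Fin.ext hj'.symm
      rw [hjj] at h2
      have h3 := sw_conj (sw ((j', 1) : SIdx n) (j, 1)) (i, 1) (j', 1)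
      rw [sw_apply_left] at h3
      by_cases hd : d = 0
      · subst hd
        obtain rfl : i = j' := Fin.ext (by omega)
        exact h2
      rw [sw_apply_of_ne] at h3
      · rw [← h3]
        exact H.mul_mem (H.mul_mem h2 h1) (H.inv_mem h2)
      all_goals simp [negIdx, Fin.ext_iff]
      all_goals omega
  have hflip : ∀ i : Fin n, sw ((i, -1) : SIdx n) (i, 1) ∈ H := by
    intro i
    obtain ⟨z, hz0⟩ : ∃ z : Fin n, z.val = 0 := ⟨⟨0, i.pos⟩, rfl⟩
    have h0 := h z
    rw [simpSw, if_pos hz0] at h0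
    by_cases hi : i = z
    · rw [hi]; exact h0
    have h1 := hpos i.val z i (by omega)
    have h3 := sw_conj (sw ((z, 1) : SIdx n) (i, 1)) (z, -1) (z, 1)
    have hz : ((z, -1) : SIdx n) = negIdx (z, 1) := by simp [negIdx]
    have hi' : ((i, -1) : SIdx n) = negIdx (i, 1) := by simp [negIdx]
    rw [hz, G.apply_negIdx, sw_apply_left, ← hz] at h3
    rw [hi', ← h3]
    exact H.mul_mem (H.mul_mem h1 h0) (H.inv_mem h1)
  have hcomm (a b : SIdx n) : sw a b = sw b a := by
    ext1; ext1 c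
    by_cases h1 : c = a
    · rw [h1, sw_apply_left, sw_apply_right]
    by_cases h2 : c = b
    · rw [h2, sw_apply_left, sw_apply_right]
    by_cases h3 : c = negIdx a
    · rw [h3, G.apply_negIdx, G.apply_negIdx, sw_apply_left, sw_apply_right]
    by_cases h4 : c = negIdx b
    · rw [h4, G.apply_negIdx, G.apply_negIdx, sw_apply_left, sw_apply_right]
    rw [sw_apply_of_ne h1 h2 h3 h4, sw_apply_of_ne h2 h1 h4 h3]
  have hpos' (i j : Fin n) : sw ((i, 1) : SIdx n) (j, 1) ∈ H := by
    rcases le_total i.val j.val with hij | hij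
    · exact hpos (j.val - i.val) i j (by omega)
    · rw [hcomm]
      exact hpos (i.val - j.val) j i (by omega)
  have hnn (a b : SIdx n) : sw (negIdx a) (negIdx b) = sw a b := by
    ext1; ext1 c
    by_cases h1 : c = a
    · rw [h1, sw_apply_left, ← negIdx_negIdx a, G.apply_negIdx, negIdx_negIdx, sw_apply_left,
        negIdx_negIdx]
    by_cases h2 : c = b
    · rw [h2, sw_apply_right, ← negIdx_negIdx b, G.apply_negIdx, negIdx_negIdx, sw_apply_right,
        negIdx_negIdx]
    by_cases h3 : c = negIdx a
    · rw [h3, sw_apply_left, G.apply_negIdx, sw_apply_left]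
    by_cases h4 : c = negIdx b
    · rw [h4, sw_apply_right, G.apply_negIdx, sw_apply_right]
    rw [sw_apply_of_ne h1 h2 h3 h4, sw_apply_of_ne h3 h4 (by simpa using h1) (by simpa using h2)]
  have hmix (i j : Fin n) : sw ((i, 1) : SIdx n) (j, -1) ∈ H := by
    have hj' : ((j, -1) : SIdx n) = negIdx (j, 1) := by simp [negIdx]
    by_cases hij : i = j
    · rw [hij, hcomm]; exact hflip j
    have h3 := sw_conj (sw ((j, -1) : SIdx n) (j, 1)) (i, 1) (j, 1)
    rw [sw_apply_right, sw_apply_of_ne (by simp [hij]) (by simp [hij]) (by simp [negIdx, hij])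
      (by simp [negIdx, hij])] at h3
    rw [← h3]
    exact H.mul_mem (H.mul_mem (hflip j) (hpos' i j)) (H.inv_mem (hflip j))
  rcases a with ⟨i, u⟩
  rcases b with ⟨j, v⟩
  rcases Int.units_eq_one_or u with rfl | rfl <;> rcases Int.units_eq_one_or v with rfl | rfl
  · exact hpos' i j
  · exact hmix i j
  · rw [hcomm]; exact hmix j i
  · rw [← hnn]
    simpa [negIdx] using hpos' i j

theorem W_eq_range : W n = (act (n := n)).range := by
  apply le_antisymm
  · rw [W, Subgroup.closure_le]
    rintro _ ⟨i, rfl⟩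
    exact ⟨simpSw i, act_simpSw i⟩
  · have : (W n).comap act = ⊤ := by
      apply closure_sw
      intro a b _
      apply sw_mem_of_simple
      intro i
      rw [Subgroup.mem_comap, act_simpSw]
      exact Subgroup.subset_closure ⟨i, rfl⟩
    rintro _ ⟨g, rfl⟩
    have hg : g ∈ (W n).comap act := this ▸ Subgroup.mem_top g
    exact hg

theorem coxeterElement_eq_act (σ : Equiv.Perm (Fin n)) :
    coxeterElement σ = act (List.ofFn fun i => simpSw (σ i)).prod := by
  rw [coxeterElement, map_list_prod, List.map_ofFn]
  congr 2
  ext1 i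
  exact (act_simpSw _).symm

end
end TypeB

namespace TypeB
noncomputable section

variable {n : ℕ}

/-! ### Simple roots of stabilizers and interval refinements -/

open Classical in
/-- The root attached to a pair of signed indices. -/
def root (a b : SIdx n) : V n := if b = negIdx a then E a else E a - E b

theorem mem_stabPosRoots {π : Submodule ℝ (V n)} {α : V n} :
    α ∈ stabPosRoots π ↔ ∃ a b, sv a < sv b ∧ rel π a b ∧ α = root a b := by
  constructor
  · rintro ⟨h1, h2⟩
    obtain ⟨a, b, hab, ⟨hb, rfl⟩ | ⟨hb, rfl⟩⟩ := exists_root_pair h1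
    · exact ⟨a, b, hab, rel_iff_inner.2 h2, by simp [root, hb]⟩
    · exact ⟨a, b, hab, hb ▸ rel_neg_iff_inner.2 h2, by simp [root, hb]⟩
  · rintro ⟨a, b, hab, hr, rfl⟩
    by_cases hb : b = negIdx a
    · simp only [root, if_pos hb]
      exact ⟨(root_pair_mem hab).2 hb, rel_neg_iff_inner.1 (hb ▸ hr)⟩
    · simp only [root, if_neg hb]
      exact ⟨(root_pair_mem hab).1 hb, rel_iff_inner.1 hr⟩

/-- Generically E a - E b = (E a - E t) + (E t - E b). For b = -a one may replace t by -t and take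
it negative, and then E a = (E a - E t) + E t. If t is -a or -b, the class is its own opposite, and
E a - E b is the sum of the short roots E a and E (-b). -/
theorem exists_decomposition {π : Submodule ℝ (V n)} {a t b : SIdx n} (h1 : sv a < sv t)
    (h2 : sv t < sv b) (hat : rel π a t) (htb : rel π t b) :
    ∃ β ∈ stabPosRoots π, ∃ γ ∈ stabPosRoots π, root a b = β + γ := by
  have hr := isBPart_rel π
  by_cases hb : b = negIdx a
  · subst hb
    have haz := hr.equiv.trans hat htb
    rw [sv_negIdx] at h2
    wlog ht : sv t < 0 generalizing t
    · have ht' := sv_ne_zero t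
      have hta : rel π a (negIdx t) :=
        hr.equiv.trans haz (hr.neg _ _ hat)
      have e1 : sv a < sv (negIdx t) := by rw [sv_negIdx]; omega
      have e2 : sv (negIdx t) < -sv a := by rw [sv_negIdx]; omega
      have e3 : sv (negIdx t) < 0 := by rw [sv_negIdx]; omega
      exact this (t := negIdx t) (h1 := e1) (h2 := e2) (hat := hta)
        (htb := hr.equiv.trans (hr.equiv.symm hta) haz) (ht := e3)
    have hta : t ≠ negIdx a := by
      rintro rfl
      simp at ht h2
    have htz : rel π t (negIdx t) :=
      hr.equiv.trans htb (hr.neg _ _ hat)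
    refine ⟨root a t, mem_stabPosRoots.2 ⟨a, t, h1, hat, rfl⟩, root t (negIdx t),
      mem_stabPosRoots.2 ⟨_, _, by simp; omega, htz, rfl⟩, ?_⟩
    simp [root, hta]
  · by_cases h : t = negIdx a ∨ t = negIdx b
    · have haz : rel π a (negIdx a) ∧ rel π b (negIdx b) := by
        rcases h with rfl | rfl
        · exact ⟨hat, hr.equiv.trans (hr.equiv.symm htb)
            (hr.equiv.trans (hr.equiv.symm hat) (by simpa using hr.neg _ _ htb))⟩
        · exact ⟨hr.equiv.trans (hr.equiv.trans hat htb) (by simpa using hr.equiv.symm (hr.neg _ _ hat)),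
            hr.equiv.symm htb⟩
      have hs : sv a < 0 ∧ 0 < sv b := by
        rcases h with rfl | rfl <;> simp at h1 h2 <;> constructor <;> omega
      refine ⟨root a (negIdx a), mem_stabPosRoots.2 ⟨_, _, by simp; omega, haz.1, rfl⟩,
        root (negIdx b) b, mem_stabPosRoots.2 ⟨_, _, by simp; omega, hr.equiv.symm haz.2, rfl⟩, ?_⟩
      simp [root, hb, sub_eq_add_neg]
    · push Not at h
      refine ⟨root a t, mem_stabPosRoots.2 ⟨_, _, h1, hat, rfl⟩, root t b,
        mem_stabPosRoots.2 ⟨_, _, h2, htb, rfl⟩, ?_⟩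
      have : b ≠ negIdx t := fun h' => h.2 (by simp [h'])
      simp [root, hb, h.1, this]

/-- `b` is the successor of `a` in its class. -/
def Consec (r : SIdx n → SIdx n → Prop) (a b : SIdx n) : Prop :=
  sv a < sv b ∧ r a b ∧ ∀ t, r a t → sv a < sv t → sv b ≤ sv t

open Classical in
/-- The number of smaller elements of the class minus the number of larger ones. -/
def height (r : SIdx n → SIdx n → Prop) (t : SIdx n) : ℤ :=
  (Finset.univ.filter fun u => r t u ∧ sv u < sv t).card -
    (Finset.univ.filter fun u => r t u ∧ sv t < sv u).card

theorem height_negIdx {r : SIdx n → SIdx n → Prop} (hr : IsBPart r) (t : SIdx n) :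
    height r (negIdx t) = -height r t := by
  classical
  have h1 : (Finset.univ.filter fun u => r (negIdx t) u ∧ sv u < sv (negIdx t)).card =
      (Finset.univ.filter fun u => r t u ∧ sv t < sv u).card := by
    refine Finset.card_nbij' negIdx negIdx ?_ ?_ (fun _ _ => by simp) (fun _ _ => by simp)
    · intro u
      simp only [Finset.coe_filter, Finset.mem_univ, true_and, Set.mem_ofPred_eq, sv_negIdx]
      rintro ⟨h, h'⟩
      exact ⟨by simpa using hr.neg _ _ h, by omega⟩
    · intro u
      simp only [Finset.coe_filter, Finset.mem_univ, true_and, Set.mem_ofPred_eq, sv_negIdx]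
      rintro ⟨h, h'⟩
      exact ⟨hr.neg _ _ h, by omega⟩
  have h2 : (Finset.univ.filter fun u => r (negIdx t) u ∧ sv (negIdx t) < sv u).card =
      (Finset.univ.filter fun u => r t u ∧ sv u < sv t).card := by
    refine Finset.card_nbij' negIdx negIdx ?_ ?_ (fun _ _ => by simp) (fun _ _ => by simp)
    · intro u
      simp only [Finset.coe_filter, Finset.mem_univ, true_and, Set.mem_ofPred_eq, sv_negIdx]
      rintro ⟨h, h'⟩
      exact ⟨by simpa using hr.neg _ _ h, by omega⟩
    · intro u
      simp only [Finset.coe_filter, Finset.mem_univ, true_and, Set.mem_ofPred_eq, sv_negIdx]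
      rintro ⟨h, h'⟩
      exact ⟨hr.neg _ _ h, by omega⟩
  rw [height, height, h1, h2]
  ring

/-- Moving up inside a class gains at least one smaller element and loses at least one larger one,
and for consecutive elements exactly one of each. Pairing with the height vector thus gives at least
2 on roots E a - E b and at least 1 on short roots. -/
theorem height_add_two_le {r : SIdx n → SIdx n → Prop} (hr : IsBPart r) {a b : SIdx n}
    (hab : sv a < sv b) (h : r a b) : height r a + 2 ≤ height r b := by
  classical
  have h1 : (Finset.univ.filter fun u => r a u ∧ sv u < sv a).card <
      (Finset.univ.filter fun u => r b u ∧ sv u < sv b).card := by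
    apply Finset.card_lt_card
    rw [Finset.ssubset_iff_of_subset]
    · exact ⟨a, by simpa using ⟨hr.equiv.symm h, hab⟩, by simp⟩
    · intro u
      simp only [Finset.mem_filter, Finset.mem_univ, true_and]
      rintro ⟨h3, h4⟩
      exact ⟨hr.equiv.trans (hr.equiv.symm h) h3, by omega⟩
  have h2 : (Finset.univ.filter fun u => r b u ∧ sv b < sv u).card <
      (Finset.univ.filter fun u => r a u ∧ sv a < sv u).card := by
    apply Finset.card_lt_card
    rw [Finset.ssubset_iff_of_subset]
    · exact ⟨b, by simpa using ⟨h, hab⟩, by simp⟩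
    · intro u
      simp only [Finset.mem_filter, Finset.mem_univ, true_and]
      rintro ⟨h3, h4⟩
      exact ⟨hr.equiv.trans h h3, by omega⟩
  simp only [height]
  omega

theorem Consec.height_eq {r : SIdx n → SIdx n → Prop} (hr : IsBPart r) {a b : SIdx n}
    (h : Consec r a b) : height r b = height r a + 2 := by
  classical
  obtain ⟨hab, hrab, hmin⟩ := h
  have h1 : (Finset.univ.filter fun u => r b u ∧ sv u < sv b) =
      insert a (Finset.univ.filter fun u => r a u ∧ sv u < sv a) := by
    ext u
    simp only [Finset.mem_filter, Finset.mem_univ, true_and, Finset.mem_insert]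
    constructor
    · rintro ⟨h3, h4⟩
      by_cases hu : u = a
      · exact Or.inl hu
      have h5 := hr.equiv.trans hrab h3
      have : sv u ≠ sv a := fun h => hu (sv_injective h)
      refine Or.inr ⟨h5, ?_⟩
      by_contra h6
      have := hmin u h5 (by omega)
      omega
    · rintro (rfl | ⟨h3, h4⟩)
      · exact ⟨hr.equiv.symm hrab, hab⟩
      · exact ⟨hr.equiv.trans (hr.equiv.symm hrab) h3, by omega⟩
  have h2 : (Finset.univ.filter fun u => r a u ∧ sv a < sv u) =
      insert b (Finset.univ.filter fun u => r b u ∧ sv b < sv u) := by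
    ext u
    simp only [Finset.mem_filter, Finset.mem_univ, true_and, Finset.mem_insert]
    constructor
    · rintro ⟨h3, h4⟩
      by_cases hu : u = b
      · exact Or.inl hu
      have : sv u ≠ sv b := fun h => hu (sv_injective h)
      have := hmin u h3 h4
      exact Or.inr ⟨hr.equiv.trans (hr.equiv.symm hrab) h3, by omega⟩
    · rintro (rfl | ⟨h3, h4⟩)
      · exact ⟨hrab, hab⟩
      · exact ⟨hr.equiv.trans hrab h3, by omega⟩
  simp only [height]
  rw [h1, h2, Finset.card_insert_of_notMem (by simp), Finset.card_insert_of_notMem (by simp)]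
  push_cast
  ring

/-- The vector with coordinates given by the height. -/
def heightVec (r : SIdx n → SIdx n → Prop) : V n := WithLp.toLp 2 fun i => -(height r (i, 1) : ℝ)

theorem coord_heightVec {r : SIdx n → SIdx n → Prop} (hr : IsBPart r) (t : SIdx n) :
    coord t (heightVec r) = -height r t := by
  rcases t with ⟨i, u⟩
  rcases Int.units_eq_one_or u with rfl | rfl
  · simp [coord, heightVec]
  · have : ((i, -1) : SIdx n) = negIdx (i, 1) := by simp [negIdx]
    rw [this, height_negIdx hr]
    simp [coord, heightVec, negIdx]

theorem inner_root_heightVec {r : SIdx n → SIdx n → Prop} (hr : IsBPart r) {a b : SIdx n}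
    (hab : sv a < sv b) (h : r a b) :
    (b = negIdx a ∧ root a b = E a ∧ inner ℝ (root a b) (heightVec r) = -(height r a : ℝ) ∧
      height r a ≤ -1) ∨
    (b ≠ negIdx a ∧ root a b = E a - E b ∧
      inner ℝ (root a b) (heightVec r) = (height r b : ℝ) - height r a ∧
      height r a + 2 ≤ height r b) := by
  have h2 := height_add_two_le hr hab h
  by_cases hb : b = negIdx a
  · left
    simp only [root, if_pos hb]
    refine ⟨hb, trivial, ?_, ?_⟩
    · rw [← coord_eq_inner, coord_heightVec hr]
    · rw [hb, height_negIdx hr] at h2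
      omega
  · right
    simp only [root, if_neg hb]
    refine ⟨hb, trivial, ?_, h2⟩
    rw [inner_sub_left, ← coord_eq_inner, ← coord_eq_inner, coord_heightVec hr, coord_heightVec hr]
    ring

/-- A root of a consecutive pair pairs with the height vector to 1 (short) or 2, the least possible
values. A sum of two positive roots pairs to at least 2, with equality only for two short roots of
height -1. These lie in the same zero class, so they coincide, and their sum 2 E c has no coordinate
equal to 1. -/
theorem Consec.root_ne_add {π : Submodule ℝ (V n)} {a b : SIdx n} (h : Consec (rel π) a b)
    {β γ : V n} (hβ : β ∈ stabPosRoots π) (hγ : γ ∈ stabPosRoots π) : root a b ≠ β + γ := by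
  classical
  intro heq
  have hr := isBPart_rel π
  obtain ⟨c, d, hcd, hrcd, rfl⟩ := mem_stabPosRoots.1 hβ
  obtain ⟨u, v, huv, hruv, rfl⟩ := mem_stabPosRoots.1 hγ
  have hin : inner ℝ (root a b) (heightVec (rel π)) =
      inner ℝ (root c d) (heightVec (rel π)) + inner ℝ (root u v) (heightVec (rel π)) := by
    rw [heq, inner_add_left]
  have h2 := h.height_eq hr
  rcases inner_root_heightVec hr h.1 h.2.1 with ⟨hb, -, e1, -⟩ | ⟨hb, f1, e1, -⟩ <;>
  rcases inner_root_heightVec hr hcd hrcd with ⟨hd, f2, e2, l2⟩ | ⟨hd, f2, e2, l2⟩ <;>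
  rcases inner_root_heightVec hr huv hruv with ⟨hv, f3, e3, l3⟩ | ⟨hv, f3, e3, l3⟩ <;>
  rw [e1, e2, e3] at hin <;> norm_cast at hin
  · rw [hb, height_negIdx hr] at h2; omega
  · rw [hb, height_negIdx hr] at h2; omega
  · rw [hb, height_negIdx hr] at h2; omega
  · rw [hb, height_negIdx hr] at h2; omega
  · have hcu : rel π c u := hr.zero c u (hd ▸ hrcd) (hv ▸ hruv)
    have : c = u := by
      by_contra hne
      rcases lt_or_gt_of_ne (fun h => hne (sv_injective h)) with h' | h'
      · have := height_add_two_le hr h' hcu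
        omega
      · have := height_add_two_le hr h' (hr.equiv.symm hcu)
        omega
    subst this
    have h3 := congrArg (coord a) heq
    rw [f1, f2, f3, coord_sub, coord_add, coord_E_self, coord_E, coord_E] at h3
    have hab : a ≠ b := by rintro rfl; exact lt_irrefl _ h.1
    have hab' : a ≠ negIdx b := fun h => hb (by rw [h]; simp)
    rw [if_neg hab, if_neg hab'] at h3
    split_ifs at h3 <;> norm_num at h3
  · omega
  · omega
  · omega

theorem mem_stabSimpleRoots {π : Submodule ℝ (V n)} {α : V n} :
    α ∈ stabSimpleRoots π ↔ ∃ a b, Consec (rel π) a b ∧ α = root a b := by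
  have hr := isBPart_rel π
  constructor
  · rintro ⟨h1, h2⟩
    obtain ⟨a, b, hab, hrab, rfl⟩ := mem_stabPosRoots.1 h1
    refine ⟨a, b, ⟨hab, hrab, fun t hat hlt => ?_⟩, rfl⟩
    by_contra hlt'
    obtain ⟨β, hβ, γ, hγ, h⟩ := exists_decomposition hlt (not_le.1 hlt') hat
      (hr.equiv.trans (hr.equiv.symm hat) hrab)
    exact h2 β hβ γ hγ h
  · rintro ⟨a, b, h, rfl⟩
    exact ⟨mem_stabPosRoots.2 ⟨a, b, h.1, h.2.1, rfl⟩, fun β hβ γ hγ => h.root_ne_add hβ hγ⟩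

/-- The classes of `r₂` are order-convex in those of `r₁`. -/
def Conv (r₂ r₁ : SIdx n → SIdx n → Prop) : Prop :=
  ∀ a t b, sv a < sv t → sv t < sv b → r₂ a b → r₁ a t → r₂ a t

/-- If t violates convexity, its nearest neighbours on both sides in the finer class are consecutive
there but separated by t in the coarser class, so their root becomes decomposable. Conversely
convexity keeps consecutive pairs consecutive. -/
theorem isIntervalRefinement_iff {π₂ π₁ : Submodule ℝ (V n)} (hle : π₁ ≤ π₂) :
    IsIntervalRefinement π₂ π₁ ↔ Conv (rel π₂) (rel π₁) := by
  classical
  have hr₂ := isBPart_rel π₂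
  have hr₁ := isBPart_rel π₁
  constructor
  · intro h a t b hat htb hab hr
    by_contra hn
    obtain ⟨a', ha', hmax⟩ := Finset.exists_max_image
      (Finset.univ.filter fun u => rel π₂ a u ∧ sv u < sv t) sv
      ⟨a, by simpa using ⟨hr₂.equiv.refl a, hat⟩⟩
    obtain ⟨b', hb', hmin⟩ := Finset.exists_min_image
      (Finset.univ.filter fun u => rel π₂ a u ∧ sv t < sv u) sv
      ⟨b, by simpa using ⟨hab, htb⟩⟩
    simp only [Finset.mem_filter, Finset.mem_univ, true_and] at ha' hb' hmax hmin
    have hc : Consec (rel π₂) a' b' := by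
      refine ⟨by omega, hr₂.equiv.trans (hr₂.equiv.symm ha'.1) hb'.1, fun u hu hlt => ?_⟩
      have hau := hr₂.equiv.trans ha'.1 hu
      have hut : sv u ≠ sv t := fun h => hn (sv_injective h ▸ hau)
      by_contra hlt'
      rcases lt_or_gt_of_ne hut with h' | h'
      · have := hmax u ⟨hau, h'⟩; omega
      · have := hmin u ⟨hau, h'⟩; omega
    obtain ⟨-, h2⟩ := h (mem_stabSimpleRoots.2 ⟨a', b', hc, rfl⟩)
    have h3 := hr₁.equiv.trans (hr₁.equiv.symm (rel_mono hle ha'.1)) hr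
    obtain ⟨β, hβ, γ, hγ, h⟩ := exists_decomposition ha'.2 hb'.2 h3
      (hr₁.equiv.trans (hr₁.equiv.symm h3) (rel_mono hle hc.2.1))
    exact h2 β hβ γ hγ h
  · intro h α hα
    obtain ⟨a, b, hc, rfl⟩ := mem_stabSimpleRoots.1 hα
    refine mem_stabSimpleRoots.2 ⟨a, b, ⟨hc.1, rel_mono hle hc.2.1, fun t hat hlt => ?_⟩, rfl⟩
    by_contra hlt'
    have := hc.2.2 t (h a t b hlt (not_le.1 hlt') hc.2.1 hat) hlt
    omega

end
end TypeB

namespace TypeB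
noncomputable section

variable {n : ℕ}

/-! ### Coxeter elements as cycles on the signed indices -/

theorem linearIndependent_simpleRoot : LinearIndependent ℝ (simpleRoot (n := n)) := by
  apply linearIndependent_of_top_le_span_of_card_eq_finrank
  · have hmem : ∀ k (hk : k < n), e (⟨k, hk⟩ : Fin n) ∈
        Submodule.span ℝ (Set.range (simpleRoot (n := n))) := by
      intro k
      induction k with
      | zero =>
        intro hk
        have h : simpleRoot (⟨0, hk⟩ : Fin n) ∈ Submodule.span ℝ (Set.range (simpleRoot (n := n))) :=
          Submodule.subset_span ⟨_, rfl⟩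
        rw [simpleRoot, if_pos rfl] at h
        simpa using Submodule.neg_mem _ h
      | succ k ih =>
        intro hk
        have h : simpleRoot (⟨k + 1, hk⟩ : Fin n) ∈
          Submodule.span ℝ (Set.range (simpleRoot (n := n))) := Submodule.subset_span ⟨_, rfl⟩
        rw [simpleRoot, if_neg (by simp)] at h
        have := Submodule.sub_mem _ (ih (by omega)) h
        simpa using this
    rintro x -
    have hx : x = ∑ i, x i • e i := by
      ext j
      simp [e, Finset.sum_apply, Pi.single_apply]
    rw [hx]
    exact Submodule.sum_mem _ fun i _ => Submodule.smul_mem _ _ (hmem i.1 i.2)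
  · simp

theorem refl_apply_sub_mem (α x : V n) : refl α x - x ∈ ℝ ∙ α := by
  rw [refl_apply, sub_sub_cancel_left]
  exact Submodule.neg_mem _ (Submodule.smul_mem _ _ (Submodule.mem_span_singleton_self α))

theorem inner_eq_zero_of_refl_eq {α x : V n} (h : refl α x = x) : inner ℝ α x = 0 := by
  rw [refl_apply, sub_eq_self, smul_eq_zero] at h
  rcases h with h | h
  · by_cases hα : α = 0
    · simp [hα]
    · have : ‖α‖ ^ 2 ≠ 0 := by simpa using hα
      simpa [this, hα] using h
  · simp [h]

theorem refl_eq_of_inner_eq_zero {α x : V n} (h : inner ℝ α x = 0) : refl α x = x := by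
  rw [refl_apply, h]
  simp

theorem prod_simple_sub_mem (L : List (Fin n)) (x : V n) :
    (L.map fun i => refl (simpleRoot i)).prod x - x ∈
      Submodule.span ℝ (simpleRoot '' {i | i ∈ L}) := by
  induction L with
  | nil => simp
  | cons i L ih =>
    rw [List.map_cons, List.prod_cons, LinearIsometryEquiv.coe_mul, Function.comp_apply]
    have h1 : simpleRoot '' {j | j ∈ L} ⊆ simpleRoot '' {j | j ∈ i :: L} :=
      Set.image_mono fun j hj => List.mem_cons_of_mem _ hj
    have h2 := Submodule.span_mono (R := ℝ) h1 ih
    have h3 : (ℝ ∙ simpleRoot i) ≤ Submodule.span ℝ (simpleRoot '' {j | j ∈ i :: L}) := by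
      apply Submodule.span_mono
      rintro _ rfl
      exact ⟨i, by simp, rfl⟩
    have := Submodule.add_mem _ (h3 (refl_apply_sub_mem _ ((L.map fun i => refl (simpleRoot i)).prod x))) h2
    simpa using this

/-- If the product fixes x, the displacement by the first reflection lies on its root and cancels
the displacement by the others, which lies in the span of the other roots. By linear independence
both vanish, and induction applies to the tail. -/
theorem inner_simpleRoot_of_fixed (L : List (Fin n)) (hL : L.Nodup) (x : V n)
    (hx : (L.map fun i => refl (simpleRoot i)).prod x = x) :
    ∀ i ∈ L, inner ℝ (simpleRoot i) x = 0 := by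
  induction L with
  | nil => simp
  | cons i L ih =>
    rw [List.nodup_cons] at hL
    rw [List.map_cons, List.prod_cons, LinearIsometryEquiv.coe_mul, Function.comp_apply] at hx
    have h1 := prod_simple_sub_mem L x
    have h2 := refl_apply_sub_mem (simpleRoot i) ((L.map fun i => refl (simpleRoot i)).prod x)
    rw [hx] at h2
    have hd : Disjoint (Submodule.span ℝ (simpleRoot '' {j | j ∈ L}))
        (Submodule.span ℝ (simpleRoot '' ({i} : Set (Fin n)))) :=
      linearIndependent_simpleRoot.disjoint_span_image (by simpa using hL.1)
    rw [Set.image_singleton] at hd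
    have h3 := Submodule.disjoint_def.1 hd _ h1 (by simpa using Submodule.neg_mem _ h2)
    rw [sub_eq_zero] at h3
    rw [h3] at hx
    intro j hj
    rcases List.mem_cons.1 hj with rfl | hj
    · exact inner_eq_zero_of_refl_eq hx
    · exact ih hL.2 h3 j hj

theorem coxeterElement_fixed (σ : Equiv.Perm (Fin n)) (x : V n) (h : coxeterElement σ x = x) :
    x = 0 := by
  have h1 : coxeterElement σ = ((List.ofFn σ).map fun i => refl (simpleRoot i)).prod := by
    rw [coxeterElement, List.map_ofFn]
    rfl
  rw [h1] at h
  have h2 := inner_simpleRoot_of_fixed _ (List.nodup_ofFn.2 σ.injective) x h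
  have h3 : ∀ y ∈ Submodule.span ℝ (Set.range (simpleRoot (n := n))), inner ℝ y x = 0 := by
    intro y hy
    induction hy using Submodule.span_induction with
    | mem y hy =>
      obtain ⟨i, rfl⟩ := hy
      exact h2 i ((List.mem_ofFn' _ _).2 ⟨σ.symm i, by simp⟩)
    | zero => simp
    | add y z _ _ hy hz => rw [inner_add_left, hy, hz, add_zero]
    | smul t y _ hy => rw [inner_smul_left, hy, mul_zero]
  have h4 : Submodule.span ℝ (Set.range (simpleRoot (n := n))) = ⊤ :=
    linearIndependent_simpleRoot.span_eq_top_of_card_eq_finrank' (by simp)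
  exact inner_self_eq_zero.1 (h3 x (h4 ▸ Submodule.mem_top))

/-- The crossings of the cuts of the signed indices by a simple reflection. -/
theorem simpSw_exit {i : Fin n} {t : ℤ} {a : SIdx n} (h1 : sv a < t)
    (h2 : t ≤ sv ((simpSw i).1 a)) :
    (i.val = 0 ∧ sv a = -1 ∧ (t = 0 ∨ t = 1)) ∨
      (i.val ≠ 0 ∧ sv a = i.val ∧ t = i.val + 1) ∨
      (i.val ≠ 0 ∧ sv a = -(i.val + 1) ∧ t = -i.val) := by
  have key {b c : SIdx n} (hs : sv b < sv c) (h2 : t ≤ sv ((sw b c).1 a)) :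
      (a = b ∧ t ≤ sv c) ∨ (a = negIdx c ∧ t ≤ -sv b) := by
    by_cases h3 : a = b
    · rw [h3, sw_apply_left] at h2
      exact Or.inl ⟨h3, h2⟩
    by_cases h4 : a = c
    · rw [h4, sw_apply_right] at h2
      rw [h4] at h1
      omega
    by_cases h5 : a = negIdx b
    · rw [h5, G.apply_negIdx, sw_apply_left, sv_negIdx] at h2
      rw [h5, sv_negIdx] at h1
      omega
    by_cases h6 : a = negIdx c
    · rw [h6, G.apply_negIdx, sw_apply_right, sv_negIdx] at h2
      exact Or.inr ⟨h6, h2⟩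
    rw [sw_apply_of_ne h3 h4 h5 h6] at h2
    omega
  unfold simpSw at h2
  split_ifs at h2 with hi
  · have e1 : sv ((i, -1) : SIdx n) = -1 := by simp [sv, hi]
    have e2 : sv ((i, 1) : SIdx n) = 1 := by simp [sv, hi]
    rcases key (by omega) h2 with ⟨h3, h4⟩ | ⟨h3, h4⟩
    · rw [h3, e1] at h1 ⊢
      omega
    · rw [h3, sv_negIdx, e2] at h1 ⊢
      omega
  · have e1 : sv ((⟨i.val - 1, by omega⟩, 1) : SIdx n) = i.val := by
      simp only [sv]; push_cast; omega
    have e2 : sv ((i, 1) : SIdx n) = i.val + 1 := by simp [sv]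
    rcases key (by omega) h2 with ⟨h3, h4⟩ | ⟨h3, h4⟩
    · rw [h3, e1] at h1 ⊢
      omega
    · rw [h3, sv_negIdx, e2] at h1 ⊢
      omega

theorem prod_simpSw_exit (L : List (Fin n)) (t : ℤ) (a : SIdx n) (h1 : sv a < t)
    (h2 : t ≤ sv ((L.map simpSw).prod.1 a)) :
    ∃ i ∈ L, ∃ b, sv b < t ∧ t ≤ sv ((simpSw i).1 b) := by
  induction L with
  | nil => simp at h2; omega
  | cons i L ih =>
    rw [List.map_cons, List.prod_cons] at h2
    by_cases h3 : t ≤ sv ((L.map simpSw).prod.1 a)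
    · obtain ⟨j, hj, h⟩ := ih h3
      exact ⟨j, List.mem_cons_of_mem _ hj, h⟩
    · exact ⟨i, List.mem_cons_self, _, not_le.1 h3, h2⟩

/-- A threshold t is crossed upwards by at most one simple reflection, and by only one index under
it. As the letters are distinct, either the last reflection applied makes the crossing and the
others never do, or it does not and can be removed. -/
theorem prod_simpSw_exit_unique (L : List (Fin n)) (hL : L.Nodup) (t : ℤ) (a b : SIdx n)
    (ha : sv a < t) (ha' : t ≤ sv ((L.map simpSw).prod.1 a))
    (hb : sv b < t) (hb' : t ≤ sv ((L.map simpSw).prod.1 b)) : a = b := by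
  induction L with
  | nil => simp at ha'; omega
  | cons i L ih =>
    rw [List.nodup_cons] at hL
    have ha2 : t ≤ sv ((simpSw i).1 ((L.map simpSw).prod.1 a)) := ha'
    have hb2 : t ≤ sv ((simpSw i).1 ((L.map simpSw).prod.1 b)) := hb'
    have hno : ∀ j ∈ L, ∀ c d, sv c < t → t ≤ sv ((simpSw i).1 c) → sv d < t →
        t ≤ sv ((simpSw j).1 d) → False := by
      intro j hj c d h1 h2 h3 h4
      have h5 := simpSw_exit h1 h2
      have h6 := simpSw_exit h3 h4
      have : i = j := by
        ext
        omega
      exact hL.1 (this ▸ hj)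
    by_cases h3 : ∃ c, sv c < t ∧ t ≤ sv ((simpSw i).1 c)
    · obtain ⟨c, hc, hc'⟩ := h3
      have stay : ∀ x, sv x < t → sv ((L.map simpSw).prod.1 x) < t := by
        intro x hx
        by_contra h
        obtain ⟨j, hj, d, hd, hd'⟩ := prod_simpSw_exit L t x hx (not_lt.1 h)
        exact hno j hj c d hc hc' hd hd'
      have h5 := simpSw_exit (stay a ha) ha2
      have h6 := simpSw_exit (stay b hb) hb2
      have : (L.map simpSw).prod.1 a = (L.map simpSw).prod.1 b := sv_injective (by omega)
      exact (L.map simpSw).prod.1.injective this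
    · have out : ∀ x, t ≤ sv ((simpSw i).1 x) → t ≤ sv x := by
        intro x hx
        by_contra h
        exact h3 ⟨x, not_le.1 h, hx⟩
      exact ih hL.2 (out _ ha2) (out _ hb2)

/-- A cyclic enumeration of the signed indices, such that each cut is crossed upwards once. -/
structure IsCoxEnum (P : ℤ → SIdx n) : Prop where
  surj : ∀ a, ∃ k, P k = a
  eq_iff : ∀ k l, P k = P l ↔ (2 * n : ℤ) ∣ k - l
  add_n : ∀ k, P (k + n) = negIdx (P k)
  exit : ∀ t k l, sv (P k) < t → t ≤ sv (P (k + 1)) → sv (P l) < t → t ≤ sv (P (l + 1)) → P k = P l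

/-- If a cycle did not contain the opposite of one of its elements, its antisymmetrized indicator
would be a nonzero vector fixed by c. So every cycle meets both signs and crosses 0 upwards. This
crossing is unique, hence there is only one cycle. -/
theorem exists_isCoxEnum (hn : 1 ≤ n) (σ : Equiv.Perm (Fin n)) :
    ∃ (γ : G n) (P : ℤ → SIdx n), coxeterElement σ = act γ ∧ IsCoxEnum P ∧
      ∀ k, P (k + 1) = γ.1 (P k) := by
  obtain ⟨γ, hγ⟩ : ∃ γ : G n, γ = ((List.ofFn σ).map simpSw).prod := ⟨_, rfl⟩
  have hγ' : coxeterElement σ = act γ := by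
    rw [coxeterElement_eq_act, hγ, List.map_ofFn]
    rfl
  have hfix : ∀ x, act γ x = x → x = 0 := fun x hx => coxeterElement_fixed σ x (hγ' ▸ hx)
  have hexit : ∀ t a b, sv a < t → t ≤ sv (γ.1 a) → sv b < t → t ≤ sv (γ.1 b) → a = b := by
    intro t a b
    rw [hγ]
    exact prod_simpSw_exit_unique _ (List.nodup_ofFn.2 σ.injective) t a b
  have hinv : ∀ a b, γ.1.SameCycle a (γ.1⁻¹ b) ↔ γ.1.SameCycle a b := fun a b =>
    ⟨fun h => h.trans ⟨1, by simp⟩, fun h => h.trans ⟨-1, by simp⟩⟩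
  have hneg : ∀ a, γ.1.SameCycle a (negIdx a) := by
    intro a
    by_contra h
    have hx := hfix (indVec {b | γ.1.SameCycle a b}) (ext_coord fun b => by
      rw [coord_act]
      have h1 : (γ.1⁻¹ b ∈ {b | γ.1.SameCycle a b}) ↔ b ∈ {b | γ.1.SameCycle a b} :=
        hinv a b
      have h2 : (negIdx (γ.1⁻¹ b) ∈ {b | γ.1.SameCycle a b}) ↔
          negIdx b ∈ {b | γ.1.SameCycle a b} := by
        rw [← G.inv_apply_negIdx]
        exact hinv a (negIdx b)
      exact coord_indVec_congr h1 h2)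
    have h3 := coord_indVec {b | γ.1.SameCycle a b} a
    rw [hx, coord_zero, if_pos (by simp [Equiv.Perm.SameCycle.refl]), if_neg (by simpa using h)] at h3
    norm_num at h3
  have hcross : ∀ a, ∃ b, γ.1.SameCycle a b ∧ sv b < 0 ∧ 0 ≤ sv (γ.1 b) := by
    intro a
    by_contra hcon
    push Not at hcon
    wlog ha : sv a < 0 generalizing a
    · have ha0 := sv_ne_zero a
      exact this (negIdx a) (fun b hb => hcon b ((hneg a).trans hb)) (by rw [sv_negIdx]; omega)
    have hall : ∀ k : ℕ, sv ((γ.1 ^ k) a) < 0 := by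
      intro k
      induction k with
      | zero => simpa using ha
      | succ k ih =>
        rw [pow_succ', Equiv.Perm.mul_apply]
        exact hcon _ ⟨k, by simp⟩ ih
    obtain ⟨k, hk⟩ := (hneg a).exists_nat_pow_eq
    have := hall k
    rw [hk, sv_negIdx] at this
    omega
  have hsame : ∀ a b, γ.1.SameCycle a b := by
    intro a b
    obtain ⟨c, hc, hc1, hc2⟩ := hcross a
    obtain ⟨d, hd, hd1, hd2⟩ := hcross b
    have : c = d := hexit 0 c d hc1 hc2 hd1 hd2
    exact hc.trans (this ▸ hd.symm)
  have hcyc : γ.1.IsCycleOn ((Finset.univ : Finset (SIdx n)) : Set (SIdx n)) := by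
    refine ⟨?_, fun a _ b _ => hsame a b⟩
    rw [Finset.coe_univ]
    exact Set.bijOn_univ.2 γ.1.bijective
  have hcard : (Finset.univ : Finset (SIdx n)).card = 2 * n := by
    simp [mul_comm]
  obtain ⟨a₀⟩ : Nonempty (SIdx n) := ⟨(⟨0, hn⟩, 1)⟩
  have hdvd : ∀ a (k : ℤ), (γ.1 ^ k) a = a ↔ (2 * n : ℤ) ∣ k := by
    intro a k
    rw [hcyc.zpow_apply_eq (Finset.mem_univ a), hcard]
    push_cast
    rfl
  have hsucc : ∀ k : ℤ, (γ.1 ^ (k + 1)) a₀ = γ.1 ((γ.1 ^ k) a₀) := by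
    intro k
    rw [add_comm, zpow_add, zpow_one, Equiv.Perm.mul_apply]
  have hzneg : ∀ (k : ℤ) a, (γ.1 ^ k) (negIdx a) = negIdx ((γ.1 ^ k) a) := fun k a =>
    (γ ^ k).2 a
  refine ⟨γ, fun k => (γ.1 ^ k) a₀, hγ', ⟨fun a => hsame a₀ a, fun k l => ?_, fun k => ?_,
    fun t k l => ?_⟩, hsucc⟩
  · rw [← hdvd a₀ (k - l), sub_eq_neg_add, zpow_add, Equiv.Perm.mul_apply, zpow_neg,
      Equiv.Perm.inv_eq_iff_eq]
  -- Some power t sends a₀ to its opposite; 2n divides 2t but not t, so t is an odd multiple of n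
  -- and the power n also does it.
  · obtain ⟨t, ht⟩ := hneg a₀
    have h1 : (2 * n : ℤ) ∣ t + t := by
      rw [← hdvd a₀, zpow_add, Equiv.Perm.mul_apply, ht, hzneg, ht, negIdx_negIdx]
    have h2 : ¬ (2 * n : ℤ) ∣ t := by
      rw [← hdvd a₀, ht]
      simp
    obtain ⟨u, hu⟩ := h1
    have h3 : t = n * u := by linarith
    have hodd : u % 2 = 1 := by
      rcases Int.emod_two_eq_zero_or_one u with h | h
      · exact absurd ⟨u / 2, by rw [h3]; have : u = 2 * (u / 2) := by omega
                                conv_lhs => rw [this]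
                                ring⟩ h2
      · exact h
    have h4 : (2 * n : ℤ) ∣ n - t := ⟨(1 - u) / 2, by
      have : 1 - u = 2 * ((1 - u) / 2) := by omega
      rw [h3, mul_assoc, mul_left_comm, ← this]
      ring⟩
    rw [← hdvd a₀] at h4
    have h5 : (γ.1 ^ (n : ℤ)) a₀ = negIdx a₀ := by
      have : (n : ℤ) = t + (n - t) := by ring
      rw [this, zpow_add, Equiv.Perm.mul_apply, h4, ht]
    rw [zpow_add, Equiv.Perm.mul_apply, h5, hzneg]
  · simp only [hsucc]
    exact hexit t _ _

end
end TypeB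

namespace TypeB
noncomputable section

variable {n : ℕ}

/-! ### Fixed spaces -/

/-- The fixed space of an isometry. -/
def fixSp (g : V n ≃ₗᵢ[ℝ] V n) : Submodule ℝ (V n) where
  carrier := {x | g x = x}
  add_mem' := by
    intro x y hx hy
    simp only [Set.mem_ofPred_eq] at *
    rw [map_add, hx, hy]
  zero_mem' := by simp
  smul_mem' := by
    intro t x hx
    simp only [Set.mem_ofPred_eq] at *
    rw [map_smul, hx]

theorem mem_fixSp {g : V n ≃ₗᵢ[ℝ] V n} {x : V n} : x ∈ fixSp g ↔ g x = x := Iff.rfl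

/-- Codimension of the fixed space is subadditive, because common fixed vectors are fixed by the
product. -/
theorem finrank_fixSp_mul (g h : V n ≃ₗᵢ[ℝ] V n) :
    Module.finrank ℝ (fixSp g) + Module.finrank ℝ (fixSp h) ≤
      n + Module.finrank ℝ (fixSp (g * h)) := by
  have h1 := Submodule.finrank_sup_add_finrank_inf_eq (fixSp g) (fixSp h)
  have h2 : Module.finrank ℝ (fixSp g ⊓ fixSp h : Submodule ℝ (V n)) ≤
      Module.finrank ℝ (fixSp (g * h)) := by
    apply Submodule.finrank_mono
    rintro x ⟨hg, hh⟩
    change g (h x) = x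
    rw [mem_fixSp.1 hh, mem_fixSp.1 hg]
  have h3 := Submodule.finrank_le (fixSp g ⊔ fixSp h)
  rw [finrank_euclideanSpace_fin] at h3
  omega

theorem finrank_fixSp_refl (α : V n) : n ≤ Module.finrank ℝ (fixSp (refl α)) + 1 := by
  have h1 : (ℝ ∙ α)ᗮ ≤ fixSp (refl α) := fun x hx =>
    refl_eq_of_inner_eq_zero (Submodule.mem_orthogonal_singleton_iff_inner_right.1 hx)
  have h2 := Submodule.finrank_mono h1
  have h3 := Submodule.finrank_add_finrank_orthogonal (ℝ ∙ α)
  have h4 := finrank_span_le_card (R := ℝ) ({α} : Set (V n))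
  rw [Set.toFinset_singleton, Finset.card_singleton] at h4
  rw [finrank_euclideanSpace_fin] at h3
  omega

theorem refl_mul_self (α : V n) : refl α * refl α = 1 := by
  ext1 x
  change refl α (refl α x) = x
  rw [refl, Submodule.reflection_reflection]

theorem finrank_fixSp_conj (g u : V n ≃ₗᵢ[ℝ] V n) :
    Module.finrank ℝ (fixSp g) ≤ Module.finrank ℝ (fixSp (u⁻¹ * g * u)) := by
  have h1 : (fixSp g).map (u⁻¹.toLinearEquiv : V n →ₗ[ℝ] V n) ≤ fixSp (u⁻¹ * g * u) := by
    rintro _ ⟨x, hx, rfl⟩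
    change u⁻¹ (g (u (u⁻¹ x))) = u⁻¹ x
    have : u (u⁻¹ x) = x := u.apply_symm_apply x
    rw [this, mem_fixSp.1 hx]
  have h2 := Submodule.finrank_mono h1
  rwa [LinearEquiv.finrank_map_eq] at h2

/-- Each letter of l' that is omitted in l can be moved to the front by conjugation, so l⁻¹ l' has a
fixed space of codimension at most the number of omitted letters. -/
theorem finrank_fixSp_sublist {l l' : List (V n ≃ₗᵢ[ℝ] V n)} (h : l.Sublist l')
    (hl' : ∀ t ∈ l', t ∈ reflections n) :
    n + l.length ≤ Module.finrank ℝ (fixSp (l.prod⁻¹ * l'.prod)) + l'.length := by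
  induction h with
  | slnil =>
    have : fixSp (1 : V n ≃ₗᵢ[ℝ] V n) = ⊤ := by
      ext x
      simp [mem_fixSp]
    rw [List.prod_nil, inv_one, one_mul, this]
    simp
  | @cons l l' t h ih =>
    have ih := ih fun s hs => hl' s (List.mem_cons_of_mem _ hs)
    obtain ⟨α, -, hα⟩ := hl' t List.mem_cons_self
    have h1 := finrank_fixSp_refl α
    rw [hα] at h1
    have h2 := finrank_fixSp_conj t l.prod
    have h3 := finrank_fixSp_mul (l.prod⁻¹ * t * l.prod) (l.prod⁻¹ * l'.prod)
    have h4 : l.prod⁻¹ * t * l.prod * (l.prod⁻¹ * l'.prod) = l.prod⁻¹ * (t :: l').prod := by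
      rw [List.prod_cons]
      group
    rw [h4] at h3
    rw [List.length_cons]
    omega
  | @cons_cons l l' t h ih =>
    have ih := ih fun s hs => hl' s (List.mem_cons_of_mem _ hs)
    have h4 : (t :: l).prod⁻¹ * (t :: l').prod = l.prod⁻¹ * l'.prod := by
      rw [List.prod_cons, List.prod_cons]
      group
    rw [h4, List.length_cons, List.length_cons]
    omega

theorem finrank_fixSp_prod {l : List (V n ≃ₗᵢ[ℝ] V n)} (hl : ∀ t ∈ l, t ∈ reflections n) :
    n ≤ Module.finrank ℝ (fixSp l.prod) + l.length := by
  have := finrank_fixSp_sublist (List.nil_sublist l) hl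
  rwa [List.prod_nil, inv_one, one_mul] at this

theorem sub_apply_mem_orthogonal (u : V n ≃ₗᵢ[ℝ] V n) (z : V n) : z - u z ∈ (fixSp u)ᗮ := by
  rw [Submodule.mem_orthogonal]
  intro x hx
  rw [inner_sub_right]
  nth_rewrite 2 [← mem_fixSp.1 hx]
  rw [u.inner_map_map, sub_self]

/-- Since c agrees with u on Fix v, the injective map 1 - c sends Fix v into the orthogonal of Fix
u; the dimensions force equality. -/
theorem exists_fixed_of_mem_orthogonal {c u v : V n ≃ₗᵢ[ℝ] V n} (hc : c = u * v)
    (hfix : ∀ x, c x = x → x = 0)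
    (hdim : n ≤ Module.finrank ℝ (fixSp u) + Module.finrank ℝ (fixSp v)) {y : V n}
    (hy : y ∈ (fixSp u)ᗮ) : ∃ z, v z = z ∧ z - c z = y := by
  let φ : V n →ₗ[ℝ] V n := LinearMap.id - (c.toLinearEquiv : V n →ₗ[ℝ] V n)
  have hφ (x : V n) : φ x = x - c x := rfl
  have hinj : Function.Injective φ := by
    rw [← LinearMap.ker_eq_bot, LinearMap.ker_eq_bot']
    intro x hx
    rw [hφ, sub_eq_zero] at hx
    exact hfix x hx.symm
  have hle : (fixSp v).map φ ≤ (fixSp u)ᗮ := by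
    rintro _ ⟨z, hz, rfl⟩
    rw [hφ, hc]
    change z - u (v z) ∈ _
    rw [mem_fixSp.1 hz]
    exact sub_apply_mem_orthogonal u z
  have h1 := Submodule.finrank_add_finrank_orthogonal (fixSp u)
  rw [finrank_euclideanSpace_fin] at h1
  have h2 : Module.finrank ℝ ((fixSp v).map φ) = Module.finrank ℝ (fixSp v) :=
    
    (LinearEquiv.finrank_eq (Submodule.equivMapOfInjective φ hinj _)).symm
  have heq := Submodule.eq_of_le_of_finrank_le hle (by omega)
  rw [← heq] at hy
  obtain ⟨z, hz, rfl⟩ := hy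
  exact ⟨z, hz, rfl⟩

/-! ### Arcs of the cyclic enumeration -/

theorem IsCoxEnum.eq_of_abs_lt {P : ℤ → SIdx n} (hP : IsCoxEnum P) {s t : ℤ} (h : P s = P t)
    (h1 : s < t + 2 * n) (h2 : t < s + 2 * n) : s = t := by
  rw [hP.eq_iff] at h
  have := Int.eq_zero_of_abs_lt_dvd h (by rw [abs_lt]; constructor <;> linarith)
  linarith

theorem IsCoxEnum.add_two_n {P : ℤ → SIdx n} (hP : IsCoxEnum P) (k : ℤ) :
    P (k + 2 * n) = P k := by
  rw [hP.eq_iff]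
  simp

theorem IsCoxEnum.sub_n {P : ℤ → SIdx n} (hP : IsCoxEnum P) (k : ℤ) :
    P (k - n) = negIdx (P k) := by
  have := hP.add_n (k - n)
  rw [sub_add_cancel] at this
  rw [this, negIdx_negIdx]

theorem IsCoxEnum.sub_two_n {P : ℤ → SIdx n} (hP : IsCoxEnum P) (k : ℤ) :
    P (k - 2 * n) = P k := by
  rw [hP.eq_iff]
  simp

theorem IsCoxEnum.exists_between {P : ℤ → SIdx n} (hP : IsCoxEnum P) (hn : 1 ≤ n) (s : ℤ)
    (a : SIdx n) : ∃ t, s ≤ t ∧ t < s + 2 * n ∧ P t = a := by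
  obtain ⟨k, rfl⟩ := hP.surj a
  refine ⟨s + (k - s) % (2 * n), ?_, ?_, ?_⟩
  · have := Int.emod_nonneg (k - s) (b := 2 * n) (by omega)
    omega
  · have := Int.emod_lt_of_pos (k - s) (b := 2 * n) (by omega)
    omega
  · rw [hP.eq_iff]
    have : s + (k - s) % (2 * n) - k = -((k - s) - (k - s) % (2 * n)) := by ring
    rw [this, Int.dvd_neg]
    exact Int.dvd_self_sub_emod

/-- The sum of the signed basis vectors along an arc. -/
def arcVec (P : ℤ → SIdx n) (i : ℤ) (m : ℕ) : V n := ∑ t ∈ Finset.range m, E (P (i + t))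

/-- The signed indices on an arc. -/
def arcSet (P : ℤ → SIdx n) (i j : ℤ) : Set (SIdx n) := {a | ∃ q, i ≤ q ∧ q < j ∧ P q = a}

/-- Telescoping along the cycle: arc sums are the preimages under 1 - c of differences of signed
basis vectors. -/
theorem arcVec_sub_apply {P : ℤ → SIdx n} {γ : G n} (hγ : ∀ k, P (k + 1) = γ.1 (P k)) (i : ℤ)
    (m : ℕ) : arcVec P i m - act γ (arcVec P i m) = E (P i) - E (P (i + m)) := by
  rw [arcVec, map_sum, ← Finset.sum_sub_distrib]
  have : ∀ t ∈ Finset.range m, E (P (i + t)) - act γ (E (P (i + t))) =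
      E (P (i + t)) - E (P (i + (t + 1 : ℕ))) := by
    intro t _
    rw [act_E, ← hγ]
    push_cast
    rw [add_assoc]
  rw [Finset.sum_congr rfl this, Finset.sum_range_sub' fun t : ℕ => E (P (i + t))]
  simp

theorem arcVec_eq_indVec {P : ℤ → SIdx n} (hP : IsCoxEnum P) (i : ℤ) {m : ℕ} (hm : m ≤ 2 * n) :
    arcVec P i m = indVec (arcSet P i (i + m)) := by
  classical
  have key (a : SIdx n) : (∑ t ∈ Finset.range m, if a = P (i + t) then (1 : ℝ) else 0) =
      if a ∈ arcSet P i (i + m) then 1 else 0 := by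
    split_ifs with h
    · obtain ⟨q, h1, h2, rfl⟩ := h
      rw [Finset.sum_eq_single (q - i).toNat]
      · rw [if_pos]
        congr 1
        omega
      · intro t ht hne
        rw [if_neg]
        intro heq
        have := Finset.mem_range.1 ht
        have := hP.eq_of_abs_lt heq (by omega) (by omega)
        omega
      · intro h
        rw [Finset.mem_range] at h
        omega
    · apply Finset.sum_eq_zero
      intro t ht
      rw [if_neg]
      rintro rfl
      have := Finset.mem_range.1 ht
      exact h ⟨i + t, by omega, by omega, rfl⟩
  refine ext_coord fun a => ?_
  rw [arcVec, coord_sum, coord_indVec, ← key, ← key, ← Finset.sum_sub_distrib]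
  refine Finset.sum_congr rfl fun t _ => ?_
  rw [coord_E]
  simp only [negIdx_eq_iff]

/-- A signed permutation commutes with any odd function applied coordinatewise. This particular one,
on coordinates in {0, 1, -1}, keeps x where x = y and gives 0 elsewhere, so it turns two indicator
vectors into that of the intersection. -/
theorem act_oddCombo (g : G n) {x y : V n} (hx : act g x = x) (hy : act g y = y) {z : V n}
    (hz : ∀ a, coord a z = (coord a x * coord a y ^ 2 + coord a y * coord a x ^ 2) / 2) :
    act g z = z := by
  refine ext_coord fun a => ?_
  rw [coord_act, hz, hz]
  nth_rewrite 3 [← hx]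
  nth_rewrite 3 [← hy]
  nth_rewrite 4 [← hx]
  nth_rewrite 4 [← hy]
  simp only [coord_act]

theorem coord_indVec_inter {S T : Set (SIdx n)} (hS : ∀ a ∈ S, negIdx a ∉ S)
    (hT : ∀ a ∈ T, negIdx a ∉ T) (a : SIdx n) :
    coord a (indVec (S ∩ T)) = (coord a (indVec S) * coord a (indVec T) ^ 2 +
      coord a (indVec T) * coord a (indVec S) ^ 2) / 2 := by
  classical
  rw [coord_indVec, coord_indVec, coord_indVec]
  have h1 := hS a
  have h2 := hT a
  by_cases h3 : a ∈ S <;> by_cases h4 : a ∈ T <;> by_cases h5 : negIdx a ∈ S <;>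
    by_cases h6 : negIdx a ∈ T <;> simp_all

/-! ### Noncrossing partitions -/

/-- The relation has no crossing with respect to the cyclic enumeration. -/
def NC (P : ℤ → SIdx n) (r : SIdx n → SIdx n → Prop) : Prop :=
  ∀ i j k l : ℤ, i < j → j < k → k < l → l < i + 2 * n → r (P i) (P k) → r (P j) (P l) →
    r (P i) (P j)

theorem negIdx_notMem_arcSet {P : ℤ → SIdx n} (hP : IsCoxEnum P) {i j : ℤ} (h : j ≤ i + n) :
    ∀ a ∈ arcSet P i j, negIdx a ∉ arcSet P i j := by
  rintro _ ⟨q, h1, h2, rfl⟩ ⟨q', h3, h4, h5⟩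
  rcases le_total q q' with h6 | h6
  · rw [← hP.add_n] at h5
    have := hP.eq_of_abs_lt h5 (by omega) (by omega)
    omega
  · rw [← hP.sub_n] at h5
    have := hP.eq_of_abs_lt h5 (by omega) (by omega)
    omega

/-- Together with `rel_of_apply_arcVec` this is a Kreweras-type duality for c = uv: two points are
related on Fix u exactly when v fixes the sum over the arc between them. The vector provided by
`exists_fixed_of_mem_orthogonal` has the same image under 1 - c as the arc sum, hence equals it. -/
theorem apply_arcVec_eq_self {P : ℤ → SIdx n} {γ : G n} (hγ : ∀ k, P (k + 1) = γ.1 (P k))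
    (hfix : ∀ x, act γ x = x → x = 0) {u v : V n ≃ₗᵢ[ℝ] V n} (hc : act γ = u * v)
    (hdim : n ≤ Module.finrank ℝ (fixSp u) + Module.finrank ℝ (fixSp v)) {i : ℤ} {m : ℕ}
    (h : rel (fixSp u) (P i) (P (i + m))) : v (arcVec P i m) = arcVec P i m := by
  obtain ⟨z, hz, hz'⟩ := exists_fixed_of_mem_orthogonal hc hfix hdim (rel_iff_inner.1 h)
  rw [← arcVec_sub_apply hγ] at hz'
  have : z - arcVec P i m = 0 := by
    apply hfix
    have h1 : act γ z = z - (arcVec P i m - act γ (arcVec P i m)) := by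
      rw [← hz']
      abel
    rw [map_sub, h1]
    abel
  rw [sub_eq_zero] at this
  rw [← this, hz]

theorem rel_of_apply_arcVec {P : ℤ → SIdx n} {γ : G n} (hγ : ∀ k, P (k + 1) = γ.1 (P k))
    {u v : V n ≃ₗᵢ[ℝ] V n} (hc : act γ = u * v) {i : ℤ} {m : ℕ}
    (h : v (arcVec P i m) = arcVec P i m) : rel (fixSp u) (P i) (P (i + m)) := by
  rw [rel_iff_inner, ← arcVec_sub_apply hγ, hc]
  change _ - u (v _) ∈ _
  rw [h]
  exact sub_apply_mem_orthogonal u _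

/-- By duality, two crossing related pairs give two overlapping arcs fixed by the complement v. As v
is a signed permutation it also fixes their intersection, so the endpoints of the overlap are
related. -/
theorem NC_of_fixSp {P : ℤ → SIdx n} (hP : IsCoxEnum P) {γ g : G n}
    (hγ : ∀ k, P (k + 1) = γ.1 (P k)) (hfix : ∀ x, act γ x = x → x = 0) {u : V n ≃ₗᵢ[ℝ] V n}
    (hc : act γ = u * act g)
    (hdim : n ≤ Module.finrank ℝ (fixSp u) + Module.finrank ℝ (fixSp (act g))) :
    NC P (rel (fixSp u)) := by
  have hr := isBPart_rel (fixSp u)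
  -- The intersection argument needs arcs disjoint from their opposites, that is of length at most
  -- n.
  have core : ∀ i j k l : ℤ, i < j → j < k → k < l → l < i + 2 * n → k ≤ i + n → l ≤ j + n →
      rel (fixSp u) (P i) (P k) → rel (fixSp u) (P j) (P l) → rel (fixSp u) (P j) (P k) := by
    intro i j k l hij hjk hkl hli hki hlj hik hjl
    obtain ⟨m₁, rfl⟩ : ∃ m : ℕ, k = i + m := ⟨(k - i).toNat, by omega⟩
    obtain ⟨m₂, rfl⟩ : ∃ m : ℕ, l = j + m := ⟨(l - j).toNat, by omega⟩
    obtain ⟨m₃, hm₃⟩ : ∃ m : ℕ, i + m₁ = j + m := ⟨(i + m₁ - j).toNat, by omega⟩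
    have e1 := apply_arcVec_eq_self hγ hfix hc hdim hik
    have e2 := apply_arcVec_eq_self hγ hfix hc hdim hjl
    rw [hm₃]
    apply rel_of_apply_arcVec hγ hc
    rw [arcVec_eq_indVec hP _ (by omega)] at e1 e2 ⊢
    have hset : arcSet P j (j + m₃) = arcSet P i (i + m₁) ∩ arcSet P j (j + m₂) := by
      ext a
      constructor
      · rintro ⟨q, h1, h2, rfl⟩
        exact ⟨⟨q, by omega, by omega, rfl⟩, ⟨q, by omega, by omega, rfl⟩⟩
      · rintro ⟨⟨q, h1, h2, rfl⟩, ⟨q', h3, h4, h5⟩⟩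
        have := hP.eq_of_abs_lt h5 (by omega) (by omega)
        exact ⟨q, by omega, by omega, rfl⟩
    rw [hset]
    exact act_oddCombo g e1 e2 (coord_indVec_inter (negIdx_notMem_arcSet hP (by omega))
      (negIdx_notMem_arcSet hP (by omega)))
  intro i j k l hij hjk hkl hli hik hjl
  have hsym {a b : SIdx n} (h : rel (fixSp u) a b) := hr.equiv.symm h
  -- An arc longer than n is replaced by its complement, which amounts to rotating the four points
  -- by one or two places.
  rcases le_or_gt k (i + n) with h1 | h1 <;> rcases le_or_gt l (j + n) with h2 | h2
  · exact hr.equiv.trans hik (hsym (core i j k l hij hjk hkl hli h1 h2 hik hjl))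
  · have := core (l - 2 * n) i j k (by omega) hij hjk (by omega) (by omega) h1
      (by rw [hP.sub_two_n]; exact hsym hjl) hik
    exact this
  · have := core j k l (i + 2 * n) hjk hkl hli (by omega) h2 (by omega) hjl
      (by rw [hP.add_two_n]; exact hsym hik)
    exact hr.equiv.trans hik (hr.equiv.trans this (hsym hjl))
  · have := core k l (i + 2 * n) (j + 2 * n) hkl hli (by omega) (by omega) (by omega) (by omega)
      (by rw [hP.add_two_n]; exact hsym hik) (by rw [hP.add_two_n]; exact hsym hjl)
    rw [hP.add_two_n] at this
    exact hsym (hr.equiv.trans hjl this)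

theorem NC_of_mem_noncrossing {P : ℤ → SIdx n} (hP : IsCoxEnum P) {γ : G n}
    (hγ : ∀ k, P (k + 1) = γ.1 (P k)) (hfix : ∀ x, act γ x = x → x = 0)
    (hword : ∃ l : List (V n ≃ₗᵢ[ℝ] V n), (∀ t ∈ l, t ∈ reflections n) ∧ l.prod = act γ ∧
      l.length = n) {π : Submodule ℝ (V n)} (hπ : π ∈ noncrossing (act γ)) : NC P (rel π) := by
  obtain ⟨-, w, hw, ⟨l, l', ⟨h1, rfl, h3⟩, ⟨h1', h2', h3'⟩, hsub⟩, hfixw⟩ := hπ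
  have hπ : π = fixSp l.prod := by
    ext x
    exact hfixw x
  rw [W_eq_range] at hw
  obtain ⟨g, hg⟩ := hw
  rw [hπ]
  obtain ⟨l₀, h4, h5, h6⟩ := hword
  have h7 := h3' l₀ h4 h5
  have h8 := finrank_fixSp_sublist hsub h1'
  have h9 := finrank_fixSp_prod h1
  have h10 : act (g⁻¹ * γ) = l.prod⁻¹ * l'.prod := by
    rw [map_mul, map_inv, hg, h2']
  refine NC_of_fixSp hP hγ hfix (g := g⁻¹ * γ) ?_ ?_
  · rw [map_mul, map_inv, hg]
    group
  · rw [h10]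
    omega

/-- A class of `r` is cut along an arc, in a way that is compatible with `r'`. -/
def ArcSplit (P : ℤ → SIdx n) (r' r : SIdx n → SIdx n → Prop) : Prop :=
  ∃ i j : ℤ, i < j ∧ j < i + 2 * n ∧ r (P i) (P j) ∧
    ∀ s t, i < s → s ≤ j → j < t → t ≤ i + 2 * n → r (P i) (P s) → ¬ r' (P s) (P t)

/-- Suppose an arc between r'-related points s, t contains just one of the cut points. If its other
end lies in the cut class, r' joins the two sides of the cut; if not, the pairs (s, t) and (i, j)
cross in r. Both are excluded. The use of this is that the arc vector is orthogonal to E (P i) - E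
(P j). -/
theorem mem_arcSet_iff_of_arcSplit {P : ℤ → SIdx n} (hP : IsCoxEnum P)
    {r r' : SIdx n → SIdx n → Prop} (hr : IsBPart r) (hr' : IsBPart r') (hNC : NC P r)
    (hsub : ∀ a b, r' a b → r a b) {i j : ℤ} (hij : i < j) (hji : j < i + 2 * n)
    (hrij : r (P i) (P j))
    (hsplit : ∀ s t, i < s → s ≤ j → j < t → t ≤ i + 2 * n → r (P i) (P s) → ¬ r' (P s) (P t))
    {s t : ℤ} (hts : t < s + 2 * n) (hrst : r' (P s) (P t)) :
    P i ∈ arcSet P s t ↔ P j ∈ arcSet P s t := by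
  have hshift : ∀ q d : ℤ, (2 * n : ℤ) ∣ d → P (q - d) = P q := by
    intro q d hd
    rw [hP.eq_iff]
    simpa using hd
  constructor
  · rintro ⟨q, h1, h2, h3⟩
    have hd := (hP.eq_iff _ _).1 h3
    obtain ⟨d, rfl⟩ : ∃ d, q = i + d := ⟨q - i, by ring⟩
    rw [add_sub_cancel_left] at hd
    -- Translating by the multiple d of the period places the occurrence of P i at i itself.
    obtain ⟨s', rfl⟩ : ∃ s', s = s' + d := ⟨s - d, by ring⟩
    obtain ⟨t', rfl⟩ : ∃ t', t = t' + d := ⟨t - d, by ring⟩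
    have hs' : P (s' + d) = P s' := by rw [← hshift (s' + d) d hd]; simp
    have ht' : P (t' + d) = P t' := by rw [← hshift (t' + d) d hd]; simp
    have hj' : P (j + d) = P j := by rw [← hshift (j + d) d hd]; simp
    rw [hs', ht'] at hrst
    by_contra hnot
    have h4 : t' ≤ j := by
      by_contra h
      exact hnot ⟨j + d, by omega, by omega, hj'⟩
    have h5 : j - 2 * n < s' := by
      by_contra h
      exact hnot ⟨j + d - 2 * n, by omega, by omega, by rw [hP.sub_two_n, hj']⟩
    by_cases h6 : r (P i) (P t')
    · apply hsplit t' (s' + 2 * n) (by omega) h4 (by omega) (by omega) h6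
      rw [hP.add_two_n]
      exact hr'.equiv.symm hrst
    · have hr1 := hsub _ _ hrst
      have h7 : s' ≠ i := by rintro rfl; exact h6 hr1
      have h8 : t' ≠ j := by rintro rfl; exact h6 hrij
      exact h6 (hr.equiv.trans (hr.equiv.symm (hNC s' i t' j (by omega) (by omega) (by omega)
        (by omega) hr1 hrij)) hr1)
  · rintro ⟨q, h1, h2, h3⟩
    have hd := (hP.eq_iff _ _).1 h3
    obtain ⟨d, rfl⟩ : ∃ d, q = j + d := ⟨q - j, by ring⟩
    rw [add_sub_cancel_left] at hd
    obtain ⟨s', rfl⟩ : ∃ s', s = s' + d := ⟨s - d, by ring⟩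
    obtain ⟨t', rfl⟩ : ∃ t', t = t' + d := ⟨t - d, by ring⟩
    have hs' : P (s' + d) = P s' := by rw [← hshift (s' + d) d hd]; simp
    have ht' : P (t' + d) = P t' := by rw [← hshift (t' + d) d hd]; simp
    have hi' : P (i + d) = P i := by rw [← hshift (i + d) d hd]; simp
    rw [hs', ht'] at hrst
    by_contra hnot
    have h4 : i < s' := by
      by_contra h
      exact hnot ⟨i + d, by omega, by omega, hi'⟩
    have h5 : t' ≤ i + 2 * n := by
      by_contra h
      exact hnot ⟨i + d + 2 * n, by omega, by omega, by rw [hP.add_two_n, hi']⟩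
    by_cases h6 : r (P i) (P s')
    · exact hsplit s' t' h4 (by omega) (by omega) h5 h6 hrst
    · have hr1 := hsub _ _ hrst
      have h7 : s' ≠ j := by rintro rfl; exact h6 hrij
      have h8 : t' ≠ i + 2 * n := by
        rintro rfl
        rw [hP.add_two_n] at hr1
        exact h6 (hr.equiv.symm hr1)
      exact h6 (hNC i s' j t' h4 (by omega) (by omega) (by omega) hrij hr1)

/-- Let f be the arc sum from i to j. Then f - u f = E (P i) - E (P j), so the reflection t in this
vector exchanges f and u f, and ut fixes u f, which u does not: Fix (ut) strictly contains Fix u.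
Conversely, an arc sum g between π'-related points is fixed by v and by t, so c g = u t g and the
difference g - c g of the endpoints is orthogonal to Fix (ut). Hence Fix (ut) lies in π', and the
dimensions agree. -/
theorem fixSp_mul_refl_of_arcSplit (hn : 1 ≤ n) {P : ℤ → SIdx n} (hP : IsCoxEnum P) {γ : G n}
    (hγ : ∀ k, P (k + 1) = γ.1 (P k)) (hfix : ∀ x, act γ x = x → x = 0)
    {u v : V n ≃ₗᵢ[ℝ] V n} (hc : act γ = u * v)
    (hdim : n ≤ Module.finrank ℝ (fixSp u) + Module.finrank ℝ (fixSp v))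
    {π' : Submodule ℝ (V n)} (hπ' : π' ∈ setPartitions n) (hle : fixSp u ≤ π')
    (hrank : Module.finrank ℝ π' ≤ Module.finrank ℝ (fixSp u) + 1)
    (hNC : NC P (rel (fixSp u))) (hsplit : ArcSplit P (rel π') (rel (fixSp u))) :
    ∃ t ∈ reflections n, fixSp (u * t) = π' ∧ t * t = 1 := by
  obtain ⟨i, j, hij, hji, hrij, hsp⟩ := hsplit
  have hne : P i ≠ P j := fun h => by
    have := hP.eq_of_abs_lt h (by omega) (by omega)
    omega
  have hr := isBPart_rel (fixSp u)
  have hr' := isBPart_rel π'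
  refine ⟨refl (E (P i) - E (P j)), refl_E_sub_E_mem hne, ?_, ?_⟩
  swap
  · exact refl_mul_self _
  obtain ⟨m, rfl⟩ : ∃ m : ℕ, j = i + m := ⟨(j - i).toNat, by omega⟩
  have hf := apply_arcVec_eq_self hγ hfix hc hdim hrij
  have hα := arcVec_sub_apply hγ i m
  generalize arcVec P i m = f at hf hα
  have hcf : act γ f = u f := by
    rw [hc]
    change u (v f) = _
    rw [hf]
  rw [hcf] at hα
  rw [← hα]
  have hα0 : f - u f ≠ 0 := by
    rw [hα, sub_ne_zero]
    exact fun h => hne (E_injective h)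
  have hrefl : refl (f - u f) (u f) = f := by
    rw [← refl_neg, neg_sub]
    exact Submodule.reflection_sub (u.norm_map f)
  have hlt : fixSp u < fixSp (u * refl (f - u f)) := by
    rw [SetLike.lt_iff_le_and_exists]
    constructor
    · intro x hx
      change u (refl _ x) = x
      rw [refl_eq_of_inner_eq_zero]
      · exact hx
      · exact Submodule.inner_left_of_mem_orthogonal hx (sub_apply_mem_orthogonal u f)
    · refine ⟨u f, ?_, ?_⟩
      · change u (refl _ (u f)) = u f
        rw [hrefl]
      · intro h
        rw [mem_fixSp] at h
        exact hα0 (by rw [sub_eq_zero]; exact (u.injective h).symm)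
  refine Submodule.eq_of_le_of_finrank_le ?_ ?_
  · intro x hx
    rw [mem_setPartition hπ']
    intro a b hab
    obtain ⟨s, rfl⟩ := hP.surj a
    obtain ⟨t, hst, hts, rfl⟩ := hP.exists_between hn s b
    obtain ⟨m', rfl⟩ : ∃ m : ℕ, t = s + m := ⟨(t - s).toNat, by omega⟩
    have hg := apply_arcVec_eq_self hγ hfix hc hdim (rel_mono hle hab)
    have hg' := arcVec_sub_apply hγ s m'
    have hiff : ∀ {s t : ℤ}, t < s + 2 * n → rel π' (P s) (P t) →
        (P i ∈ arcSet P s t ↔ P (i + m) ∈ arcSet P s t) := fun h1 h2 =>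
      mem_arcSet_iff_of_arcSplit hP hr hr' hNC (fun _ _ => rel_mono hle) hij hji hrij hsp h1 h2
    have hneg : ∀ k, negIdx (P k) ∈ arcSet P s (s + m') ↔
        P k ∈ arcSet P (s + n) (s + m' + n) := by
      intro k
      constructor
      · rintro ⟨q, h1, h2, h3⟩
        exact ⟨q + n, by omega, by omega, by rw [hP.add_n, h3, negIdx_negIdx]⟩
      · rintro ⟨q, h1, h2, h3⟩
        exact ⟨q - n, by omega, by omega, by rw [hP.sub_n, h3]⟩
    have hperp : inner ℝ (f - u f) (arcVec P s m') = 0 := by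
      rw [hα, inner_sub_left, ← coord_eq_inner, ← coord_eq_inner, sub_eq_zero,
        arcVec_eq_indVec hP _ (by omega)]
      refine coord_indVec_congr (hiff hts hab) ?_
      rw [hneg, hneg]
      refine hiff (by omega) ?_
      rw [hP.add_n, hP.add_n]
      exact hr'.neg _ _ hab
    have h5 : E (P s) - E (P (s + m')) ∈ (fixSp (u * refl (f - u f)))ᗮ := by
      rw [← hg']
      have h6 : act γ (arcVec P s m') = (u * refl (f - u f)) (arcVec P s m') := by
        rw [hc]
        change u (v _) = u (refl _ _)
        rw [hg, refl_eq_of_inner_eq_zero hperp]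
      rw [h6]
      exact sub_apply_mem_orthogonal _ _
    have h7 := Submodule.inner_left_of_mem_orthogonal hx h5
    rw [inner_sub_left, ← coord_eq_inner, ← coord_eq_inner, sub_eq_zero] at h7
    exact h7
  · have := Submodule.finrank_lt_finrank_of_lt hlt
    omega

theorem prod_mem_W {l : List (V n ≃ₗᵢ[ℝ] V n)} (hl : ∀ t ∈ l, t ∈ reflections n) :
    l.prod ∈ W n := by
  apply Subgroup.list_prod_mem
  intro t ht
  obtain ⟨a, b, -, h, -⟩ := reflections_subset_range_act (hl t ht)
  rw [W_eq_range, h]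
  exact ⟨_, rfl⟩

/-- Starting from Fix c = 0, each step up the chain of subspaces strips one reflection off c on the
right. After n steps nothing but the identity is left, so the stripped reflections form a word of c
whose prefixes have the Ω k as fixed spaces. Prefixes are reduced because the codimension of the
fixed space bounds the length of a word from below. -/
theorem mem_noncrossing_of_chain (hn : 1 ≤ n) {P : ℤ → SIdx n} (hP : IsCoxEnum P) {γ : G n}
    (hγ : ∀ k, P (k + 1) = γ.1 (P k)) (hfix : ∀ x, act γ x = x → x = 0)
    {Ω : ℕ → Submodule ℝ (V n)} (hΩ : ∀ k ≤ n, Ω k ∈ setPartitions n)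
    (hrank : ∀ k ≤ n, Module.finrank ℝ (Ω k) = n - k) (hle : ∀ k < n, Ω (k + 1) ≤ Ω k)
    (hNC : ∀ k ≤ n, NC P (rel (Ω k)))
    (hsplit : ∀ k < n, ArcSplit P (rel (Ω k)) (rel (Ω (k + 1)))) :
    ∀ k ≤ n, Ω k ∈ noncrossing (act γ) := by
  have main : ∀ d ≤ n, ∃ L : List (V n ≃ₗᵢ[ℝ] V n), L.length = d ∧ (∀ t ∈ L, t ∈ reflections n) ∧
      ∀ m ≤ d, fixSp (act γ * (L.drop m).prod⁻¹) = Ω (n - d + m) := by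
    intro d
    induction d with
    | zero =>
      intro _
      refine ⟨[], rfl, by simp, ?_⟩
      intro m hm
      obtain rfl : m = 0 := by omega
      have h1 : Ω n = ⊥ := Submodule.finrank_eq_zero.1 (by rw [hrank n le_rfl]; omega)
      rw [Nat.sub_zero, Nat.add_zero, h1]
      simp only [List.drop_nil, List.prod_nil, inv_one, mul_one]
      rw [eq_bot_iff]
      intro x hx
      exact hfix x hx
    | succ d ih =>
      intro hd
      obtain ⟨L, hL1, hL2, hL3⟩ := ih (by omega)
      have h0 := hL3 0 (by omega)
      simp only [List.drop_zero, add_zero] at h0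
      have e1 : n - (d + 1) + 1 = n - d := by omega
      have h1 := hsplit (n - (d + 1)) (by omega)
      have h2 := hle (n - (d + 1)) (by omega)
      have h3 := hNC (n - d) (by omega)
      have h4 := hrank (n - d) (by omega)
      have h5 := hrank (n - (d + 1)) (by omega)
      rw [e1, ← h0] at h1 h2
      rw [← h0] at h3 h4
      have h6 := finrank_fixSp_prod hL2
      obtain ⟨t, ht1, ht2, ht3⟩ := fixSp_mul_refl_of_arcSplit hn hP hγ hfix
        (u := act γ * L.prod⁻¹) (v := L.prod) (by group) (by omega) (hΩ _ (by omega)) h2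
        (by omega) h3 h1
      refine ⟨t :: L, by simp [hL1], ?_, ?_⟩
      · intro s hs
        rcases List.mem_cons.1 hs with rfl | hs
        · exact ht1
        · exact hL2 s hs
      · intro m hm
        cases m with
        | zero =>
          rw [List.drop_zero, List.prod_cons, mul_inv_rev, ← mul_assoc,
            inv_eq_of_mul_eq_one_right ht3, ht2, add_zero]
        | succ m =>
          rw [List.drop_succ_cons, hL3 m (by omega)]
          congr 1
          omega
  obtain ⟨L, hL1, hL2, hL3⟩ := main n le_rfl
  have hL3' : ∀ m ≤ n, fixSp (act γ * (L.drop m).prod⁻¹) = Ω m := by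
    intro m hm
    rw [hL3 m hm]
    simp
  have hLc : L.prod = act γ := by
    have h0 := hL3' 0 (by omega)
    have h1 : Ω 0 = ⊤ := Submodule.eq_top_of_finrank_eq (by
      rw [hrank 0 (by omega), finrank_euclideanSpace_fin]; omega)
    rw [h1, List.drop_zero] at h0
    have h2 : act γ * L.prod⁻¹ = 1 := by
      ext1 x
      have : x ∈ fixSp (act γ * L.prod⁻¹) := h0 ▸ Submodule.mem_top
      exact this
    exact (mul_inv_eq_one.1 h2).symm
  have hLm : ∀ m ≤ n, fixSp (L.take m).prod = Ω m := by
    intro m hm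
    rw [← hL3' m hm, ← hLc, ← List.prod_take_mul_prod_drop L m]
    congr 1
    group
  have htake : ∀ m, ∀ t ∈ L.take m, t ∈ reflections n := fun m t ht =>
    hL2 t (List.mem_of_mem_take ht)
  intro k hk
  refine ⟨hΩ k hk, (L.take k).prod, prod_mem_W (htake k), ⟨L.take k, L, ⟨htake k, rfl, ?_⟩,
    ⟨hL2, hLc, ?_⟩, List.take_sublist k L⟩, ?_⟩
  · intro l hl1 hl2
    have := finrank_fixSp_prod hl1
    rw [hl2, hLm k hk, hrank k hk] at this
    rw [List.length_take]
    omega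
  · intro l hl1 hl2
    have := finrank_fixSp_prod hl1
    have h1 : fixSp (act γ) = ⊥ := by
      rw [eq_bot_iff]
      exact fun x hx => hfix x hx
    rw [hl2, h1, finrank_bot] at this
    omega
  · intro x
    rw [← hLm k hk]
    rfl

end
end TypeB

namespace TypeB
noncomputable section

variable {n : ℕ}

/-! ### Splitting a class of a set partition -/

/-- The relation obtained by separating `S` and `-S` from the rest. -/
def split (r : SIdx n → SIdx n → Prop) (S : Set (SIdx n)) (x y : SIdx n) : Prop :=
  r x y ∧ (x ∈ S ↔ y ∈ S) ∧ (negIdx x ∈ S ↔ negIdx y ∈ S)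

/-- `S` is a proper nonempty part of the class `b`, disjoint from its opposite. -/
structure IsPiece (r : SIdx n → SIdx n → Prop) (b S : Set (SIdx n)) : Prop where
  isClass : ∃ a, b = {x | r a x}
  subset : S ⊆ b
  nonempty : S.Nonempty
  ne : S ≠ b
  neg : ∀ x ∈ S, negIdx x ∉ S

theorem IsPiece.rel_of_mem {r : SIdx n → SIdx n → Prop} (hr : IsBPart r) {b S : Set (SIdx n)}
    (h : IsPiece r b S) {x y : SIdx n} (hx : x ∈ b) (hy : y ∈ b) : r x y := by
  obtain ⟨a, rfl⟩ := h.isClass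
  exact hr.equiv.trans (hr.equiv.symm hx) hy

theorem IsPiece.mem_of_rel {r : SIdx n → SIdx n → Prop} (hr : IsBPart r) {b S : Set (SIdx n)}
    (h : IsPiece r b S) {x y : SIdx n} (hx : x ∈ b) (hy : r x y) : y ∈ b := by
  obtain ⟨a, rfl⟩ := h.isClass
  exact hr.equiv.trans hx hy

theorem isBPart_split {r : SIdx n → SIdx n → Prop} (hr : IsBPart r) {S : Set (SIdx n)}
    (hS : ∀ x ∈ S, negIdx x ∉ S) : IsBPart (split r S) where
  equiv := ⟨fun x => ⟨hr.equiv.refl x, Iff.rfl, Iff.rfl⟩,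
    fun h => ⟨hr.equiv.symm h.1, h.2.1.symm, h.2.2.symm⟩,
    fun h h' => ⟨hr.equiv.trans h.1 h'.1, h.2.1.trans h'.2.1, h.2.2.trans h'.2.2⟩⟩
  neg a b h := ⟨hr.neg _ _ h.1, h.2.2, by simpa using h.2.1⟩
  zero a b ha hb := by
    refine ⟨hr.zero a b ha.1 hb.1, ?_⟩
    have h1 := hS a
    have h2 := hS b
    have h3 := ha.2.1
    have h4 := hb.2.1
    tauto

/-- `S` does not alternate with the rest of `b` in the cyclic order. -/
def NoAlt (P : ℤ → SIdx n) (S b : Set (SIdx n)) : Prop :=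
  ∀ i j k l : ℤ, i < j → j < k → k < l → l < i + 2 * n → P i ∈ S → P k ∈ S →
    P j ∈ b → P j ∉ S → P l ∈ b → P l ∉ S → False

/-- Once r is noncrossing, a new crossing can only involve the broken class and its opposite, so it
is an alternation of the piece with the rest of b. -/
theorem NC_split_iff {P : ℤ → SIdx n} (hP : IsCoxEnum P) {r : SIdx n → SIdx n → Prop}
    (hr : IsBPart r) (hNC : NC P r) {b S : Set (SIdx n)} (h : IsPiece r b S) :
    NC P (split r S) ↔ NoAlt P S b := by
  have hr' := isBPart_split hr h.neg
  constructor
  · intro hNC'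
    have hSS {x y : SIdx n} (hx : x ∈ S) (hy : y ∈ S) : split r S x y :=
      ⟨h.rel_of_mem hr (h.subset hx) (h.subset hy), by simp [hx, hy],
        by simp [h.neg x hx, h.neg y hy]⟩
    -- In a zero class the rest of b splits further into -S and a smaller zero class, so an
    -- alternation with one point in each is not itself a crossing. Here P j is in -S and P l in the
    -- smaller zero class: then P (j + n) is in S and P (l - n) is related to P l, and these
    -- antipodes produce a crossing wherever l - n lies.
    have core : ∀ i j k l : ℤ, i < j → j < k → k < l → l < i + 2 * n → P i ∈ S → P k ∈ S →
        P j ∈ b → P l ∈ b → P l ∉ S → negIdx (P j) ∈ S → negIdx (P l) ∉ S → False := by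
      intro i j k l hij hjk hkl hli hi hk hj hl hlS hj' hl'
      have hzj : r (P j) (negIdx (P j)) := h.rel_of_mem hr hj (h.subset hj')
      have hzl : r (P l) (negIdx (P l)) := by
        have := h.rel_of_mem hr hl hj
        exact hr.equiv.trans this (hr.equiv.trans hzj (hr.neg _ _ (hr.equiv.symm this)))
      have hl2 : split r S (P (l - n)) (P l) := by
        rw [hP.sub_n]
        exact ⟨hr.equiv.symm hzl, by simp [hlS, hl'], by simp [hlS, hl']⟩
      rw [← hP.sub_n] at hl'
      rw [← hP.add_n] at hj'
      have h1 : l - n ≠ i := by rintro rfl; exact hl' hi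
      have h2 : l - n ≠ k := by rintro rfl; exact hl' hk
      rcases lt_or_gt_of_ne h1 with h3 | h3
      · have := hNC' (l - n) i l (j + n) (by omega) (by omega) (by omega) (by omega) hl2 (hSS hi hj')
        exact hl' (this.2.1.2 hi)
      rcases lt_or_gt_of_ne h2 with h4 | h4
      · have := hNC' i (l - n) k l (by omega) (by omega) (by omega) (by omega) (hSS hi hk) hl2
        exact hl' (this.2.1.1 hi)
      · have := hNC' (l - n) (j + n) l (i + 2 * n) (by omega) (by omega) (by omega) (by omega) hl2
          (hSS hj' (by rwa [hP.add_two_n]))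
        exact hl' (this.2.1.2 hj')
    intro i j k l hij hjk hkl hli hi hk hj hjS hl hlS
    by_cases h1 : negIdx (P j) ∈ S <;> by_cases h2 : negIdx (P l) ∈ S
    · have := hNC' i j k l hij hjk hkl hli (hSS hi hk)
        ⟨h.rel_of_mem hr hj hl, by simp [hjS, hlS], by simp [h1, h2]⟩
      exact hjS (this.2.1.1 hi)
    · exact core i j k l hij hjk hkl hli hi hk hj hl hlS h1 h2
    · refine core k l (i + 2 * n) (j + 2 * n) hkl hli (by omega) (by omega) hk ?_ hl ?_ ?_ h2 ?_
      all_goals rwa [hP.add_two_n]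
    · have := hNC' i j k l hij hjk hkl hli (hSS hi hk)
        ⟨h.rel_of_mem hr hj hl, by simp [hjS, hlS], by simp [h1, h2]⟩
      exact hjS (this.2.1.1 hi)
  · intro hA
    have core : ∀ i j k l : ℤ, i < j → j < k → k < l → l < i + 2 * n →
        split r S (P i) (P k) → split r S (P j) (P l) → (P i ∈ S ↔ P j ∈ S) := by
      intro i j k l hij hjk hkl hli hik hjl
      have hrij := hNC i j k l hij hjk hkl hli hik.1 hjl.1
      by_cases h1 : P i ∈ S <;> by_cases h2 : P j ∈ S
      · simp [h1, h2]
      · exact (hA i j k l hij hjk hkl hli h1 (hik.2.1.1 h1) (h.mem_of_rel hr (h.subset h1) hrij) h2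
          (h.mem_of_rel hr (h.subset h1) (hr.equiv.trans hrij hjl.1))
          (fun h3 => h2 (hjl.2.1.2 h3))).elim
      · refine (hA j k l (i + 2 * n) hjk hkl hli (by omega) h2 (hjl.2.1.1 h2)
          (h.mem_of_rel hr (h.subset h2) (hr.equiv.trans (hr.equiv.symm hrij) hik.1))
          (fun h3 => h1 (hik.2.1.2 h3)) ?_ ?_).elim
        · rw [hP.add_two_n]
          exact h.mem_of_rel hr (h.subset h2) (hr.equiv.symm hrij)
        · rwa [hP.add_two_n]
      · simp [h1, h2]
    intro i j k l hij hjk hkl hli hik hjl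
    refine ⟨hNC i j k l hij hjk hkl hli hik.1 hjl.1, core i j k l hij hjk hkl hli hik hjl, ?_⟩
    have := core (i + n) (j + n) (k + n) (l + n) (by omega) (by omega) (by omega) (by omega)
    simp only [hP.add_n] at this
    exact this (hr'.neg _ _ hik) (hr'.neg _ _ hjl)

/-- `S` is an initial segment of `b` for the order given by `f`. -/
def IsInit (f : SIdx n → ℤ) (S b : Set (SIdx n)) : Prop :=
  ∀ x ∈ S, ∀ y ∈ b, f y < f x → y ∈ S

/-- If S is neither an initial nor a final segment, convexity of S gives y, y' in b outside S with
all of S between them. If y and y' stay related, this contradicts convexity. Otherwise exactly one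
of them is in -S, the other lies in the remaining zero class, and that one and its opposite enclose
S. -/
theorem conv_split_iff {r : SIdx n → SIdx n → Prop} (hr : IsBPart r) {b S : Set (SIdx n)}
    (h : IsPiece r b S) :
    Conv (split r S) r ↔ IsInit sv S b ∨ IsInit (fun x => -sv x) S b := by
  have hr' := isBPart_split hr h.neg
  constructor
  · intro hC
    by_contra hcon
    push Not at hcon
    obtain ⟨h1, h2⟩ := hcon
    simp only [IsInit, not_forall] at h1 h2
    obtain ⟨x, hx, y, hy, hyx, hyS⟩ := h1
    obtain ⟨x', hx', y', hy', hyx', hyS'⟩ := h2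
    have hSS {x y : SIdx n} (hx : x ∈ S) (hy : y ∈ S) : split r S x y :=
      ⟨h.rel_of_mem hr (h.subset hx) (h.subset hy), by simp [hx, hy],
        by simp [h.neg x hx, h.neg y hy]⟩
    have lo : ∀ u ∈ S, sv y < sv u := by
      intro u hu
      by_contra hlt
      have hne : sv y ≠ sv u := fun h => hyS (sv_injective h ▸ hu)
      have := hC u y x (by omega) hyx (hSS hu hx) (h.rel_of_mem hr (h.subset hu) hy)
      exact hyS (this.2.1.1 hu)
    have hi : ∀ u ∈ S, sv u < sv y' := by
      intro u hu
      by_contra hlt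
      have hne : sv y' ≠ sv u := fun h => hyS' (sv_injective h ▸ hu)
      have := hC x' y' u (by omega) (by omega) (hSS hx' hu) (h.rel_of_mem hr (h.subset hx') hy')
      exact hyS' (this.2.1.1 hx')
    have hyy : r y y' := h.rel_of_mem hr hy hy'
    have hyx2 : r y x := h.rel_of_mem hr hy (h.subset hx)
    by_cases h3 : negIdx y ∈ S <;> by_cases h4 : negIdx y' ∈ S
    · have := hC y x y' hyx (hi x hx) ⟨hyy, by simp [hyS, hyS'], by simp [h3, h4]⟩ hyx2
      exact hyS (this.2.1.2 hx)
    · have h5 := hi _ h3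
      rw [sv_negIdx] at h5
      have hz : r y (negIdx y) := h.rel_of_mem hr hy (h.subset h3)
      have hz' : r (negIdx y') y' := hr.equiv.trans (hr.neg _ _ (hr.equiv.symm hyy))
        (hr.equiv.trans (hr.equiv.symm hz) hyy)
      have := hC (negIdx y') x y' (by rw [sv_negIdx]; omega) (hi x hx)
        ⟨hz', by simp [hyS', h4], by simp [hyS', h4]⟩
        (hr.equiv.trans hz' (hr.equiv.trans (hr.equiv.symm hyy) hyx2))
      exact h4 (this.2.1.2 hx)
    · have h5 := lo _ h4
      rw [sv_negIdx] at h5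
      have hz' : r y' (negIdx y') := h.rel_of_mem hr hy' (h.subset h4)
      have hz : r y (negIdx y) := hr.equiv.trans hyy
        (hr.equiv.trans hz' (hr.neg _ _ (hr.equiv.symm hyy)))
      have := hC y x (negIdx y) hyx (by have := hi x hx; rw [sv_negIdx]; omega)
        ⟨hz, by simp [hyS, h3], by simp [hyS, h3]⟩ hyx2
      exact hyS (this.2.1.2 hx)
    · have := hC y x y' hyx (hi x hx) ⟨hyy, by simp [hyS, hyS'], by simp [h3, h4]⟩ hyx2
      exact hyS (this.2.1.2 hx)
  · have core : ∀ a t c, sv a < sv t → sv t < sv c → r a c → r a t → (a ∈ S ↔ c ∈ S) →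
        (IsInit sv S b ∨ IsInit (fun x => -sv x) S b) → (a ∈ S ↔ t ∈ S) := by
      intro a t c hat htc hac hrat hiff hI
      rcases hI with hI | hI
      · constructor
        · intro ha
          exact hI c (hiff.1 ha) t (h.mem_of_rel hr (h.subset ha) hrat) htc
        · intro ht
          exact hI t ht a (h.mem_of_rel hr (h.subset ht) (hr.equiv.symm hrat)) hat
      · constructor
        · intro ha
          exact hI a ha t (h.mem_of_rel hr (h.subset ha) hrat) (by simpa using hat)
        · intro ht
          exact hiff.2 (hI t ht c (h.mem_of_rel hr (h.subset ht)
            (hr.equiv.trans (hr.equiv.symm hrat) hac)) (by simpa using htc))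
    intro hI a t c hat htc hac hrat
    refine ⟨hrat, core a t c hat htc hac.1 hrat hac.2.1 hI, ?_⟩
    have hct : r (negIdx c) (negIdx t) :=
      hr.neg _ _ (hr.equiv.trans (hr.equiv.symm hac.1) hrat)
    have := core (negIdx c) (negIdx t) (negIdx a) (by simpa using htc) (by simpa using hat)
      (hr.neg _ _ (hr.equiv.symm hac.1)) hct hac.2.2.symm hI
    exact hac.2.2.trans this

/-! ### Cyclic enumeration of a class -/

/-- A cyclic enumeration with period `m` of the set `b`. -/
structure IsCycEnum {α : Type*} (Q : ℕ → α) (b : Set α) (m : ℕ) : Prop where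
  mem : ∀ k, Q k ∈ b
  per : ∀ k, Q (k + m) = Q k
  inj : ∀ k l, k < l → l < k + m → Q k ≠ Q l
  surj : ∀ x ∈ b, ∀ K, ∃ k, K ≤ k ∧ k < K + m ∧ Q k = x

/-- `S` does not alternate with its complement in the enumeration. -/
def NoAltQ {α : Type*} (Q : ℕ → α) (m : ℕ) (S : Set α) : Prop :=
  ∀ i j k l : ℕ, i < j → j < k → k < l → l < i + m → Q i ∈ S → Q k ∈ S →
    Q j ∉ S → Q l ∉ S → False

section CycEnum

variable {α : Type*} {Q : ℕ → α} {b : Set α} {m : ℕ}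

theorem IsCycEnum.injOn (h : IsCycEnum Q b m) (k : ℕ) {t : ℕ} (ht : t ≤ m) :
    Set.InjOn Q (Finset.Ico k (k + t)) := by
  intro x hx y hy hxy
  simp only [Finset.coe_Ico, Set.mem_Ico] at hx hy
  by_contra hne
  rcases lt_or_gt_of_ne hne with h' | h'
  · exact h.inj x y h' (by omega) hxy
  · exact h.inj y x h' (by omega) hxy.symm

theorem IsCycEnum.ncard_image (h : IsCycEnum Q b m) (k : ℕ) {t : ℕ} (ht : t ≤ m) :
    (Q '' Set.Ico k (k + t)).ncard = t := by
  have := h.injOn k ht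
  rw [Finset.coe_Ico] at this
  rw [this.ncard_image]
  simp [Set.ncard_eq_toFinset_card']

theorem IsCycEnum.ncard_eq (h : IsCycEnum Q b m) : b.ncard = m := by
  have hb : b = Q '' Set.Ico 0 (0 + m) := by
    ext x
    constructor
    · intro hx
      obtain ⟨k, h1, h2, rfl⟩ := h.surj x hx 0
      exact ⟨k, ⟨h1, h2⟩, rfl⟩
    · rintro ⟨k, -, rfl⟩
      exact h.mem k
  rw [hb, h.ncard_image 0 le_rfl]

theorem IsCycEnum.noAltQ_arc (h : IsCycEnum Q b m) (k t : ℕ) :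
    NoAltQ Q m (Q '' Set.Ico k (k + t)) := by
  intro i j u l hij hju hul hli hi hu hj hl
  have per : ∀ s : ℕ, ∀ x, Q (x + s * m) = Q x := by
    intro s
    induction s with
    | zero => simp
    | succ s ih =>
      intro x
      rw [Nat.succ_mul, ← add_assoc, h.per, ih]
  obtain ⟨i', ⟨h1, h2⟩, h3⟩ := hi
  have hlow : ∃ i₀, k ≤ i₀ ∧ i₀ < k + t ∧ i₀ < k + m ∧ Q i₀ = Q i := by
    obtain ⟨i₀, h4, h5, h6⟩ := h.surj _ (h.mem i) k
    refine ⟨i₀, h4, ?_, h5, h6⟩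
    by_contra h7
    have h8 : i' < k + m := by omega
    rcases lt_trichotomy i' i₀ with h9 | h9 | h9
    · exact h.inj i' i₀ h9 (by omega) (h3.trans h6.symm)
    · omega
    · omega
  obtain ⟨i₀, h4, h5, h6, h7⟩ := hlow
  have hmod : i₀ % m = i % m := by
    by_contra hne
    have hm : 0 < m := by omega
    have e1 : Q (i₀ % m) = Q (i % m) := by
      have a1 := per (i₀ / m) (i₀ % m)
      have a2 := per (i / m) (i % m)
      rw [Nat.mod_add_div'] at a1 a2
      rw [← a1, ← a2, h7]
    have b1 := Nat.mod_lt i₀ hm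
    have b2 := Nat.mod_lt i hm
    rcases lt_or_gt_of_ne hne with h' | h'
    · exact h.inj _ _ h' (by omega) e1
    · exact h.inj _ _ h' (by omega) e1.symm
  have shift : ∀ d, Q (i₀ + d) = Q (i + d) := by
    intro d
    have a1 := per (i₀ / m) (i₀ % m + d)
    have a2 := per (i / m) (i % m + d)
    have c1 := Nat.mod_add_div' i₀ m
    have c2 := Nat.mod_add_div' i m
    rw [show i₀ % m + d + i₀ / m * m = i₀ + d by omega] at a1
    rw [show i % m + d + i / m * m = i + d by omega] at a2
    rw [a1, a2, hmod]
  have hj' : k + t ≤ i₀ + (j - i) := by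
    by_contra hcon
    apply hj
    refine ⟨i₀ + (j - i), ⟨by omega, by omega⟩, ?_⟩
    rw [shift]
    congr 1
    omega
  obtain ⟨u', ⟨h8, h9⟩, h10⟩ := hu
  have hu' : k + m ≤ i₀ + (u - i) := by
    by_contra hcon
    refine h.inj u' (i₀ + (u - i)) (by omega) (by omega) ?_
    rw [h10, shift]
    congr 1
    omega
  apply hl
  refine ⟨i₀ + (l - i) - m, ⟨by omega, by omega⟩, ?_⟩
  rw [← h.per, Nat.sub_add_cancel (by omega), shift]
  congr 1
  omega

/-- Starting outside S, let k be the first entry into S and k + t the next exit; a second entry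
would be an alternation. The bounds on k leave room for its predecessor k - 1 and bring k into the
first period after at most one shift. -/
theorem IsCycEnum.exists_arc (h : IsCycEnum Q b m) {S : Set α} (hS : S ⊆ b) (hne : S.Nonempty)
    (hb : S ≠ b) (hA : NoAltQ Q m S) :
    ∃ k t, 1 ≤ k ∧ k < 2 * m ∧ 0 < t ∧ t < m ∧ S = Q '' Set.Ico k (k + t) ∧
      ∀ s, t ≤ s → s < m → Q (k + s) ∉ S := by
  classical
  obtain ⟨x, hx⟩ := hne
  obtain ⟨y, hy, hyS⟩ : ∃ y ∈ b, y ∉ S := by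
    by_contra hcon
    push Not at hcon
    exact hb (hS.antisymm hcon)
  obtain ⟨κ, -, hκ, rfl⟩ := h.surj y hy 0
  obtain ⟨κ', hκ1, hκ2, rfl⟩ := h.surj x (hS hx) (κ + 1)
  have hex : ∃ k, κ < k ∧ Q k ∈ S := ⟨κ', by omega, hx⟩
  obtain ⟨hk1, hk2⟩ := Nat.find_spec hex
  have hkle := Nat.find_min' hex ⟨(by omega : κ < κ'), hx⟩
  have hkmin := fun j (hj : j < Nat.find hex) => Nat.find_min hex hj
  generalize Nat.find hex = k at *
  have hprev : Q (k - 1) ∉ S := by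
    by_cases h1 : k - 1 = κ
    · rwa [h1]
    · intro h2
      exact hkmin (k - 1) (by omega) ⟨by omega, h2⟩
  have hm : κ' ≠ κ + m := fun h1 => hyS (by rwa [h1, h.per] at hx)
  have hlast : Q (k + (m - 1)) ∉ S := by
    have := h.per (k - 1)
    rwa [← this, show k - 1 + m = k + (m - 1) by omega] at hprev
  have hex2 : ∃ t, Q (k + t) ∉ S := ⟨m - 1, hlast⟩
  have ht1 := Nat.find_spec hex2
  have htle := Nat.find_min' hex2 hlast
  have htmin := fun j (hj : j < Nat.find hex2) => Nat.find_min hex2 hj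
  generalize Nat.find hex2 = t at *
  have ht0 : 0 < t := by
    rcases Nat.eq_zero_or_pos t with rfl | h1
    · exact (ht1 hk2).elim
    · exact h1
  have hrest : ∀ s, t ≤ s → s < m → Q (k + s) ∉ S := by
    intro s hts hsm hsS
    have h1 : s ≠ t := by rintro rfl; exact ht1 hsS
    have h2 : s ≠ m - 1 := by rintro rfl; exact hlast hsS
    exact hA k (k + t) (k + s) (k + (m - 1)) (by omega) (by omega) (by omega) (by omega) hk2 hsS
      ht1 hlast
  refine ⟨k, t, by omega, by omega, ht0, by omega, ?_, hrest⟩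
  ext z
  constructor
  · intro hz
    obtain ⟨s, h1, h2, rfl⟩ := h.surj z (hS hz) k
    refine ⟨s, ⟨h1, ?_⟩, rfl⟩
    by_contra h3
    apply hrest (s - k) (by omega) (by omega)
    rwa [show k + (s - k) = s by omega]
  · rintro ⟨s, ⟨h1, h2⟩, rfl⟩
    have := htmin (s - k) (by omega)
    rw [not_not, show k + (s - k) = s by omega] at this
    exact this

/-- The start of a proper nonempty arc is its only element whose predecessor is outside the arc. -/
theorem IsCycEnum.arc_injOn (h : IsCycEnum Q b m) {t : ℕ} (ht0 : 0 < t) (htm : t < m) :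
    Set.InjOn (fun k => Q '' Set.Ico k (k + t)) (Finset.range m) := by
  have key : ∀ k l, k < l → l < k + m → Q '' Set.Ico k (k + t) ≠ Q '' Set.Ico l (l + t) := by
    intro k l hkl hlk heq
    have h1 : Q l ∈ Q '' Set.Ico k (k + t) := heq ▸ ⟨l, ⟨le_rfl, by omega⟩, rfl⟩
    obtain ⟨s, ⟨h2, h3⟩, h4⟩ := h1
    have h5 : s = l := by
      rcases lt_trichotomy s l with h6 | h6 | h6
      · exact (h.inj s l h6 (by omega) h4).elim
      · exact h6
      · exact (h.inj l s h6 (by omega) h4.symm).elim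
    subst h5
    have h6 : Q (s - 1) ∈ Q '' Set.Ico s (s + t) := heq ▸ ⟨s - 1, ⟨by omega, by omega⟩, rfl⟩
    obtain ⟨u, ⟨h7, h8⟩, h9⟩ := h6
    exact h.inj (s - 1) u (by omega) (by omega) h9.symm
  intro k hk l hl heq
  simp only [Finset.coe_range, Set.mem_Iio] at hk hl
  by_contra hne
  rcases lt_or_gt_of_ne hne with h' | h'
  · exact key k l h' (by omega) heq
  · exact key l k h' (by omega) heq.symm

theorem IsCycEnum.ncard_noAltQ (h : IsCycEnum Q b m) {t : ℕ} (ht0 : 0 < t) (htm : t < m) :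
    {S : Set α | S ⊆ b ∧ S.ncard = t ∧ NoAltQ Q m S}.ncard = m := by
  have heq : {S : Set α | S ⊆ b ∧ S.ncard = t ∧ NoAltQ Q m S} =
      (fun k => Q '' Set.Ico k (k + t)) '' (Finset.range m : Set ℕ) := by
    ext S
    constructor
    · rintro ⟨h1, h2, h3⟩
      have hne : S.Nonempty := Set.nonempty_of_ncard_ne_zero (by omega)
      have hb : S ≠ b := by
        rintro rfl
        rw [h.ncard_eq] at h2
        omega
      obtain ⟨k, s, hk1, hk2, hs1, hs2, hS, -⟩ := h.exists_arc h1 hne hb h3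
      have hst : s = t := by rw [← h2, hS, h.ncard_image k hs2.le]
      subst hst
      by_cases hkm : k < m
      · exact ⟨k, by simpa using hkm, hS.symm⟩
      · refine ⟨k - m, by simp; omega, ?_⟩
        rw [hS]
        ext x
        constructor
        · rintro ⟨u, ⟨h4, h5⟩, rfl⟩
          exact ⟨u + m, ⟨by omega, by omega⟩, h.per u⟩
        · rintro ⟨u, ⟨h4, h5⟩, rfl⟩
          refine ⟨u - m, ⟨by omega, by omega⟩, ?_⟩
          rw [← h.per, Nat.sub_add_cancel (by omega)]
    · rintro ⟨k, -, rfl⟩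
      refine ⟨?_, h.ncard_image k htm.le, h.noAltQ_arc k t⟩
      rintro _ ⟨s, -, rfl⟩
      exact h.mem s
  rw [heq, (h.arc_injOn ht0 htm).ncard_image]
  simp

end CycEnum

end
end TypeB

/-! ### Enumeration of a class along the Coxeter cycle, and the local count -/

namespace TypeB
noncomputable section

variable {n : ℕ}

theorem nth_add_count {p : ℕ → Prop} [DecidablePred p] {N : ℕ} (hper : ∀ k, p (k + N) ↔ p k)
    (hinf : {k | p k}.Infinite) (k : ℕ) :
    Nat.nth p (k + Nat.count p N) = Nat.nth p k + N := by
  have h1 : p (Nat.nth p k) := Nat.nth_mem_of_infinite hinf k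
  have h2 : Nat.count p (Nat.nth p k) = k := Nat.count_nth_of_infinite hinf k
  have h3 : Nat.count p (Nat.nth p k + N) = k + Nat.count p N := by
    rw [add_comm (Nat.nth p k), Nat.count_add, add_comm k]
    congr 1
    nth_rewrite 2 [← h2]
    congr 1
    ext x
    rw [add_comm, hper]
  rw [← h3]
  exact Nat.nth_count ((hper _).2 h1)

/-- The function q lists the positions along the Coxeter cycle at which b is visited. For b = -b the
half turn k ↦ k + n preserves these positions and so becomes a shift by half the size of b. -/
theorem exists_cycEnum (hn : 1 ≤ n) {P : ℤ → SIdx n} (hP : IsCoxEnum P) {b : Set (SIdx n)}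
    (hb : b.Nonempty) :
    ∃ q : ℕ → ℕ, StrictMono q ∧ (∀ s : ℕ, P s ∈ b → ∃ k, q k = s) ∧
      (∀ k, q (k + b.ncard) = q k + 2 * n) ∧ IsCycEnum (fun k => P (q k)) b b.ncard ∧
      ((∀ x ∈ b, negIdx x ∈ b) → ∃ h, b.ncard = 2 * h ∧ ∀ k, q (k + h) = q k + n) := by
  classical
  let p : ℕ → Prop := fun s => P s ∈ b
  have hper : ∀ k, p (k + 2 * n) ↔ p k := by
    intro k
    simp only [p]
    push_cast
    rw [hP.add_two_n]
  have hfind : ∀ x ∈ b, ∀ K : ℕ, ∃ s : ℕ, K ≤ s ∧ s < K + 2 * n ∧ P s = x := by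
    intro x hx K
    obtain ⟨t, h1, h2, h3⟩ := hP.exists_between hn K x
    exact ⟨t.toNat, by omega, by omega, by rw [Int.toNat_of_nonneg (by omega), h3]⟩
  have hinf : {k | p k}.Infinite := by
    obtain ⟨x, hx⟩ := hb
    rw [Set.infinite_iff_exists_gt]
    intro K
    obtain ⟨s, h1, -, h3⟩ := hfind x hx (K + 1)
    exact ⟨s, by simpa [p, h3] using hx, by omega⟩
  have hmono : StrictMono (Nat.nth p) := Nat.nth_strictMono hinf
  have hmem : ∀ k, P (Nat.nth p k) ∈ b := fun k => Nat.nth_mem_of_infinite hinf k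
  have hsurj : ∀ s : ℕ, P s ∈ b → ∃ k, Nat.nth p k = s := fun s hs =>
    ⟨Nat.count p s, Nat.nth_count (p := p) hs⟩
  have hper' := nth_add_count hper hinf
  have hcyc : IsCycEnum (fun k => P (Nat.nth p k)) b (Nat.count p (2 * n)) := by
    refine ⟨hmem, fun k => ?_, fun k l hkl hlk heq => ?_, fun x hx K => ?_⟩
    · simp only [hper']
      push_cast
      exact hP.add_two_n _
    · have h1 := hmono hkl
      have h2 := hmono hlk
      rw [hper'] at h2
      have := hP.eq_of_abs_lt heq (by omega) (by omega)
      omega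
    · obtain ⟨s, h1, h2, h3⟩ := hfind x hx (Nat.nth p K)
      obtain ⟨k, rfl⟩ := hsurj s (h3 ▸ hx)
      rw [← hper' K] at h2
      exact ⟨k, hmono.le_iff_le.1 h1, hmono.lt_iff_lt.1 h2, h3⟩
  have hcard := hcyc.ncard_eq
  refine ⟨Nat.nth p, hmono, hsurj, by rwa [hcard], by rwa [hcard], fun hz => ?_⟩
  have hpern : ∀ k, p (k + n) ↔ p k := by
    intro k
    simp only [p]
    push_cast
    rw [hP.add_n]
    exact ⟨fun h => by simpa using hz _ h, fun h => hz _ h⟩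
  refine ⟨Nat.count p n, ?_, nth_add_count hpern hinf⟩
  rw [hcard, two_mul n, Nat.count_add, two_mul]
  congr 1
  congr 1
  ext x
  rw [add_comm, hpern]

theorem noAlt_iff (hn : 1 ≤ n) {P : ℤ → SIdx n} (hP : IsCoxEnum P) {b S : Set (SIdx n)}
    (hS : S ⊆ b) {q : ℕ → ℕ} {m : ℕ} (hmono : StrictMono q)
    (hsurj : ∀ s : ℕ, P s ∈ b → ∃ k, q k = s) (hper : ∀ k, q (k + m) = q k + 2 * n)
    (hmem : ∀ k, P (q k) ∈ b) : NoAlt P S b ↔ NoAltQ (fun k => P (q k)) m S := by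
  constructor
  · intro h i j k l hij hjk hkl hli hi hk hj hl
    have h1 := hmono hij
    have h2 := hmono hjk
    have h3 := hmono hkl
    have h4 := hmono hli
    rw [hper] at h4
    exact h (q i) (q j) (q k) (q l) (by omega) (by omega) (by omega) (by omega) hi hk (hmem j) hj
      (hmem l) hl
  · intro h i j k l hij hjk hkl hli hi hk hj hjS hl hlS
    -- A common translation by a multiple of 2n makes all positions nonnegative, so that they are
    -- values of q.
    have hsh : ∀ t : ℤ, i ≤ t → ∃ s : ℕ, (s : ℤ) = t + (-i + i % (2 * n)) ∧ P s = P t := by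
      intro t ht
      refine ⟨(t + (-i + i % (2 * n))).toNat, ?_, ?_⟩
      · have := Int.emod_nonneg i (b := 2 * n) (by omega)
        rw [Int.toNat_of_nonneg (by omega)]
      · have := Int.emod_nonneg i (b := 2 * n) (by omega)
        rw [Int.toNat_of_nonneg (by omega), hP.eq_iff]
        have : t + (-i + i % (2 * n)) - t = -(i - i % (2 * n)) := by ring
        rw [this, Int.dvd_neg]
        exact Int.dvd_self_sub_emod
    obtain ⟨i', ei, hi'⟩ := hsh i le_rfl
    obtain ⟨j', ej, hj'⟩ := hsh j (by omega)
    obtain ⟨k', ek, hk'⟩ := hsh k (by omega)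
    obtain ⟨l', el, hl'⟩ := hsh l (by omega)
    rw [← hi'] at hi
    rw [← hj'] at hj hjS
    rw [← hk'] at hk
    rw [← hl'] at hl hlS
    obtain ⟨i₀, rfl⟩ := hsurj i' (hS hi)
    obtain ⟨j₀, rfl⟩ := hsurj j' hj
    obtain ⟨k₀, rfl⟩ := hsurj k' (hS hk)
    obtain ⟨l₀, rfl⟩ := hsurj l' hl
    have := hper i₀
    exact h i₀ j₀ k₀ l₀ (hmono.lt_iff_lt.1 (by omega)) (hmono.lt_iff_lt.1 (by omega))
      (hmono.lt_iff_lt.1 (by omega)) (hmono.lt_iff_lt.1 (by omega)) hi hk hjS hlS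

theorem arcSplit_of_noAlt (hn : 1 ≤ n) {P : ℤ → SIdx n} (hP : IsCoxEnum P)
    {r : SIdx n → SIdx n → Prop} (hr : IsBPart r) {b S : Set (SIdx n)} (h : IsPiece r b S)
    (hA : NoAlt P S b) : ArcSplit P (split r S) r := by
  obtain ⟨q, hmono, hsurj, hper, hcyc, -⟩ := exists_cycEnum hn hP (h.nonempty.mono h.subset)
  rw [noAlt_iff hn hP h.subset hmono hsurj hper hcyc.mem] at hA
  obtain ⟨k, t, hk1, -, ht0, htm, hS, hrest⟩ := hcyc.exists_arc h.subset h.nonempty h.ne hA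
  have hp := hper (k - 1)
  -- The cut points are the last element before the arc and the last element of the arc, since the
  -- arcs in `ArcSplit` are open on the left and closed on the right.
  refine ⟨q (k - 1), q (k + t - 1), ?_, ?_, h.rel_of_mem hr (hcyc.mem _) (hcyc.mem _), ?_⟩
  · have := hmono (show k - 1 < k + t - 1 by omega)
    omega
  · have := hmono (show k + t - 1 < k - 1 + b.ncard by omega)
    omega
  · intro s u his hsj hju hui hrs hsu
    have hsb : P s ∈ b := h.mem_of_rel hr (hcyc.mem _) hrs
    have hub : P u ∈ b := h.mem_of_rel hr hsb hsu.1
    obtain ⟨s, rfl⟩ : ∃ s' : ℕ, s = s' := ⟨s.toNat, by omega⟩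
    obtain ⟨u, rfl⟩ : ∃ u' : ℕ, u = u' := ⟨u.toNat, by omega⟩
    obtain ⟨x, rfl⟩ := hsurj s hsb
    obtain ⟨y, rfl⟩ := hsurj u hub
    have h1 := hmono.lt_iff_lt.1 (show q (k - 1) < q x by omega)
    have h2 := hmono.le_iff_le.1 (show q x ≤ q (k + t - 1) by omega)
    have h3 := hmono.lt_iff_lt.1 (show q (k + t - 1) < q y by omega)
    have h4 := hmono.le_iff_le.1 (show q y ≤ q (k - 1 + b.ncard) by omega)
    have hxS : P (q x) ∈ S := by
      rw [hS]
      exact ⟨x, ⟨by omega, by omega⟩, rfl⟩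
    have := hrest (y - k) (by omega) (by omega)
    rw [show k + (y - k) = y by omega] at this
    exact this (hsu.2.1.1 hxS)

/-- A threshold separates an initial or final segment from the rest of b. An alternation would force
the cycle to cross it upwards twice within one period. -/
theorem noAlt_of_isInit {P : ℤ → SIdx n} (hP : IsCoxEnum P) {b S : Set (SIdx n)}
    (h : IsInit sv S b ∨ IsInit (fun x => -sv x) S b) : NoAlt P S b := by
  have exit : ∀ (t : ℤ) (d : ℕ) (i : ℤ), sv (P i) < t → t ≤ sv (P (i + d)) →
      ∃ k, i ≤ k ∧ k < i + d ∧ sv (P k) < t ∧ t ≤ sv (P (k + 1)) := by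
    intro t d
    induction d with
    | zero => intro i h1 h2; simp at h2; omega
    | succ d ih =>
      intro i h1 h2
      by_cases h3 : t ≤ sv (P (i + d))
      · obtain ⟨k, h4, h5, h6⟩ := ih i h1 h3
        exact ⟨k, h4, by push_cast; omega, h6⟩
      · exact ⟨i + d, by omega, by push_cast; omega, by omega, by
          rw [add_assoc]; exact_mod_cast h2⟩
  have core : ∀ (t : ℤ) (i j k l : ℤ), i < j → j < k → k < l → l < i + 2 * n →
      sv (P i) < t → t ≤ sv (P j) → sv (P k) < t → t ≤ sv (P l) → False := by
    intro t i j k l hij hjk hkl hli hi hj hk hl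
    obtain ⟨x, h1, h2, h3, h4⟩ := exit t (j - i).toNat i hi (by
      rwa [Int.toNat_of_nonneg (by omega), add_sub_cancel])
    obtain ⟨y, h5, h6, h7, h8⟩ := exit t (l - k).toNat k hk (by
      rwa [Int.toNat_of_nonneg (by omega), add_sub_cancel])
    have := hP.eq_of_abs_lt (hP.exit t x y h3 h4 h7 h8) (by omega) (by omega)
    omega
  intro i j k l hij hjk hkl hli hi hk hj hjS hl hlS
  rcases h with h | h
  · have lt : ∀ {x y}, x ∈ S → y ∈ b → y ∉ S → sv x < sv y := by
      intro x y hx hy hyS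
      by_contra hcon
      have hne : sv y ≠ sv x := fun h => hyS (sv_injective h ▸ hx)
      exact hyS (h x hx y hy (by omega))
    have h1 := lt hi hj hjS
    have h2 := lt hi hl hlS
    have h3 := lt hk hj hjS
    have h4 := lt hk hl hlS
    exact core (min (sv (P j)) (sv (P l))) i j k l hij hjk hkl hli (by omega) (by omega) (by omega)
      (by omega)
  · have lt : ∀ {x y}, x ∈ S → y ∈ b → y ∉ S → sv y < sv x := by
      intro x y hx hy hyS
      by_contra hcon
      have hne : sv y ≠ sv x := fun h => hyS (sv_injective h ▸ hx)
      exact hyS (h x hx y hy (by simp only; omega))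
    have h1 := lt hi hj hjS
    have h2 := lt hi hl hlS
    have h3 := lt hk hj hjS
    have h4 := lt hk hl hlS
    refine core (min (sv (P i)) (sv (P k))) j k l (i + 2 * n) hjk hkl hli (by omega) (by omega)
      (by omega) (by omega) ?_
    rw [hP.add_two_n]
    omega

/-! ### Initial segments -/

theorem exists_isInit (f : SIdx n → ℤ) (b : Set (SIdx n)) (j : ℕ)
    (hj : j ≤ b.ncard) : ∃ S, S ⊆ b ∧ S.ncard = j ∧ IsInit f S b := by
  induction j with
  | zero => exact ⟨∅, Set.empty_subset _, Set.ncard_empty _, fun x hx => hx.elim⟩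
  | succ j ih =>
    obtain ⟨S, h1, h2, h3⟩ := ih (by omega)
    have hne : (b \ S).Nonempty := by
      rw [Set.sdiff_nonempty]
      intro h
      have := Set.ncard_le_ncard h
      omega
    obtain ⟨x, hx, hmin⟩ := Set.exists_min_image (b \ S) f (Set.toFinite _) hne
    refine ⟨insert x S, Set.insert_subset hx.1 h1, ?_, ?_⟩
    · rw [Set.ncard_insert_of_notMem hx.2, h2]
    · intro y hy z hz hlt
      by_cases hzS : z ∈ S
      · exact Or.inr hzS
      rcases hy with rfl | hy
      · exact absurd (hmin z ⟨hz, hzS⟩) (by omega)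
      · exact Or.inr (h3 y hy z hz hlt)

theorem isInit_unique {f : SIdx n → ℤ} (hf : Function.Injective f) {b S T : Set (SIdx n)}
    (hS : S ⊆ b) (hT : T ⊆ b) (hcard : S.ncard = T.ncard) (hSI : IsInit f S b)
    (hTI : IsInit f T b) : S = T := by
  by_cases h : S ⊆ T
  · exact Set.eq_of_subset_of_ncard_le h hcard.ge
  · rw [Set.not_subset] at h
    obtain ⟨x, hx, hxT⟩ := h
    refine (Set.eq_of_subset_of_ncard_le (fun y hy => ?_) hcard.le).symm
    have hne : f y ≠ f x := fun h => hxT (hf h ▸ hy)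
    rcases lt_or_gt_of_ne hne with h' | h'
    · exact hSI x hx y (hT hy) h'
    · exact (hxT (hTI y hy x (hS hx) h')).elim

/-- One initial and one final segment of each size; they differ because a set that is both is empty
or all of b. -/
theorem ncard_isInit (b : Set (SIdx n)) {j : ℕ} (hj0 : 0 < j) (hj : j < b.ncard) :
    {S : Set (SIdx n) | S ⊆ b ∧ S.ncard = j ∧
      (IsInit sv S b ∨ IsInit (fun x => -sv x) S b)}.ncard = 2 := by
  have hf : Function.Injective fun x : SIdx n => -sv x := neg_injective.comp sv_injective
  obtain ⟨S, h1, h2, h3⟩ := exists_isInit sv b j hj.le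
  obtain ⟨T, h4, h5, h6⟩ := exists_isInit (fun x => -sv x) b j hj.le
  rw [Set.ncard_eq_two]
  refine ⟨S, T, ?_, ?_⟩
  · rintro rfl
    obtain ⟨x, hx⟩ : S.Nonempty := Set.nonempty_of_ncard_ne_zero (by omega)
    have : b ⊆ S := by
      intro y hy
      rcases lt_trichotomy (sv y) (sv x) with h | h | h
      · exact h3 x hx y hy h
      · exact sv_injective h ▸ hx
      · exact h6 x hx y hy (by simpa using h)
    have := Set.ncard_le_ncard this
    omega
  · ext U
    simp only [Set.mem_ofPred_eq, Set.mem_insert_iff, Set.mem_singleton_iff]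
    constructor
    · rintro ⟨h7, h8, h9 | h9⟩
      · exact Or.inl (isInit_unique sv_injective h7 h1 (by omega) h9 h3)
      · exact Or.inr (isInit_unique hf h7 h4 (by omega) h9 h6)
    · rintro (rfl | rfl)
      · exact ⟨h1, h2, Or.inl h3⟩
      · exact ⟨h4, h5, Or.inr h6⟩

/-! ### The local generating function -/

/-- On a zero class negation shifts the cyclic enumeration by half its length, which carries an arc
of at most that length off itself. -/
theorem negIdx_notMem_of_noAlt (hn : 1 ≤ n) {P : ℤ → SIdx n} (hP : IsCoxEnum P)
    {b S : Set (SIdx n)} (hb : ∀ x ∈ b, negIdx x ∈ b) (hS : S ⊆ b) (h0 : 0 < S.ncard)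
    (h2 : 2 * S.ncard ≤ b.ncard) (hA : NoAlt P S b) : ∀ x ∈ S, negIdx x ∉ S := by
  have hne : S.Nonempty := Set.nonempty_of_ncard_ne_zero (by omega)
  obtain ⟨q, hmono, hsurj, hper, hcyc, hzero⟩ := exists_cycEnum hn hP (hne.mono hS)
  obtain ⟨h, hh, hq⟩ := hzero hb
  rw [noAlt_iff hn hP hS hmono hsurj hper hcyc.mem] at hA
  have hSb : S ≠ b := by rintro rfl; omega
  obtain ⟨k, t, hk1, -, ht0, htm, hSeq, -⟩ := hcyc.exists_arc hS hne hSb hA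
  have ht : S.ncard = t := by rw [hSeq, hcyc.ncard_image k htm.le]
  intro x hx hx'
  rw [hSeq] at hx hx'
  obtain ⟨u, ⟨h3, h4⟩, rfl⟩ := hx
  obtain ⟨v, ⟨h5, h6⟩, h7⟩ := hx'
  refine hcyc.inj v (u + h) (by omega) (by omega) ?_
  simp only at h7 ⊢
  rw [h7, hq]
  push_cast
  rw [hP.add_n]

open Polynomial in
open Classical in
-- The admissible pieces are the |b| arcs of size j, and two of them, the initial and the final
-- segment, have weight 1 instead of X. The bound on j in a zero class makes disjointness from the
-- opposite automatic for arcs.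
theorem sum_local_weight (hn : 1 ≤ n) {P : ℤ → SIdx n} (hP : IsCoxEnum P)
    {r : SIdx n → SIdx n → Prop} (hr : IsBPart r) (hNC : NC P r) {b : Set (SIdx n)}
    (hb : ∃ a, b = {x | r a x}) {j : ℕ} (hj0 : 0 < j) (hj : j < b.ncard)
    (hz : ∀ x ∈ b, negIdx x ∈ b → 2 * j ≤ b.ncard) :
    (∑ S : Set (SIdx n) with S ⊆ b ∧ S.ncard = j ∧ ∀ x ∈ S, negIdx x ∉ S,
      (if NC P (split r S) then (if Conv (split r S) r then 1 else X) else 0 : ℤ[X])) =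
    2 + X * ((b.ncard : ℤ[X]) - 2) := by
  have hbne : b.Nonempty := Set.nonempty_of_ncard_ne_zero (by omega)
  obtain ⟨q, hmono, hsurj, hper, hcyc, -⟩ := exists_cycEnum hn hP hbne
  have hpiece : ∀ S, S ⊆ b ∧ S.ncard = j ∧ (∀ x ∈ S, negIdx x ∉ S) → IsPiece r b S := by
    rintro S ⟨h1, h2, h3⟩
    exact ⟨hb, h1, Set.nonempty_of_ncard_ne_zero (by omega), by rintro rfl; omega, h3⟩
  have hneg : ∀ S, S ⊆ b → S.ncard = j → NoAlt P S b → ∀ x ∈ S, negIdx x ∉ S := by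
    intro S h1 h2 h3 x hx hx'
    have hxb := h1 hx
    have hxb' := h1 hx'
    have h4 := hz x hxb hxb'
    refine negIdx_notMem_of_noAlt hn hP (fun y hy => ?_) h1 (by omega) (by omega) h3 x hx hx'
    obtain ⟨a, rfl⟩ := hb
    have h5 : r x y := hr.equiv.trans (hr.equiv.symm hxb) hy
    exact hr.equiv.trans hxb' (hr.neg _ _ h5)
  have h1 : ∀ S, S ⊆ b ∧ S.ncard = j ∧ (∀ x ∈ S, negIdx x ∉ S) →
      (if NC P (split r S) then (if Conv (split r S) r then 1 else X) else 0 : ℤ[X]) =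
      if NoAlt P S b then (if IsInit sv S b ∨ IsInit (fun x => -sv x) S b then 1 else X) else 0 :=
    fun S hS => by
      rw [if_congr (NC_split_iff hP hr hNC (hpiece S hS))
        (if_congr (conv_split_iff hr (hpiece S hS)) rfl rfl) rfl]
  rw [Finset.sum_congr rfl fun S hS => h1 S (by simpa using hS), ← Finset.sum_filter,
    Finset.filter_filter]
  have h2 : (Finset.univ.filter fun S : Set (SIdx n) => (S ⊆ b ∧ S.ncard = j ∧
      ∀ x ∈ S, negIdx x ∉ S) ∧ NoAlt P S b) =
      Finset.univ.filter fun S => S ⊆ b ∧ S.ncard = j ∧ NoAlt P S b := by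
    ext S
    simp only [Finset.mem_filter, Finset.mem_univ, true_and]
    constructor
    · rintro ⟨⟨h3, h4, -⟩, h5⟩
      exact ⟨h3, h4, h5⟩
    · rintro ⟨h3, h4, h5⟩
      exact ⟨⟨h3, h4, hneg S h3 h4 h5⟩, h5⟩
  rw [h2, Finset.sum_ite, Finset.sum_const, Finset.sum_const]
  set F := Finset.univ.filter fun S : Set (SIdx n) => S ⊆ b ∧ S.ncard = j ∧ NoAlt P S b with hF
  have h3 : F.card = b.ncard := by
    have := hcyc.ncard_noAltQ hj0 hj
    rw [← this, ← Set.ncard_coe_finset]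
    congr 1
    ext S
    simp only [hF, Finset.coe_filter, Finset.mem_univ, true_and, Set.mem_ofPred_eq]
    exact and_congr_right fun h4 => and_congr_right fun _ =>
      noAlt_iff hn hP h4 hmono hsurj hper hcyc.mem
  have h4 : (F.filter fun S => IsInit sv S b ∨ IsInit (fun x => -sv x) S b).card = 2 := by
    rw [← ncard_isInit b hj0 hj, ← Set.ncard_coe_finset]
    congr 1
    ext S
    simp only [hF, Finset.coe_filter, Finset.mem_filter, Finset.mem_univ, true_and,
      Set.mem_ofPred_eq]
    constructor
    · rintro ⟨⟨h4, h5, -⟩, h6⟩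
      exact ⟨h4, h5, h6⟩
    · rintro ⟨h4, h5, h6⟩
      exact ⟨⟨h4, h5, noAlt_of_isInit hP h6⟩, h6⟩
  have h5 := Finset.card_filter_add_card_filter_not (s := F)
    fun S => IsInit sv S b ∨ IsInit (fun x => -sv x) S b
  rw [h4, h3] at h5
  have h6 : ((F.filter fun S => ¬ (IsInit sv S b ∨ IsInit (fun x => -sv x) S b)).card : ℤ[X]) =
      (b.ncard : ℤ[X]) - 2 := by
    rw [← h5]
    push_cast
    ring
  rw [h4, nsmul_eq_mul, nsmul_eq_mul, h6]
  push_cast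
  ring

end
end TypeB

namespace TypeB
noncomputable section

variable {n : ℕ}

/-! ### Chains of set partitions as chains of splittings -/

/-- A drop of one dimension means that π is cut out of π' by the single equation of a with c. A
vector of π' can be corrected by a multiple of the indicator vector of the π'-class of a so as to
land in π; if x and y are not separated by that class, the correction changes their coordinates
equally, so an equation between x and y on π already holds on π'. -/
theorem rel_eq_split {π' π : Submodule ℝ (V n)} (hπ' : π' ∈ setPartitions n)
    (hle : π ≤ π') (hrank : Module.finrank ℝ π' = Module.finrank ℝ π + 1)
    {a c : SIdx n} (hac : rel π a c) (hac' : ¬ rel π' a c) (hz : ¬ rel π' a (negIdx a)) :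
    IsPiece (rel π) {x | rel π a x} {x | rel π' a x} ∧ rel π' = split (rel π) {x | rel π' a x} := by
  classical
  have hr := isBPart_rel π
  have hr' := isBPart_rel π'
  have hneg : ∀ x, rel π' a x → ¬ rel π' a (negIdx x) := by
    intro x hx hx'
    have h1 := hr'.neg _ _ hx
    exact hz (hr'.equiv.trans hx' (hr'.equiv.symm h1))
  refine ⟨⟨⟨a, rfl⟩, fun x hx => rel_mono hle hx, ⟨a, hr'.equiv.refl a⟩, ?_, hneg⟩, ?_⟩
  · intro h
    have : c ∈ {x | rel π' a x} := h ▸ hac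
    exact hac' this
  have hinf : π' ⊓ (ℝ ∙ (E a - E c))ᗮ = π := by
    have h1 : π ≤ π' ⊓ (ℝ ∙ (E a - E c))ᗮ := by
      intro x hx
      refine ⟨hle hx, ?_⟩
      rw [SetLike.mem_coe, Submodule.mem_orthogonal_singleton_iff_inner_right, inner_sub_left, ← coord_eq_inner,
        ← coord_eq_inner, hac x hx, sub_self]
    have h2 : π' ⊓ (ℝ ∙ (E a - E c))ᗮ < π' := by
      refine lt_of_le_of_ne inf_le_left fun h => hac' fun x hx => ?_
      rw [← h] at hx
      have := Submodule.mem_orthogonal_singleton_iff_inner_right.1 hx.2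
      rwa [inner_sub_left, ← coord_eq_inner, ← coord_eq_inner, sub_eq_zero] at this
    have h3 := Submodule.finrank_lt_finrank_of_lt h2
    exact (Submodule.eq_of_le_of_finrank_le h1 (by omega)).symm
  have hs : indVec {x | rel π' a x} ∈ π' := by
    refine indVec_mem hπ' fun x y hxy => ?_
    exact ⟨fun h => hr'.equiv.trans h hxy, fun h => hr'.equiv.trans h (hr'.equiv.symm hxy)⟩
  have ha1 : coord a (indVec {x | rel π' a x}) = 1 := by
    rw [coord_indVec, if_pos (show a ∈ {x | rel π' a x} from hr'.equiv.refl a),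
      if_neg (show negIdx a ∉ {x | rel π' a x} from hz), sub_zero]
  have hc1 : coord c (indVec {x | rel π' a x}) ≤ 0 := by
    rw [coord_indVec, if_neg (show c ∉ {x | rel π' a x} from hac')]
    split_ifs <;> norm_num
  funext x y
  apply propext
  constructor
  · intro hxy
    refine ⟨rel_mono hle hxy, ?_, ?_⟩
    · exact ⟨fun h => hr'.equiv.trans h hxy, fun h => hr'.equiv.trans h (hr'.equiv.symm hxy)⟩
    · have hxy' := hr'.neg _ _ hxy
      exact ⟨fun h => hr'.equiv.trans h hxy', fun h => hr'.equiv.trans h (hr'.equiv.symm hxy')⟩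
  · rintro ⟨h1, h2, h3⟩ z hz'
    have h4 := coord_indVec_congr h2 h3
    generalize indVec {x | rel π' a x} = s at *
    -- The indicator s is 1 at a and at most 0 at c, so its two coordinates differ and t can be
    -- solved for.
    obtain ⟨t, ht⟩ : ∃ t : ℝ, coord a z - coord c z = t * (1 - coord c s) :=
      ⟨(coord a z - coord c z) / (1 - coord c s), by
        rw [div_mul_cancel₀]
        linarith⟩
    have h5 : z - t • s ∈ π := by
      rw [← hinf]
      refine ⟨π'.sub_mem hz' (π'.smul_mem t hs), ?_⟩
      rw [SetLike.mem_coe, Submodule.mem_orthogonal_singleton_iff_inner_right, inner_sub_left, ← coord_eq_inner,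
        ← coord_eq_inner, coord_sub, coord_sub, coord_smul, coord_smul, ha1]
      linarith
    have h6 := h1 _ h5
    rw [coord_sub, coord_sub, coord_smul, coord_smul, h4] at h6
    linarith

/-- The piece must be disjoint from its opposite. A broken class that is not a zero class falls into
two classes, either of which would do; taking the larger makes the choice canonical enough for the
stabilizer computation. -/
theorem exists_split {π' π : Submodule ℝ (V n)} (hπ' : π' ∈ setPartitions n)
    (hπ : π ∈ setPartitions n) (hle : π ≤ π')
    (hrank : Module.finrank ℝ π' = Module.finrank ℝ π + 1) :
    ∃ b S, IsPiece (rel π) b S ∧ (∃ a, S = {x | rel π' a x}) ∧ rel π' = split (rel π) S ∧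
      ((∀ x ∈ b, negIdx x ∉ b) → b.ncard ≤ 2 * S.ncard) := by
  have hr := isBPart_rel π
  have hr' := isBPart_rel π'
  obtain ⟨a, c, hac, hac'⟩ : ∃ a c, rel π a c ∧ ¬ rel π' a c := by
    by_contra hcon
    push Not at hcon
    have : π' ≤ π := fun x hx => (mem_setPartition hπ).2 fun a b hab => hcon a b hab x hx
    have := Submodule.finrank_mono this
    omega
  -- The classes of a and c cannot both be zero classes of π', since there is at most one.
  wlog hz : ¬ rel π' a (negIdx a) generalizing a c
  · refine this c a (hr.equiv.symm hac) (fun h => hac' (hr'.equiv.symm h)) fun hc => ?_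
    exact hac' (hr'.zero _ _ (not_not.1 hz) hc)
  obtain ⟨h1, h2⟩ := rel_eq_split hπ' hle hrank hac hac' hz
  by_cases hb : rel π a (negIdx a)
  · refine ⟨_, _, h1, ⟨a, rfl⟩, h2, fun h => ?_⟩
    exact (h a (hr.equiv.refl a) hb).elim
  · have hzc : ¬ rel π' c (negIdx c) := fun h =>
      hb (hr.equiv.trans (hr.equiv.trans hac (rel_mono hle h)) (hr.neg _ _ (hr.equiv.symm hac)))
    obtain ⟨h3, h4⟩ := rel_eq_split hπ' hle hrank (hr.equiv.symm hac)
      (fun h => hac' (hr'.equiv.symm h)) hzc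
    have hclass : {x | rel π c x} = {x | rel π a x} := by
      ext x
      exact ⟨fun h => hr.equiv.trans hac h, fun h => hr.equiv.trans (hr.equiv.symm hac) h⟩
    have hcover : {x | rel π a x} ⊆ {x | rel π' a x} ∪ {x | rel π' c x} := by
      intro x hx
      by_cases hxa : rel π' a x
      · exact Or.inl hxa
      · right
        have hnz : ∀ y, rel π a y → ¬ rel π' a (negIdx y) := fun y hy h =>
          hb (hr.equiv.trans (rel_mono hle h) (hr.neg _ _ (hr.equiv.symm hy)))
        change rel π' c x
        rw [h2]
        refine ⟨hr.equiv.trans (hr.equiv.symm hac) hx, ?_, ?_⟩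
        · exact ⟨fun h => (hac' h).elim, fun h => (hxa h).elim⟩
        · exact ⟨fun h => (hnz _ hac h).elim, fun h => (hnz _ hx h).elim⟩
    have hcard := (Set.ncard_le_ncard hcover).trans (Set.ncard_union_le _ _)
    rcases le_total ({x | rel π' c x}.ncard) ({x | rel π' a x}.ncard) with h5 | h5
    · exact ⟨_, _, h1, ⟨a, rfl⟩, h2, fun _ => by omega⟩
    · exact ⟨_, _, h3, ⟨c, rfl⟩, h4, fun _ => by rw [hclass]; omega⟩

/-- A maximal chain of set partitions, given by the class `b k` of `r (k + 1)` that is broken in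
`r k` and a class `S k` of `r k` contained in it. -/
structure IsSplitChain (r : ℕ → SIdx n → SIdx n → Prop) (b S : ℕ → Set (SIdx n)) : Prop where
  part : ∀ k, IsBPart (r k)
  bot : ∀ x y, r 0 x y → x = y
  top : ∀ x y, r n x y
  piece : ∀ k < n, IsPiece (r (k + 1)) (b k) (S k)
  cls : ∀ k < n, ∃ a, S k = {x | r k a x}
  eq : ∀ k < n, r k = split (r (k + 1)) (S k)
  large : ∀ k < n, (∀ x ∈ b k, negIdx x ∉ b k) → (b k).ncard ≤ 2 * (S k).ncard

section Chain

variable {p : Fin (n + 1) → Submodule ℝ (V n)} (hp : IsMaximalChain (setPartitions n) p)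
include hp

/-- A strictly decreasing chain of n + 1 subspaces in dimension n cannot skip a dimension. -/
theorem finrank_of_isMaximalChain (i : Fin (n + 1)) : Module.finrank ℝ (p i) = n - i := by
  have hanti : StrictAnti p := Fin.strictAnti_iff_succ_lt.2 fun i => (hp.2.2.2 i).1
  have hup : ∀ k (hk : k < n + 1), Module.finrank ℝ (p ⟨k, hk⟩) + k ≤ n := by
    intro k
    induction k with
    | zero =>
      intro hk
      have := Submodule.finrank_le (p ⟨0, hk⟩)
      rw [finrank_euclideanSpace_fin] at this
      omega
    | succ k ih =>
      intro hk
      have h1 := ih (by omega)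
      have h2 := Submodule.finrank_lt_finrank_of_lt
        (hanti (show (⟨k, by omega⟩ : Fin (n + 1)) < ⟨k + 1, hk⟩ by simp))
      omega
  have hlow : ∀ d (hd : d ≤ n), d ≤ Module.finrank ℝ (p ⟨n - d, by omega⟩) := by
    intro d
    induction d with
    | zero => intro _; omega
    | succ d ih =>
      intro hd
      have h1 := ih (by omega)
      have h2 := Submodule.finrank_lt_finrank_of_lt
        (hanti (show (⟨n - (d + 1), by omega⟩ : Fin (n + 1)) < ⟨n - d, by omega⟩ by
          rw [Fin.mk_lt_mk]; omega))
      omega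
  obtain ⟨k, hk⟩ := i
  have h1 := hup k hk
  have h2 := hlow (n - k) (by omega)
  have h3 : n - (n - k) = k := by omega
  have h4 : (⟨n - (n - k), by omega⟩ : Fin (n + 1)) = ⟨k, hk⟩ := Fin.ext h3
  rw [h4] at h2
  change _ = n - k
  omega

theorem exists_splitChain : ∃ (r : ℕ → SIdx n → SIdx n → Prop) (b S : ℕ → Set (SIdx n)),
    IsSplitChain r b S ∧ ∀ k (hk : k < n + 1), r k = rel (p ⟨k, hk⟩) := by
  have hex : ∀ k, ∃ b S : Set (SIdx n), ∀ hk : k < n,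
      IsPiece (rel (p ⟨k + 1, by omega⟩)) b S ∧ (∃ a, S = {x | rel (p ⟨k, by omega⟩) a x}) ∧
        rel (p ⟨k, by omega⟩) = split (rel (p ⟨k + 1, by omega⟩)) S ∧
        ((∀ x ∈ b, negIdx x ∉ b) → b.ncard ≤ 2 * S.ncard) := by
    intro k
    by_cases hk : k < n
    · have h1 := finrank_of_isMaximalChain hp ⟨k, by omega⟩
      have h2 := finrank_of_isMaximalChain hp ⟨k + 1, by omega⟩
      simp only at h1 h2
      obtain ⟨b, S, h⟩ := exists_split (hp.2.2.1 ⟨k, by omega⟩) (hp.2.2.1 ⟨k + 1, by omega⟩)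
        (hp.2.2.2 ⟨k, hk⟩).1.le (by omega)
      exact ⟨b, S, fun _ => h⟩
    · exact ⟨∅, ∅, fun h => (hk h).elim⟩
  choose b S hbS using hex
  have hr : ∀ k (hk : k < n + 1), rel (p ⟨min k n, by omega⟩) = rel (p ⟨k, hk⟩) := by
    intro k hk
    congr 2
    rw [Fin.mk.injEq]
    omega
  -- The chain is continued by its last term beyond n, so that every natural number is a legitimate
  -- index.
  refine ⟨fun k => rel (p ⟨min k n, by omega⟩), b, S, ⟨fun k => isBPart_rel _, ?_, ?_, ?_, ?_, ?_,
    ?_⟩, hr⟩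
  · intro x y hxy
    rw [hr 0 (by omega)] at hxy
    have h0 : p ⟨0, by omega⟩ = ⊤ := hp.1
    rw [h0] at hxy
    by_contra hne
    have := hxy (E x) Submodule.mem_top
    rw [coord_E_self, coord_E, if_neg (Ne.symm hne)] at this
    split_ifs at this <;> norm_num at this
  · intro x y
    rw [hr n (by omega)]
    have h0 : p ⟨n, by omega⟩ = ⊥ := hp.2.1
    rw [h0]
    intro z hz
    rw [(Submodule.mem_bot ℝ).1 hz]
    simp
  · intro k hk
    rw [hr (k + 1) (by omega)]
    exact (hbS k hk).1
  · intro k hk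
    rw [hr k (by omega)]
    exact (hbS k hk).2.1
  · intro k hk
    rw [hr k (by omega), hr (k + 1) (by omega)]
    exact (hbS k hk).2.2.1
  · intro k hk
    exact (hbS k hk).2.2.2

end Chain

/-! ### Translates by signed permutations -/

/-- The translate of a relation. -/
def smulRel (g : G n) (r : SIdx n → SIdx n → Prop) (x y : SIdx n) : Prop :=
  r (g.1⁻¹ x) (g.1⁻¹ y)

/-- The translate of a set. -/
def smulSet (g : G n) (S : Set (SIdx n)) : Set (SIdx n) := g.1 '' S

theorem mem_smulSet {g : G n} {S : Set (SIdx n)} {x : SIdx n} :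
    x ∈ smulSet g S ↔ g.1⁻¹ x ∈ S := by
  constructor
  · rintro ⟨y, hy, rfl⟩
    simpa using hy
  · exact fun h => ⟨_, h, by simp⟩

theorem smulSet_mul (g h : G n) (S : Set (SIdx n)) :
    smulSet (g * h) S = smulSet g (smulSet h S) := by
  ext x
  simp [mem_smulSet]

theorem smulSet_one (S : Set (SIdx n)) : smulSet (1 : G n) S = S := by
  ext x
  simp [mem_smulSet]

theorem ncard_smulSet (g : G n) (S : Set (SIdx n)) : (smulSet g S).ncard = S.ncard :=
  Set.ncard_image_of_injective S g.1.injective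

theorem smulSet_mono (g : G n) {S T : Set (SIdx n)} (h : S ⊆ T) : smulSet g S ⊆ smulSet g T :=
  Set.image_mono h

theorem smulSet_injective (g : G n) : Function.Injective (smulSet g) :=
  Set.image_injective.2 g.1.injective

theorem smulSet_negBlock (g : G n) (S : Set (SIdx n)) :
    smulSet g (negBlock S) = negBlock (smulSet g S) := by
  ext x
  rw [mem_smulSet, mem_negBlock, mem_negBlock, mem_smulSet, G.inv_apply_negIdx]

theorem isBPart_smulRel (g : G n) {r : SIdx n → SIdx n → Prop} (hr : IsBPart r) :
    IsBPart (smulRel g r) where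
  equiv := ⟨fun _ => hr.equiv.refl _, fun h => hr.equiv.symm h, fun h h' => hr.equiv.trans h h'⟩
  neg a b h := by
    simp only [smulRel, G.inv_apply_negIdx]
    exact hr.neg _ _ h
  zero a b ha hb := by
    simp only [smulRel, G.inv_apply_negIdx] at ha hb ⊢
    exact hr.zero _ _ ha hb

theorem smulRel_split (g : G n) (r : SIdx n → SIdx n → Prop) (S : Set (SIdx n)) :
    smulRel g (split r S) = split (smulRel g r) (smulSet g S) := by
  funext x y
  simp only [smulRel, split, mem_smulSet, G.inv_apply_negIdx]

theorem rel_map_act (π : Submodule ℝ (V n)) (g : G n) :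
    rel (π.map ((act g).toLinearEquiv : V n →ₗ[ℝ] V n)) = smulRel g (rel π) := by
  funext x y
  apply propext
  constructor
  · intro h z hz
    have := h (act g z) ⟨z, hz, rfl⟩
    rwa [coord_act, coord_act] at this
  · rintro h _ ⟨z, hz, rfl⟩
    change coord x (act g z) = coord y (act g z)
    rw [coord_act, coord_act]
    exact h z hz

/-- The signed permutations preserving each class. -/
def classStab {r : SIdx n → SIdx n → Prop} (hr : IsBPart r) : Subgroup (G n) where
  carrier := {h | ∀ a, r a (h.1 a)}
  one_mem' := fun a => hr.equiv.refl a
  mul_mem' := fun {g h} hg hh a => hr.equiv.trans (hh a) (hg (h.1 a))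
  inv_mem' := fun {g} hg a => by
    have := hg (g.1⁻¹ a)
    rw [show g.1 (g.1⁻¹ a) = a by simp] at this
    exact hr.equiv.symm this

theorem mem_classStab {r : SIdx n → SIdx n → Prop} {hr : IsBPart r} {h : G n} :
    h ∈ classStab hr ↔ ∀ a, r a (h.1 a) := Iff.rfl

theorem smulSet_of_mem_classStab {r r' : SIdx n → SIdx n → Prop} (hr : IsBPart r)
    (hr' : IsBPart r') (hsub : ∀ x y, r x y → r' x y) {h : G n} (hh : h ∈ classStab hr)
    (a : SIdx n) : smulSet h {x | r' a x} = {x | r' a x} := by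
  ext x
  rw [mem_smulSet]
  have h1 := hsub _ _ ((classStab hr).inv_mem hh x)
  exact ⟨fun h2 => hr'.equiv.trans h2 (hr'.equiv.symm h1), fun h2 => hr'.equiv.trans h2 h1⟩

theorem smulRel_of_mem_classStab {r r' : SIdx n → SIdx n → Prop} (hr : IsBPart r)
    (hr' : IsBPart r') (hsub : ∀ x y, r x y → r' x y) {h : G n} (hh : h ∈ classStab hr) (g : G n) :
    smulRel (g * h) r' = smulRel g r' := by
  funext x y
  have h1 (z : SIdx n) : r' z (h.1⁻¹ z) := hsub _ _ ((classStab hr).inv_mem hh z)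
  apply propext
  simp only [smulRel, Subgroup.coe_mul, mul_inv_rev, Equiv.Perm.mul_apply]
  have h2 := h1 (g.1⁻¹ x)
  have h3 := h1 (g.1⁻¹ y)
  exact ⟨fun h => hr'.equiv.trans h2 (hr'.equiv.trans h (hr'.equiv.symm h3)),
    fun h => hr'.equiv.trans (hr'.equiv.symm h2) (hr'.equiv.trans h h3)⟩

/-- The stabilizer of the classes acts transitively on pieces of a given size: exchange an element y
of T outside S with an element x of S outside T, and induct on |T \ S|. -/
theorem exists_smulSet_eq {r : SIdx n → SIdx n → Prop} (hr : IsBPart r) {b S : Set (SIdx n)}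
    (h : IsPiece r b S) {T : Set (SIdx n)} (hT : T ⊆ b) (hcard : T.ncard = S.ncard)
    (hneg : ∀ x ∈ T, negIdx x ∉ T) : ∃ g ∈ classStab hr, smulSet g S = T := by
  induction hd : (T \ S).ncard using Nat.strong_induction_on generalizing S with
  | _ d ih =>
    by_cases hTS : T ⊆ S
    · exact ⟨1, (classStab hr).one_mem, by
        rw [smulSet_one, Set.eq_of_subset_of_ncard_le hTS hcard.ge]⟩
    rw [Set.not_subset] at hTS
    obtain ⟨y, hyT, hyS⟩ := hTS
    have hST : ¬ S ⊆ T := fun h' => hyS (Set.eq_of_subset_of_ncard_le h' hcard.le ▸ hyT)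
    -- If -y is in S it must be the element exchanged; otherwise the new piece would contain both y
    -- and -y.
    obtain ⟨x, hxS, hxT, hxy⟩ : ∃ x ∈ S, x ∉ T ∧ (x = negIdx y ∨ negIdx y ∉ S) := by
      by_cases h1 : negIdx y ∈ S
      · exact ⟨negIdx y, h1, hneg y hyT, Or.inl rfl⟩
      · obtain ⟨x, hx, hxT⟩ := Set.not_subset.1 hST
        exact ⟨x, hx, hxT, Or.inr h1⟩
    have hrxy : r x y := h.rel_of_mem hr (h.subset hxS) (hT hyT)
    have hsw : sw x y ∈ classStab hr := by
      rw [mem_classStab]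
      intro c
      by_cases h1 : c = x
      · rw [h1, sw_apply_left]; exact hrxy
      by_cases h2 : c = y
      · rw [h2, sw_apply_right]; exact hr.equiv.symm hrxy
      by_cases h3 : c = negIdx x
      · rw [h3, G.apply_negIdx, sw_apply_left]; exact hr.neg _ _ hrxy
      by_cases h4 : c = negIdx y
      · rw [h4, G.apply_negIdx, sw_apply_right]; exact hr.neg _ _ (hr.equiv.symm hrxy)
      rw [sw_apply_of_ne h1 h2 h3 h4]
      exact hr.equiv.refl c
    have himg : smulSet (sw x y) S = insert y (S \ {x}) := by
      have hx' := h.neg x hxS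
      ext c
      rw [mem_smulSet, ← Subgroup.coe_inv, sw_inv]
      simp only [Set.mem_insert_iff, Set.mem_sdiff, Set.mem_singleton_iff]
      by_cases h1 : c = x
      · subst h1
        rw [sw_apply_left]
        have : c ≠ y := fun h => hxT (h ▸ hyT)
        simp [hyS, this]
      by_cases h2 : c = y
      · rw [h2, sw_apply_right]
        simp [hxS]
      by_cases h3 : c = negIdx x
      · subst h3
        rw [G.apply_negIdx, sw_apply_left]
        have : negIdx y ∉ S := by
          rcases hxy with h4 | h4
          · rw [h4, negIdx_negIdx] at h2
            exact (h2 rfl).elim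
          · exact h4
        simp [this, hx', h2]
      by_cases h4 : c = negIdx y
      · subst h4
        rw [G.apply_negIdx, sw_apply_right]
        have : negIdx y ∉ S := by
          rcases hxy with h5 | h5
          · exact (h1 h5.symm).elim
          · exact h5
        simp [this, hx', h2]
      rw [sw_apply_of_ne h1 h2 h3 h4]
      simp [h1, h2]
    have hncard := ncard_smulSet (sw x y) S
    rw [himg] at hncard
    have hlt : (T \ insert y (S \ {x})).ncard < d := by
      rw [← hd]
      refine Set.ncard_lt_ncard ⟨?_, ?_⟩ (Set.toFinite _)
      · rintro z ⟨hz, hz'⟩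
        simp only [Set.mem_insert_iff, Set.mem_sdiff, Set.mem_singleton_iff, not_or, not_and,
          not_not] at hz'
        refine ⟨hz, fun hzS => ?_⟩
        rw [hz'.2 hzS] at hz
        exact hxT hz
      · intro h'
        have := h' ⟨hyT, hyS⟩
        exact this.2 (Set.mem_insert _ _)
    have hpiece : IsPiece r b (insert y (S \ {x})) := by
      refine ⟨h.isClass, Set.insert_subset (hT hyT) (Set.sdiff_subset.trans h.subset),
        Set.insert_nonempty _ _, ?_, ?_⟩
      · intro heq
        rw [heq] at hncard
        exact h.ne (Set.eq_of_subset_of_ncard_le h.subset hncard.le)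
      · rw [← himg]
        intro z hz
        rw [mem_smulSet] at hz ⊢
        rw [G.inv_apply_negIdx]
        exact h.neg _ hz
    obtain ⟨g, hg, hgT⟩ := ih _ hlt hpiece (by omega) rfl
    refine ⟨g * sw x y, (classStab hr).mul_mem hg hsw, ?_⟩
    rw [smulSet_mul, himg, hgT]

/-! ### Averaging -/

/-- Averaging over right translation by H k leaves the factors j > k unchanged and replaces the k-th
one by a constant, so the factors are removed one at a time. The constant is only required where the
later factors do not vanish, because the local counts depend on the coarser steps being good. -/
theorem card_mul_sum_prod {Γ R : Type*} [Group Γ] [Fintype Γ] [CommRing R] (H : ℕ → Subgroup Γ)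
    [∀ k, Fintype (H k)] (w : ℕ → Γ → R) (C : ℕ → R) (N : ℕ)
    (hinv : ∀ k j, k < j → j < N → ∀ g, ∀ h ∈ H k, w j (g * h) = w j g)
    (hsum : ∀ k < N, ∀ g, (∏ j ∈ Finset.Ico (k + 1) N, w j g) ≠ 0 →
      ∑ h : H k, w k (g * h) = C k) :
    (∏ k ∈ Finset.range N, (Fintype.card (H k) : R)) * ∑ g, ∏ k ∈ Finset.range N, w k g =
      (Fintype.card Γ : R) * ∏ k ∈ Finset.range N, C k := by
  have main : ∀ d ≤ N, (∏ k ∈ Finset.Ico (N - d) N, (Fintype.card (H k) : R)) *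
      ∑ g, ∏ k ∈ Finset.Ico (N - d) N, w k g =
      (Fintype.card Γ : R) * ∏ k ∈ Finset.Ico (N - d) N, C k := by
    intro d
    induction d with
    | zero => simp
    | succ d ih =>
      intro hd
      obtain ⟨k, hk⟩ : ∃ k, k = N - (d + 1) := ⟨_, rfl⟩
      have hk1 : N - d = k + 1 := by omega
      have ih := ih (by omega)
      rw [hk1] at ih
      have e1 : ∀ g, ∏ j ∈ Finset.Ico k N, w j g = w k g * ∏ j ∈ Finset.Ico (k + 1) N, w j g :=
        fun g => Finset.prod_eq_prod_Ico_succ_bot (by omega) _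
      rw [← hk, Finset.prod_eq_prod_Ico_succ_bot (show k < N by omega) fun j => (Fintype.card (H j) : R),
        Finset.prod_eq_prod_Ico_succ_bot (show k < N by omega) C]
      simp only [e1]
      have e2 : (Fintype.card (H k) : R) * ∑ g, w k g * ∏ j ∈ Finset.Ico (k + 1) N, w j g =
          C k * ∑ g, ∏ j ∈ Finset.Ico (k + 1) N, w j g := by
        have e3 : ∀ h : H k, ∑ g, w k g * ∏ j ∈ Finset.Ico (k + 1) N, w j g =
            ∑ g, w k (g * h) * ∏ j ∈ Finset.Ico (k + 1) N, w j g := by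
          intro h
          refine (Equiv.sum_comp (Equiv.mulRight (h : Γ)) _).symm.trans ?_
          refine Finset.sum_congr rfl fun g _ => ?_
          congr 1
          refine Finset.prod_congr rfl fun j hj => ?_
          rw [Finset.mem_Ico] at hj
          exact hinv k j (by omega) hj.2 g h h.2
        rw [← nsmul_eq_mul, ← Finset.card_univ, ← Finset.sum_const, Finset.sum_congr rfl fun h _ => e3 h, Finset.sum_comm, Finset.mul_sum]
        refine Finset.sum_congr rfl fun g _ => ?_
        rw [← Finset.sum_mul]
        by_cases h0 : ∏ j ∈ Finset.Ico (k + 1) N, w j g = 0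
        · rw [h0, mul_zero, mul_zero]
        · rw [hsum k (by omega) g h0]
      calc _ = (∏ j ∈ Finset.Ico (k + 1) N, (Fintype.card (H j) : R)) *
            ((Fintype.card (H k) : R) * ∑ g, w k g * ∏ j ∈ Finset.Ico (k + 1) N, w j g) := by ring
        _ = _ := by
          rw [e2, mul_left_comm, ih]
          ring
  have := main N le_rfl
  rwa [Nat.sub_self, ← Finset.range_eq_Ico] at this

end
end TypeB

namespace TypeB
noncomputable section

variable {n : ℕ}

/-! ### Classes of a split partition -/

/-- `c` is a class of `r`. -/
def IsCl (r : SIdx n → SIdx n → Prop) (c : Set (SIdx n)) : Prop := ∃ a, c = {x | r a x}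

theorem IsCl.rel {r : SIdx n → SIdx n → Prop} (hr : IsBPart r) {c : Set (SIdx n)} (h : IsCl r c)
    {x y : SIdx n} (hx : x ∈ c) (hy : y ∈ c) : r x y := by
  obtain ⟨a, rfl⟩ := h
  exact hr.equiv.trans (hr.equiv.symm hx) hy

theorem IsCl.eq_of_mem {r : SIdx n → SIdx n → Prop} (hr : IsBPart r) {c : Set (SIdx n)}
    (h : IsCl r c) {x : SIdx n} (hx : x ∈ c) : c = {y | r x y} := by
  obtain ⟨a, rfl⟩ := h
  ext y
  exact ⟨fun h => hr.equiv.trans (hr.equiv.symm hx) h, fun h => hr.equiv.trans hx h⟩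

theorem IsCl.nonempty {r : SIdx n → SIdx n → Prop} (hr : IsBPart r) {c : Set (SIdx n)}
    (h : IsCl r c) : c.Nonempty := by
  obtain ⟨a, rfl⟩ := h
  exact ⟨a, hr.equiv.refl a⟩

theorem IsCl.eq_of_inter {r : SIdx n → SIdx n → Prop} (hr : IsBPart r) {c c' : Set (SIdx n)}
    (h : IsCl r c) (h' : IsCl r c') {x : SIdx n} (hx : x ∈ c) (hx' : x ∈ c') : c = c' := by
  rw [h.eq_of_mem hr hx, h'.eq_of_mem hr hx']

theorem IsCl.negBlock {r : SIdx n → SIdx n → Prop} (hr : IsBPart r) {c : Set (SIdx n)}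
    (h : IsCl r c) : IsCl r (negBlock c) := by
  obtain ⟨a, rfl⟩ := h
  refine ⟨negIdx a, ?_⟩
  ext x
  rw [mem_negBlock, Set.mem_ofPred_eq, Set.mem_ofPred_eq, ← hr.neg_iff, negIdx_negIdx]

theorem IsCl.smulSet {r : SIdx n → SIdx n → Prop} {c : Set (SIdx n)} (h : IsCl r c) (g : G n) :
    IsCl (smulRel g r) (smulSet g c) := by
  obtain ⟨a, rfl⟩ := h
  refine ⟨g.1 a, ?_⟩
  ext x
  rw [mem_smulSet]
  simp [smulRel]

theorem negBlock_injective : Function.Injective (negBlock : Set (SIdx n) → Set (SIdx n)) :=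
  fun S T h => by rw [← negBlock_negBlock S, h, negBlock_negBlock]

theorem ncard_negBlock (S : Set (SIdx n)) : (negBlock S).ncard = S.ncard :=
  Set.ncard_image_of_injective S fun _ _ h => negIdx_inj.1 h

theorem IsPiece.smulSet {r : SIdx n → SIdx n → Prop} {b S : Set (SIdx n)} (h : IsPiece r b S)
    (g : G n) : IsPiece (smulRel g r) (smulSet g b) (smulSet g S) where
  isClass := IsCl.smulSet h.isClass g
  subset := smulSet_mono g h.subset
  nonempty := h.nonempty.image _
  ne := fun h' => h.ne (smulSet_injective g h')
  neg := fun x hx hx' => by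
    rw [mem_smulSet] at hx hx'
    rw [G.inv_apply_negIdx] at hx'
    exact h.neg _ hx hx'

theorem IsPiece.ncard_lt {r : SIdx n → SIdx n → Prop} {b S : Set (SIdx n)} (h : IsPiece r b S) :
    S.ncard < b.ncard :=
  Set.ncard_lt_ncard (h.subset.ssubset_of_ne h.ne) (Set.toFinite _)

theorem IsPiece.ncard_pos {r : SIdx n → SIdx n → Prop} {b S : Set (SIdx n)} (h : IsPiece r b S) :
    0 < S.ncard := (Set.ncard_pos (Set.toFinite _)).2 h.nonempty

theorem negBlock_eq_of_mem {r : SIdx n → SIdx n → Prop} (hr : IsBPart r) {b : Set (SIdx n)}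
    (hb : IsCl r b) {x : SIdx n} (hx : x ∈ b) (hx' : negIdx x ∈ b) : negBlock b = b :=
  (hb.negBlock hr).eq_of_inter hr hb (x := negIdx x) (by rwa [mem_negBlock, negIdx_negIdx]) hx'

theorem IsPiece.two_mul_ncard_le {r : SIdx n → SIdx n → Prop} {b S : Set (SIdx n)}
    (h : IsPiece r b S) (hz : negBlock b = b) : 2 * S.ncard ≤ b.ncard := by
  have h1 : S ∪ negBlock S ⊆ b := by
    apply Set.union_subset h.subset
    rw [← hz]
    exact Set.image_mono h.subset
  have h2 : Disjoint S (negBlock S) := Set.disjoint_left.2 fun x hx hx' => h.neg x hx (mem_negBlock.1 hx')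
  have h3 := Set.ncard_le_ncard h1 (Set.toFinite _)
  rw [Set.ncard_union_eq h2 (Set.toFinite _) (Set.toFinite _), ncard_negBlock] at h3
  omega

/-- The part of `b` outside `S` and its opposite. -/
def restOf (b S : Set (SIdx n)) : Set (SIdx n) := b \ (S ∪ negBlock S)

theorem negBlock_restOf (b S : Set (SIdx n)) :
    negBlock (restOf b S) = restOf (negBlock b) S := by
  ext x
  simp only [restOf, mem_negBlock, Set.mem_sdiff, Set.mem_union, negIdx_negIdx]
  tauto

theorem isCl_split_of_ne {r : SIdx n → SIdx n → Prop} (hr : IsBPart r) {b S c : Set (SIdx n)}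
    (h : IsPiece r b S) (hc : IsCl r c) (h1 : c ≠ b) (h2 : c ≠ negBlock b) :
    IsCl (split r S) c := by
  have hout : ∀ x ∈ c, x ∉ S ∧ negIdx x ∉ S := by
    intro x hx
    refine ⟨fun hS => h1 (hc.eq_of_inter hr h.isClass hx (h.subset hS)), fun hS => h2 ?_⟩
    exact hc.eq_of_inter hr (IsCl.negBlock hr h.isClass) hx (mem_negBlock.2 (h.subset hS))
  obtain ⟨a, rfl⟩ := hc
  refine ⟨a, ?_⟩
  ext x
  refine ⟨fun hx => ?_, fun hx => hx.1⟩
  have ha := hout a (hr.equiv.refl a)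
  have hx' := hout x hx
  exact ⟨hx, by simp [ha, hx'], by simp [ha, hx']⟩

theorem isCl_split_cases {r : SIdx n → SIdx n → Prop} (hr : IsBPart r) {b S c : Set (SIdx n)}
    (h : IsPiece r b S) (hc : IsCl (split r S) c) :
    (IsCl r c ∧ c ≠ b ∧ c ≠ negBlock b) ∨ c = S ∨ c = negBlock S ∨ c = restOf b S ∨
      c = negBlock (restOf b S) := by
  obtain ⟨a, rfl⟩ := hc
  by_cases h1 : a ∈ S
  · right; left
    ext x
    refine ⟨fun hx => hx.2.1.1 h1, fun hx => ⟨h.rel_of_mem hr (h.subset h1) (h.subset hx), ?_, ?_⟩⟩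
    · simp [h1, hx]
    · simp [h.neg a h1, h.neg x hx]
  by_cases h2 : negIdx a ∈ S
  · right; right; left
    ext x
    rw [mem_negBlock]
    refine ⟨fun hx => hx.2.2.1 h2, fun hx => ⟨?_, ?_, ?_⟩⟩
    · exact hr.neg_iff.1 (h.rel_of_mem hr (h.subset h2) (h.subset hx))
    · have := h.neg _ hx
      rw [negIdx_negIdx] at this
      simp [h1, this]
    · simp [h2, hx]
  have key : ∀ {b' : Set (SIdx n)}, IsCl r b' → a ∈ b' → {x | split r S a x} = restOf b' S := by
    intro b' hb' ha
    ext x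
    rw [Set.mem_ofPred_eq, hb'.eq_of_mem hr ha, restOf, Set.mem_sdiff, Set.mem_union, mem_negBlock,
      split, Set.mem_ofPred_eq]
    simp only [h1, h2]
    tauto
  by_cases h3 : a ∈ b
  · exact Or.inr (Or.inr (Or.inr (Or.inl (key h.isClass h3))))
  by_cases h4 : a ∈ negBlock b
  · refine Or.inr (Or.inr (Or.inr (Or.inr ?_)))
    rw [key (IsCl.negBlock hr h.isClass) h4, negBlock_restOf]
  left
  have h5 : IsCl r {x | r a x} := ⟨a, rfl⟩
  have h6 := isCl_split_of_ne hr h h5 (fun h' => h3 (h' ▸ hr.equiv.refl a))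
    (fun h' => h4 (h' ▸ hr.equiv.refl a))
  have h7 : {x | split r S a x} = {x | r a x} := by
    obtain ⟨a', ha'⟩ := h6
    have h8 : split r S a' a := by
      have : a ∈ {x | r a x} := hr.equiv.refl a
      rwa [ha'] at this
    have hr' := isBPart_split hr h.neg
    rw [ha']
    ext x
    exact ⟨fun h => hr'.equiv.trans h8 h, fun h => hr'.equiv.trans (hr'.equiv.symm h8) h⟩
  rw [h7]
  exact ⟨h5, fun h' => h3 (h' ▸ hr.equiv.refl a), fun h' => h4 (h' ▸ hr.equiv.refl a)⟩

theorem not_isCl_split {r : SIdx n → SIdx n → Prop} (hr : IsBPart r) {b S : Set (SIdx n)}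
    (h : IsPiece r b S) : ¬ IsCl (split r S) b := by
  intro hb
  obtain ⟨x, hx⟩ := h.nonempty
  obtain ⟨y, hy, hyS⟩ := Set.exists_of_ssubset (h.subset.ssubset_of_ne h.ne)
  exact hyS ((IsCl.rel (isBPart_split hr h.neg) hb (h.subset hx) hy).2.1.1 hx)

/-! ### Summing over the class stabilizer -/

open Classical in
-- By transitivity the sum runs over all positions of the piece, each hit as often as the order M of
-- the stabilizer of S. As M depends on neither f nor g, it is the same in both applications of the
-- averaging and cancels.
theorem exists_sum_classStab {r : SIdx n → SIdx n → Prop} (hr : IsBPart r) {b S : Set (SIdx n)}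
    (h : IsPiece r b S) (R : Type*) [CommRing R] : ∃ M : ℕ, 0 < M ∧
      ∀ (f : Set (SIdx n) → R) (g : G n), ∑ k : classStab hr, f (smulSet (g * k) S) =
        M * ∑ T : Set (SIdx n) with T ⊆ smulSet g b ∧ T.ncard = S.ncard ∧
          ∀ x ∈ T, negIdx x ∉ T, f T := by
  refine ⟨(Finset.univ.filter fun k : classStab hr => smulSet (k : G n) S = S).card,
    Finset.card_pos.2 ⟨1, by simp [smulSet_one]⟩, fun f g => ?_⟩
  set F : Set (SIdx n) → Finset (Set (SIdx n)) := fun b' => Finset.univ.filter fun T =>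
    T ⊆ b' ∧ T.ncard = S.ncard ∧ ∀ x ∈ T, negIdx x ∉ T with hF
  have e1 : ∀ f : Set (SIdx n) → R, ∑ k : classStab hr, f (smulSet (k : G n) S) =
      (Finset.univ.filter fun k : classStab hr => smulSet (k : G n) S = S).card *
        ∑ T ∈ F b, f T := by
    intro f
    have hmaps : ∀ k ∈ (Finset.univ : Finset (classStab hr)), smulSet (k : G n) S ∈ F b := by
      intro k _
      simp only [hF, Finset.mem_filter, Finset.mem_univ, true_and]
      refine ⟨?_, ncard_smulSet _ _, ?_⟩
      · obtain ⟨a, ha⟩ := h.isClass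
        have := smulSet_of_mem_classStab hr hr (fun _ _ h => h) k.2 a
        rw [← ha] at this
        rw [← this]
        exact smulSet_mono _ h.subset
      · exact (h.smulSet (k : G n)).neg
    rw [← Finset.sum_fiberwise_of_maps_to hmaps, Finset.mul_sum]
    refine Finset.sum_congr rfl fun T hT => ?_
    simp only [hF, Finset.mem_filter, Finset.mem_univ, true_and] at hT
    obtain ⟨g₀, hg₀, rfl⟩ := exists_smulSet_eq hr h hT.1 hT.2.1 hT.2.2
    rw [Finset.sum_congr rfl fun k hk => by rw [(Finset.mem_filter.1 hk).2], Finset.sum_const,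
      nsmul_eq_mul]
    congr 2
    refine Finset.card_bij' (fun k _ => ⟨g₀, hg₀⟩⁻¹ * k) (fun k _ => ⟨g₀, hg₀⟩ * k) ?_ ?_ ?_ ?_
    · intro k hk
      simp only [Finset.mem_filter, Finset.mem_univ, true_and] at hk ⊢
      rw [Subgroup.coe_mul, smulSet_mul, hk, ← smulSet_mul]
      simp [smulSet_one]
    · intro k hk
      simp only [Finset.mem_filter, Finset.mem_univ, true_and] at hk ⊢
      rw [Subgroup.coe_mul, smulSet_mul, hk]
    · simp
    · simp
  have e2 := e1 fun T => f (smulSet g T)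
  simp only [← smulSet_mul] at e2
  rw [e2]
  congr 1
  have hmem : ∀ (g : G n) (b T : Set (SIdx n)), T ∈ F b → smulSet g T ∈ F (smulSet g b) := by
    intro g b T hT
    simp only [hF, Finset.mem_filter, Finset.mem_univ, true_and] at hT ⊢
    refine ⟨smulSet_mono g hT.1, by rw [ncard_smulSet, hT.2.1], fun x hx hx' => ?_⟩
    rw [mem_smulSet] at hx hx'
    rw [G.inv_apply_negIdx] at hx'
    exact hT.2.2 _ hx hx'
  refine Finset.sum_bij' (fun T _ => smulSet g T) (fun T _ => smulSet g⁻¹ T)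
    (fun T hT => hmem g b T hT) (fun T hT => ?_) ?_ ?_ ?_
  · have := hmem g⁻¹ _ T hT
    rwa [← smulSet_mul, inv_mul_cancel, smulSet_one] at this
  · intro T _
    rw [← smulSet_mul, inv_mul_cancel, smulSet_one]
  · intro T _
    rw [← smulSet_mul, mul_inv_cancel, smulSet_one]
  · intro T _
    rfl

/-! ### The sum of the weights over the group -/

theorem smulRel_top {g : G n} {r : SIdx n → SIdx n → Prop} (h : ∀ x y, r x y) :
    ∀ x y, smulRel g r x y := fun _ _ => h _ _

theorem IsSplitChain.mono {r : ℕ → SIdx n → SIdx n → Prop} {b S : ℕ → Set (SIdx n)}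
    (h : IsSplitChain r b S) {k l : ℕ} (hkl : k ≤ l) (hl : l ≤ n) {x y : SIdx n}
    (hxy : r k x y) : r l x y := by
  induction l, hkl using Nat.le_induction with
  | base => exact hxy
  | succ l hkl ih =>
    have := ih (by omega)
    rw [h.eq l (by omega)] at this
    exact this.1

open Polynomial in
open Classical in
/-- The weight of the `k`-th step of a translate of a chain. -/
def stepWeight (P : ℤ → SIdx n) (r : ℕ → SIdx n → SIdx n → Prop) (k : ℕ) (g : G n) : ℤ[X] :=
  if NC P (smulRel g (r k)) then
    (if Conv (smulRel g (r k)) (smulRel g (r (k + 1))) then 1 else X) else 0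

/-- The number of positions of the `k`-th piece that are fixed up to sign. -/
def symFactor (b : ℕ → Set (SIdx n)) (k : ℕ) : ℕ :=
  open Classical in if negBlock (b k) = b k ∨ (b k).ncard = 2 then 2 else 1

open Polynomial in
open Classical in
-- A nonzero product of later weights says that the coarser translate is noncrossing (trivially so
-- at the top, where everything is related), which is what the local count needs.
theorem sum_stepWeight (hn : 1 ≤ n) {P : ℤ → SIdx n} (hP : IsCoxEnum P)
    {r : ℕ → SIdx n → SIdx n → Prop} {b S : ℕ → Set (SIdx n)} (h : IsSplitChain r b S)
    {M : ℕ} {k : ℕ} (hk : k < n)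
    (hM : ∀ (f : Set (SIdx n) → ℤ[X]) (g : G n),
      ∑ t : classStab (h.part (k + 1)), f (smulSet (g * t) (S k)) =
        M * ∑ T : Set (SIdx n) with T ⊆ smulSet g (b k) ∧ T.ncard = (S k).ncard ∧
          ∀ x ∈ T, negIdx x ∉ T, f T)
    (g : G n) (hg : (∏ j ∈ Finset.Ico (k + 1) n, stepWeight P r j g) ≠ 0) :
    ∑ t : classStab (h.part (k + 1)), stepWeight P r k (g * (t : G n)) =
      (M : ℤ[X]) * (2 + X * (((b k).ncard : ℤ[X]) - 2)) := by
  have hNC : NC P (smulRel g (r (k + 1))) := by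
    rcases Nat.lt_or_ge (k + 1) n with h1 | h1
    · by_contra hcon
      refine hg (Finset.prod_eq_zero (Finset.mem_Ico.2 ⟨le_refl _, h1⟩) ?_)
      rw [stepWeight, if_neg hcon]
    · obtain rfl : n = k + 1 := by omega
      exact fun i j _ _ _ _ _ _ _ _ => smulRel_top h.top _ _
  have hpc := (h.piece k hk).smulSet g
  obtain ⟨F, hF⟩ : ∃ F : Set (SIdx n) → ℤ[X], ∀ T, F T =
      if NC P (split (smulRel g (r (k + 1))) T) then
        (if Conv (split (smulRel g (r (k + 1))) T) (smulRel g (r (k + 1))) then 1 else X) else 0 :=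
    ⟨_, fun _ => rfl⟩
  have e1 : ∀ t : classStab (h.part (k + 1)), stepWeight P r k (g * (t : G n)) =
      F (smulSet (g * (t : G n)) (S k)) := by
    intro t
    have h2 : smulRel (g * (t : G n)) (r (k + 1)) = smulRel g (r (k + 1)) :=
      smulRel_of_mem_classStab (h.part (k + 1)) (h.part (k + 1)) (fun _ _ h => h) t.2 g
    rw [hF, stepWeight, h.eq k hk, smulRel_split, h2]
  rw [Finset.sum_congr rfl fun t _ => e1 t, hM F g, Finset.sum_congr rfl fun T _ => hF T]
  congr 1
  have := sum_local_weight hn hP (isBPart_smulRel g (h.part (k + 1))) hNC hpc.isClass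
    (j := (S k).ncard) (h.piece k hk).ncard_pos
    (by rw [ncard_smulSet]; exact (h.piece k hk).ncard_lt) ?_
  · rw [ncard_smulSet] at this
    exact this
  · intro x hx hx'
    have h3 := hpc.two_mul_ncard_le
      (negBlock_eq_of_mem (isBPart_smulRel g (h.part (k + 1))) hpc.isClass hx hx')
    rwa [ncard_smulSet] at h3

theorem stepWeight_mul {P : ℤ → SIdx n} {r : ℕ → SIdx n → SIdx n → Prop} {b S : ℕ → Set (SIdx n)}
    (h : IsSplitChain r b S) {k j : ℕ} (hkj : k < j) (hj : j < n) (g t : G n)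
    (ht : t ∈ classStab (h.part (k + 1))) : stepWeight P r j (g * t) = stepWeight P r j g := by
  unfold stepWeight
  rw [smulRel_of_mem_classStab (h.part (k + 1)) (h.part j)
      (fun _ _ => h.mono (by omega) (by omega)) ht,
    smulRel_of_mem_classStab (h.part (k + 1)) (h.part (j + 1))
      (fun _ _ => h.mono (by omega) (by omega)) ht]

/-! ### The stabilizer of a chain -/

/-- The translate of the `k`-th piece is the piece or its opposite, unless the broken class is a
pair of elements. -/
def FixesPiece (b S : ℕ → Set (SIdx n)) (k : ℕ) (g : G n) : Prop :=
  (negBlock (b k) ≠ b k ∧ (b k).ncard = 2) ∨ smulSet g (S k) = S k ∨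
    smulSet g (S k) = negBlock (S k)

section Stab

variable {r : ℕ → SIdx n → SIdx n → Prop} {b S : ℕ → Set (SIdx n)} (h : IsSplitChain r b S)
include h

theorem fixesPiece_mul {k j : ℕ} (hkj : k < j) (hj : j < n) (g t : G n)
    (ht : t ∈ classStab (h.part (k + 1))) : FixesPiece b S j (g * t) ↔ FixesPiece b S j g := by
  obtain ⟨a, ha⟩ := h.cls j hj
  have := smulSet_of_mem_classStab (h.part (k + 1)) (h.part j)
    (fun _ _ => h.mono (by omega) (by omega)) ht a
  rw [← ha] at this
  unfold FixesPiece
  rw [smulSet_mul, this]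

/-- Descending from the top, a class is either inherited, or a piece, or the rest of a broken class,
up to sign; the rest is preserved because the broken class and the union of the piece with its
opposite are. The exceptional pairs do no harm: they break into singletons. -/
theorem smulSet_eq_or_of_fixesPiece {g : G n} {m : ℕ} (hm : m ≤ n)
    (hg : ∀ j, m ≤ j → j < n → FixesPiece b S j g) {c : Set (SIdx n)} (hc : IsCl (r m) c)
    (hc2 : 2 ≤ c.ncard) : smulSet g c = c ∨ smulSet g c = negBlock c := by
  induction hd : n - m generalizing m c with
  | zero =>
    left
    obtain rfl : m = n := by omega
    obtain ⟨a, rfl⟩ := hc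
    ext x
    rw [mem_smulSet]
    exact ⟨fun _ => h.top _ _, fun _ => h.top _ _⟩
  | succ d ih =>
    have hmn : m < n := by omega
    have ih : ∀ {c : Set (SIdx n)}, IsCl (r (m + 1)) c → 2 ≤ c.ncard →
        smulSet g c = c ∨ smulSet g c = negBlock c := fun hc hc2 =>
      ih (by omega) (fun j hj hj' => hg j (by omega) hj') hc hc2 (by omega)
    have hr := h.part (m + 1)
    have hp := h.piece m hmn
    wlog hc' : (IsCl (r (m + 1)) c ∧ c ≠ b m ∧ c ≠ negBlock (b m)) ∨ c = S m ∨
      c = restOf (b m) (S m) generalizing c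
    · have h1 := hc
      rw [h.eq m hmn] at h1
      have h2 := isCl_split_cases hr hp h1
      have h3 := this (c := negBlock c) (hc.negBlock (h.part m)) (by rwa [ncard_negBlock]) (by
        rcases h2 with h2 | h2 | h2 | h2 | h2
        · exact (hc' (Or.inl h2)).elim
        · exact (hc' (Or.inr (Or.inl h2))).elim
        · rw [h2, negBlock_negBlock]; simp
        · exact (hc' (Or.inr (Or.inr h2))).elim
        · rw [h2, negBlock_negBlock]; simp)
      rw [smulSet_negBlock] at h3
      rcases h3 with h3 | h3
      · exact Or.inl (negBlock_injective h3)
      · exact Or.inr (negBlock_injective h3)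
    have hb : 2 ≤ (b m).ncard := by
      have := hp.ncard_lt
      have := hp.ncard_pos
      omega
    rcases hc' with ⟨h1, -, -⟩ | h1 | h1
    · exact ih h1 hc2
    all_goals
      have hS : smulSet g (S m) = S m ∨ smulSet g (S m) = negBlock (S m) := by
        rcases hg m le_rfl hmn with ⟨h2, h3⟩ | h2
        · exfalso
          have h4 : c ⊂ b m := by
            subst h1
            first
            | exact hp.subset.ssubset_of_ne hp.ne
            | exact ⟨Set.sdiff_subset, fun h5 => by
                obtain ⟨x, hx⟩ := hp.nonempty
                exact (h5 (hp.subset hx)).2 (Or.inl hx)⟩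
          have := Set.ncard_lt_ncard h4 (Set.toFinite _)
          omega
        · exact h2
    · rw [h1]; exact hS
    · have h2 : smulSet g (S m ∪ negBlock (S m)) = S m ∪ negBlock (S m) := by
        rw [smulSet, Set.image_union]
        change smulSet g _ ∪ smulSet g _ = _
        rw [smulSet_negBlock]
        rcases hS with hS | hS <;> rw [hS]
        rw [negBlock_negBlock, Set.union_comm]
      have h3 : smulSet g (restOf (b m) (S m)) = restOf (smulSet g (b m)) (S m) := by
        rw [restOf, smulSet, Set.image_sdiff g.1.injective]
        change smulSet g _ \ smulSet g _ = _
        rw [h2, restOf]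
      rw [h1, h3]
      rcases ih hp.isClass hb with h4 | h4
      · rw [h4]; exact Or.inl rfl
      · rw [h4, negBlock_restOf]; exact Or.inr rfl

/-- The finest relation has only singletons, so going down the chain every larger class is broken at
some step. -/
theorem IsSplitChain.exists_eq_of_isCl {k : ℕ} (hk : k ≤ n) {c : Set (SIdx n)} (hc : IsCl (r k) c)
    (hc2 : 2 ≤ c.ncard) : ∃ j < k, c = b j ∨ c = negBlock (b j) := by
  induction k with
  | zero =>
    obtain ⟨a, rfl⟩ := hc
    have : {x | r 0 a x} ⊆ {a} := fun x hx => (h.bot _ _ hx).symm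
    have := Set.ncard_le_ncard this (Set.toFinite _)
    rw [Set.ncard_singleton] at this
    omega
  | succ k ih =>
    by_cases h1 : c = b k ∨ c = negBlock (b k)
    · exact ⟨k, by omega, h1⟩
    · rw [not_or] at h1
      have h2 := isCl_split_of_ne (h.part (k + 1)) (h.piece k (by omega)) hc h1.1 h1.2
      rw [← h.eq k (by omega)] at h2
      obtain ⟨j, hj, h3⟩ := ih (by omega) h2
      exact ⟨j, by omega, h3⟩

/-- Up to sign, b k is the only class of r (k + 1) that is not a class of r k, so a symmetry of the
chain cannot send it elsewhere. -/
theorem smulSet_b_of_smulRel_eq {g : G n} (hg : ∀ k ≤ n, smulRel g (r k) = r k) {k : ℕ}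
    (hk : k < n) : smulSet g (b k) = b k ∨ smulSet g (b k) = negBlock (b k) := by
  by_contra hcon
  rw [not_or] at hcon
  have hp := h.piece k hk
  have h1 := IsCl.smulSet hp.isClass g
  rw [hg (k + 1) (by omega)] at h1
  have h2 := isCl_split_of_ne (h.part (k + 1)) hp h1 hcon.1 hcon.2
  rw [← h.eq k hk, ← hg k (by omega)] at h2
  have h3 := h2.smulSet g⁻¹
  rw [← smulSet_mul, inv_mul_cancel, smulSet_one] at h3
  have h4 : smulRel g⁻¹ (smulRel g (r k)) = r k := by
    funext x y
    simp [smulRel]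
  rw [h4, h.eq k hk] at h3
  exact not_isCl_split (h.part (k + 1)) hp h3

theorem IsSplitChain.two_le_ncard_b {k : ℕ} (hk : k < n) : 2 ≤ (b k).ncard := by
  have := (h.piece k hk).ncard_lt
  have := (h.piece k hk).ncard_pos
  omega

/-- A piece of at least two elements is, up to sign, some broken b j, which is preserved. If a
singleton {x} is split off a zero class, then x and -x are the only elements leaving it, so g x is
one of them. If it is split off another class, the choice of the larger part leaves only a pair,
which is the exceptional case. -/
theorem fixesPiece_of_smulRel_eq {g : G n} (hg : ∀ k ≤ n, smulRel g (r k) = r k) {k : ℕ}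
    (hk : k < n) : FixesPiece b S k g := by
  have hp := h.piece k hk
  rcases Nat.lt_or_ge (S k).ncard 2 with h1 | h1
  · have hS1 : (S k).ncard = 1 := by have := hp.ncard_pos; omega
    obtain ⟨x, hx⟩ := Set.ncard_eq_one.1 hS1
    have hxS : x ∈ S k := by rw [hx]; rfl
    by_cases hz : negBlock (b k) = b k
    · right
      have hr1 := h.part (k + 1)
      have hxb := hp.subset hxS
      have h2 : r (k + 1) x (negIdx x) := hp.rel_of_mem hr1 hxb (by
        rw [← hz, mem_negBlock, negIdx_negIdx]; exact hxb)
      have h3 : ∀ {m}, m ≤ n → ∀ {u v}, r m (g.1 u) (g.1 v) ↔ r m u v := by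
        intro m hm u v
        conv_lhs => rw [← hg m hm]
        simp [smulRel]
      have h4 : r (k + 1) (g.1 x) (negIdx (g.1 x)) := by
        rw [← G.apply_negIdx]
        exact (h3 (by omega)).2 h2
      have h5 : g.1 x ∈ b k := hp.mem_of_rel hr1 hxb (hr1.zero _ _ h2 h4)
      have h6 : g.1 x ∈ S k ∨ negIdx (g.1 x) ∈ S k := by
        by_contra hcon
        rw [not_or] at hcon
        have h7 : r k (g.1 x) (negIdx (g.1 x)) := by
          rw [h.eq k hk]
          exact ⟨h4, by simp [hcon], by simp [hcon]⟩
        rw [← G.apply_negIdx, h3 (by omega), h.eq k hk] at h7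
        exact hp.neg x hxS (h7.2.1.1 hxS)
      rw [hx, Set.mem_singleton_iff, Set.mem_singleton_iff] at h6
      rw [hx]
      have h8 : smulSet g {x} = {g.1 x} := Set.image_singleton
      have h9 : negBlock {x} = {negIdx x} := Set.image_singleton
      rw [h8, h9]
      rcases h6 with h6 | h6
      · left; rw [h6]
      · right; rw [negIdx_eq_iff] at h6; rw [h6]
    · left
      refine ⟨hz, ?_⟩
      have h2 := h.large k hk fun x hx hx' => hz (negBlock_eq_of_mem (h.part (k + 1)) hp.isClass hx hx')
      have := h.two_le_ncard_b hk
      omega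
  · right
    obtain ⟨j, hj, h2⟩ := h.exists_eq_of_isCl hk.le (h.cls k hk) h1
    have h3 := smulSet_b_of_smulRel_eq h hg (show j < n by omega)
    rcases h2 with h2 | h2
    · rwa [h2]
    · rw [h2, smulSet_negBlock]
      rcases h3 with h3 | h3
      · left; rw [h3]
      · right; rw [h3]

/-- This turns membership in the stabilizer of the chain into a product of step conditions, the form
required by `card_mul_sum_prod`. -/
theorem smulRel_eq_iff_fixesPiece {g : G n} :
    (∀ k ≤ n, smulRel g (r k) = r k) ↔ ∀ k < n, FixesPiece b S k g := by
  refine ⟨fun hg k hk => fixesPiece_of_smulRel_eq h hg hk, fun hg => ?_⟩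
  have core : ∀ g : G n, (∀ k < n, FixesPiece b S k g) → ∀ k ≤ n, ∀ x y, r k x y →
      r k (g.1 x) (g.1 y) := by
    intro g hg k hk x y hxy
    have hr := h.part k
    by_cases hne : x = y
    · rw [hne]; exact hr.equiv.refl _
    have hc : IsCl (r k) {z | r k x z} := ⟨x, rfl⟩
    have h2 : 2 ≤ {z | r k x z}.ncard := by
      have : {x, y} ⊆ {z | r k x z} := by
        rintro z (rfl | rfl)
        · exact hr.equiv.refl _
        · exact hxy
      have := Set.ncard_le_ncard this (Set.toFinite _)
      rwa [Set.ncard_pair hne] at this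
    have hx : g.1 x ∈ smulSet g {z | r k x z} := ⟨x, hr.equiv.refl _, rfl⟩
    have hy : g.1 y ∈ smulSet g {z | r k x z} := ⟨y, hxy, rfl⟩
    rcases smulSet_eq_or_of_fixesPiece h hk (fun j _ hj => hg j hj) hc h2 with h3 | h3
    · rw [h3] at hx hy
      exact hc.rel hr hx hy
    · rw [h3] at hx hy
      exact (hc.negBlock hr).rel hr hx hy
  have hinv : ∀ k < n, FixesPiece b S k g⁻¹ := by
    intro k hk
    have hgg : ∀ T : Set (SIdx n), smulSet g⁻¹ (smulSet g T) = T := fun T => by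
      rw [← smulSet_mul, inv_mul_cancel, smulSet_one]
    rcases hg k hk with h1 | h1 | h1
    · exact Or.inl h1
    · right; left
      conv_lhs => rw [← h1]
      rw [hgg]
    · right; right
      have := hgg (S k)
      rw [h1, smulSet_negBlock] at this
      exact negBlock_injective (this.trans (negBlock_negBlock _).symm)
  intro k hk
  funext x y
  apply propext
  refine ⟨fun hxy => ?_, fun hxy => ?_⟩
  · have := core g hg k hk _ _ hxy
    simpa using this
  · exact core g⁻¹ hinv k hk x y hxy

end Stab

end
end TypeB

/-! ### The order of the stabilizer of a chain, and the product formula for a class -/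

namespace TypeB
noncomputable section

variable {n : ℕ}

open Polynomial in
open Classical in
-- A zero class contains both S and its opposite; a pair allows both of its singletons; in any other
-- class only one of S and -S lies inside b'.
theorem card_fixed_positions {r : SIdx n → SIdx n → Prop} (hr : IsBPart r) {b S b' : Set (SIdx n)}
    (hp : IsPiece r b S) (hb' : b' = b ∨ b' = negBlock b) :
    (Finset.univ.filter fun T : Set (SIdx n) => (T ⊆ b' ∧ T.ncard = S.ncard ∧
      ∀ x ∈ T, negIdx x ∉ T) ∧ ((negBlock b ≠ b ∧ b.ncard = 2) ∨ T = S ∨ T = negBlock S)).card =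
      if negBlock b = b ∨ b.ncard = 2 then 2 else 1 := by
  have hSS : S ≠ negBlock S := by
    intro h
    obtain ⟨x, hx⟩ := hp.nonempty
    exact hp.neg x hx (mem_negBlock.1 (h ▸ hx))
  have hnS : ∀ x ∈ negBlock S, negIdx x ∉ negBlock S := by
    intro x hx hx'
    rw [mem_negBlock] at hx hx'
    exact hp.neg _ hx hx'
  have hmono : negBlock S ⊆ negBlock b := Set.image_mono hp.subset
  by_cases hz : negBlock b = b
  · rw [if_pos (Or.inl hz)]
    have hbb : b' = b := by rcases hb' with h | h <;> simp [h, hz]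
    subst hbb
    rw [hz] at hmono
    rw [← Finset.card_pair hSS]
    congr 1
    ext T
    simp only [Finset.mem_filter, Finset.mem_univ, true_and, Finset.mem_insert,
      Finset.mem_singleton, ne_eq, hz, not_true, false_and, false_or, and_iff_right_iff_imp]
    rintro (rfl | rfl)
    · exact ⟨hp.subset, rfl, hp.neg⟩
    · exact ⟨hmono, ncard_negBlock S, hnS⟩
  by_cases h2 : b.ncard = 2
  · rw [if_pos (Or.inr h2)]
    have hcard : b'.ncard = 2 := by rcases hb' with h | h <;> simp [h, ncard_negBlock, h2]
    have hS1 : S.ncard = 1 := by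
      have := hp.ncard_lt
      have := hp.ncard_pos
      omega
    obtain ⟨u, v, huv, rfl⟩ := Set.ncard_eq_two.1 hcard
    have : ({u} : Set (SIdx n)) ≠ {v} := by simpa using huv
    refine (congrArg Finset.card ?_).trans (Finset.card_pair this)
    ext T
    simp only [Finset.mem_filter, Finset.mem_univ, true_and, Finset.mem_insert,
      Finset.mem_singleton, ne_eq, hz, not_false_eq_true, h2, and_self, true_or, and_true, hS1]
    constructor
    · rintro ⟨h3, h4, -⟩
      obtain ⟨w, rfl⟩ := Set.ncard_eq_one.1 h4
      rcases h3 rfl with rfl | h5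
      · exact Or.inl rfl
      · exact Or.inr (by rw [Set.mem_singleton_iff.1 h5])
    · rintro (rfl | rfl)
      · refine ⟨by simp, Set.ncard_singleton _, fun x hx hx' => ?_⟩
        rw [Set.mem_singleton_iff] at hx hx'
        exact negIdx_ne _ (hx'.trans hx.symm)
      · refine ⟨by simp, Set.ncard_singleton _, fun x hx hx' => ?_⟩
        rw [Set.mem_singleton_iff] at hx hx'
        exact negIdx_ne _ (hx'.trans hx.symm)
  · rw [if_neg (by tauto)]
    have hdis : ∀ x ∈ b, x ∉ negBlock b := fun x hx hx' =>
      hz ((IsCl.negBlock hr hp.isClass).eq_of_inter hr hp.isClass hx' hx)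
    obtain ⟨x, hx⟩ := hp.nonempty
    rw [Finset.card_eq_one]
    rcases hb' with rfl | rfl
    · refine ⟨S, ?_⟩
      ext T
      simp only [Finset.mem_filter, Finset.mem_univ, true_and, Finset.mem_singleton, h2, and_false,
        false_or]
      constructor
      · rintro ⟨⟨h3, -, -⟩, rfl | rfl⟩
        · rfl
        · have h4 : negIdx x ∈ negBlock S := by rwa [mem_negBlock, negIdx_negIdx]
          exact (hdis _ (h3 h4) (hmono h4)).elim
      · rintro rfl
        exact ⟨⟨hp.subset, rfl, hp.neg⟩, Or.inl rfl⟩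
    · refine ⟨negBlock S, ?_⟩
      ext T
      simp only [Finset.mem_filter, Finset.mem_univ, true_and, Finset.mem_singleton, h2, and_false,
        false_or]
      constructor
      · rintro ⟨⟨h3, -, -⟩, rfl | rfl⟩
        · exact (hdis _ (hp.subset hx) (h3 hx)).elim
        · rfl
      · rintro rfl
        exact ⟨⟨hmono, ncard_negBlock S, hnS⟩, Or.inr rfl⟩

open Polynomial in
open Classical in
theorem sum_fixesPiece {r : ℕ → SIdx n → SIdx n → Prop} {b S : ℕ → Set (SIdx n)}
    (h : IsSplitChain r b S) {M : ℕ} {k : ℕ} (hk : k < n)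
    (hM : ∀ (f : Set (SIdx n) → ℤ[X]) (g : G n),
      ∑ t : classStab (h.part (k + 1)), f (smulSet (g * t) (S k)) =
        M * ∑ T : Set (SIdx n) with T ⊆ smulSet g (b k) ∧ T.ncard = (S k).ncard ∧
          ∀ x ∈ T, negIdx x ∉ T, f T)
    (g : G n) (hg : (∏ j ∈ Finset.Ico (k + 1) n, (if FixesPiece b S j g then 1 else 0 : ℤ[X])) ≠ 0) :
    ∑ t : classStab (h.part (k + 1)), (if FixesPiece b S k (g * (t : G n)) then 1 else 0 : ℤ[X]) =
      (M : ℤ[X]) * (symFactor b k : ℤ[X]) := by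
  have hfix : ∀ j, k + 1 ≤ j → j < n → FixesPiece b S j g := by
    intro j hj hj'
    by_contra hcon
    exact hg (Finset.prod_eq_zero (Finset.mem_Ico.2 ⟨hj, hj'⟩) (if_neg hcon))
  have hp := h.piece k hk
  have hb := smulSet_eq_or_of_fixesPiece h (by omega) hfix hp.isClass (h.two_le_ncard_b hk)
  have := hM (fun T => if (negBlock (b k) ≠ b k ∧ (b k).ncard = 2) ∨ T = S k ∨ T = negBlock (S k)
    then 1 else 0) g
  refine (Finset.sum_congr rfl fun t _ => ?_).trans (this.trans ?_)
  · by_cases hF : FixesPiece b S k (g * (t : G n))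
    · rw [if_pos hF]
      exact (if_pos hF).symm
    · rw [if_neg hF]
      exact (if_neg hF).symm
  rw [← Finset.sum_filter, Finset.filter_filter, Finset.sum_const, nsmul_eq_mul, mul_one,
    card_fixed_positions (h.part (k + 1)) hp hb, symFactor]

/-- The signed permutations preserving every partition of a chain. -/
def chainStab (r : ℕ → SIdx n → SIdx n → Prop) : Finset (G n) :=
  open Classical in Finset.univ.filter fun g => ∀ k ≤ n, smulRel g (r k) = r k

theorem smulRel_mul (g h : G n) (r : SIdx n → SIdx n → Prop) :
    smulRel (g * h) r = smulRel g (smulRel h r) := by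
  funext x y
  simp [smulRel]

theorem smulRel_one (r : SIdx n → SIdx n → Prop) : smulRel (1 : G n) r = r := by
  funext x y
  simp [smulRel]

theorem mem_chainStab {r : ℕ → SIdx n → SIdx n → Prop} {g : G n} :
    g ∈ chainStab r ↔ ∀ k ≤ n, smulRel g (r k) = r k := by
  simp [chainStab]

open Classical in
theorem card_filter_smulRel_eq (r : ℕ → SIdx n → SIdx n → Prop) (g₀ : G n) :
    (Finset.univ.filter fun g : G n => ∀ k ≤ n, smulRel g (r k) = smulRel g₀ (r k)).card =
      (chainStab r).card := by
  refine Finset.card_bij' (fun g _ => g₀⁻¹ * g) (fun g _ => g₀ * g) ?_ ?_ ?_ ?_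
  · intro g hg
    rw [mem_chainStab]
    intro k hk
    rw [smulRel_mul, (Finset.mem_filter.1 hg).2 k hk, ← smulRel_mul, inv_mul_cancel, smulRel_one]
  · intro g hg
    rw [mem_chainStab] at hg
    refine Finset.mem_filter.2 ⟨Finset.mem_univ _, fun k hk => ?_⟩
    rw [smulRel_mul, hg k hk]
  · simp
  · simp

/-! ### Translates of a chain of subspaces -/

/-- The translate is cut out by all the positive roots orthogonal to it, which carry all its
equations between signed coordinates. -/
theorem setPartitions_map_act {π : Submodule ℝ (V n)} (h : π ∈ setPartitions n) (g : G n) :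
    π.map ((act g).toLinearEquiv : V n →ₗ[ℝ] V n) ∈ setPartitions n := by
  set ρ := π.map ((act g).toLinearEquiv : V n →ₗ[ℝ] V n) with hρ
  refine ⟨{α | α ∈ posRoots n ∧ α ∈ ρᗮ}, fun α hα => hα.1, le_antisymm ?_ fun x hx => ?_⟩
  · refine le_iInf₂ fun α hα x hx => ?_
    rw [Submodule.mem_orthogonal_singleton_iff_inner_right]
    exact (Submodule.mem_orthogonal' ρ α).1 hα.2 x hx
  have hroot : ∀ α ∈ posRoots n, α ∈ ρᗮ → inner ℝ α x = 0 := by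
    intro α h1 h2
    rw [← Submodule.mem_orthogonal_singleton_iff_inner_right]
    simp only [Submodule.mem_iInf] at hx
    exact hx α ⟨h1, h2⟩
  have hlt : ∀ a c : SIdx n, sv a < sv c → rel ρ a c → coord a x = coord c x := by
    intro a c hac hrel
    obtain ⟨h1, h2⟩ := root_pair_mem hac
    by_cases hc : c = negIdx a
    · subst hc
      have := hroot _ (h2 rfl) (rel_neg_iff_inner.1 hrel)
      rw [← coord_eq_inner] at this
      rw [coord_negIdx, this, neg_zero]
    · have := hroot _ (h1 hc) (rel_iff_inner.1 hrel)
      rwa [inner_sub_left, ← coord_eq_inner, ← coord_eq_inner, sub_eq_zero] at this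
  have hall : ∀ a c : SIdx n, rel ρ a c → coord a x = coord c x := by
    intro a c hrel
    rcases lt_trichotomy (sv a) (sv c) with h1 | h1 | h1
    · exact hlt a c h1 hrel
    · rw [sv_injective h1]
    · exact (hlt c a h1 ((isBPart_rel ρ).equiv.symm hrel)).symm
  refine ⟨act g⁻¹ x, (mem_setPartition h).2 fun a c hac => ?_, ?_⟩
  · rw [coord_act, coord_act]
    refine hall _ _ ?_
    rw [hρ, rel_map_act]
    simpa [smulRel] using hac
  · change act g (act g⁻¹ x) = x
    refine ext_coord fun a => ?_
    simp

theorem finrank_map_act (π : Submodule ℝ (V n)) (g : G n) :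
    Module.finrank ℝ (π.map ((act g).toLinearEquiv : V n →ₗ[ℝ] V n)) = Module.finrank ℝ π :=
  LinearEquiv.finrank_map_eq (act g).toLinearEquiv π

/-- The translate of a chain. -/
def mapChain (p : Fin (n + 1) → Submodule ℝ (V n)) (g : G n) (i : Fin (n + 1)) :
    Submodule ℝ (V n) := (p i).map ((act g).toLinearEquiv : V n →ₗ[ℝ] V n)

section

variable {p : Fin (n + 1) → Submodule ℝ (V n)} (hp : IsMaximalChain (setPartitions n) p)
  {r : ℕ → SIdx n → SIdx n → Prop} {b S : ℕ → Set (SIdx n)} (h : IsSplitChain r b S)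
  (hr : ∀ k (hk : k < n + 1), r k = rel (p ⟨k, hk⟩))
include hp hr

omit hp in
theorem rel_mapChain (g : G n) {k : ℕ} (hk : k < n + 1) :
    rel (mapChain p g ⟨k, hk⟩) = smulRel g (r k) := by
  rw [mapChain, rel_map_act, hr k hk]

theorem mapChain_eq_iff (g g' : G n) :
    mapChain p g = mapChain p g' ↔ ∀ k ≤ n, smulRel g (r k) = smulRel g' (r k) := by
  constructor
  · intro h k hk
    rw [← rel_mapChain hr g (by omega), ← rel_mapChain hr g' (by omega), h]
  · intro h
    funext ⟨k, hk⟩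
    refine eq_of_rel_eq (setPartitions_map_act (hp.2.2.1 _) g)
      (setPartitions_map_act (hp.2.2.1 _) g') ?_
    rw [rel_mapChain hr, rel_mapChain hr, h k (by omega)]

include h

/-- For the converse, noncrossing relations at two successive steps force the piece not to
alternate, hence to be an arc, and the reflections can then be stripped off as in
`mem_noncrossing_of_chain`. Nothing fits between successive terms because their dimensions differ by
1. -/
theorem mapChain_mem_chainClass_iff (hn : 1 ≤ n) {P : ℤ → SIdx n} (hP : IsCoxEnum P) {γ : G n}
    (hγ : ∀ k, P (k + 1) = γ.1 (P k)) (hfix : ∀ x, act γ x = x → x = 0)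
    (hword : ∃ l : List (V n ≃ₗᵢ[ℝ] V n), (∀ t ∈ l, t ∈ reflections n) ∧ l.prod = act γ ∧
      l.length = n) (g : G n) :
    mapChain p g ∈ chainClass (act γ) p ↔ ∀ k < n, NC P (smulRel g (r k)) := by
  constructor
  · intro hg k hk
    rw [← rel_mapChain hr g (by omega)]
    exact NC_of_mem_noncrossing hP hγ hfix hword (hg.1.2.2.1 _)
  · intro hNC
    have hNC' : ∀ k ≤ n, NC P (smulRel g (r k)) := by
      intro k hk
      rcases hk.lt_or_eq with h1 | rfl
      · exact hNC k h1
      · exact fun i j _ _ _ _ _ _ _ _ => h.top _ _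
    have hrank := fun i => (finrank_map_act (p i) g).trans (finrank_of_isMaximalChain hp i)
    have hstep : ∀ i : Fin n, mapChain p g i.succ < mapChain p g i.castSucc := fun i =>
      (Submodule.map_strictMono_of_injective (act g).toLinearEquiv.injective) (hp.2.2.2 i).1
    have hmem : ∀ k (hk : k ≤ n), mapChain p g ⟨k, by omega⟩ ∈ noncrossing (act γ) := by
      have := mem_noncrossing_of_chain hn hP hγ hfix
        (Ω := fun k => mapChain p g ⟨min k n, by omega⟩)
        (fun k _ => setPartitions_map_act (hp.2.2.1 _) g) ?_ ?_ ?_ ?_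
      · intro k hk
        have := this k hk
        simpa only [min_eq_left hk] using this
      · intro k hk
        refine (hrank ⟨min k n, by omega⟩).trans ?_
        rw [Fin.val_mk, min_eq_left hk]
      · intro k hk
        have : mapChain p g ⟨k + 1, by omega⟩ ≤ mapChain p g ⟨k, by omega⟩ := (hstep ⟨k, hk⟩).le
        simpa only [min_eq_left hk.le, min_eq_left (show k + 1 ≤ n by omega)] using this
      · intro k hk
        simp only [min_eq_left hk]
        rw [rel_mapChain hr]
        exact hNC' k hk
      · intro k hk
        simp only [min_eq_left hk.le, min_eq_left (show k + 1 ≤ n by omega)]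
        rw [rel_mapChain hr, rel_mapChain hr]
        have h1 := (h.piece k hk).smulSet g
        have h2 := hNC' k hk.le
        rw [h.eq k hk, smulRel_split] at h2 ⊢
        have h3 := isBPart_smulRel g (h.part (k + 1))
        exact arcSplit_of_noAlt hn hP h3 h1
          ((NC_split_iff hP h3 (hNC' (k + 1) (by omega)) h1).1 h2)
    refine ⟨⟨?_, ?_, fun i => hmem i (by omega), fun i => ⟨hstep i, ?_⟩⟩, act g, ?_, fun _ => rfl⟩
    · rw [mapChain, hp.1, Submodule.map_top]
      exact LinearMap.range_eq_top.2 (act g).toLinearEquiv.surjective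
    · rw [mapChain, hp.2.1, Submodule.map_bot]
    · rintro ρ - ⟨h1, h2⟩
      have h3 := Submodule.finrank_lt_finrank_of_lt h1
      have h4 := Submodule.finrank_lt_finrank_of_lt h2
      have h5 := hrank i.succ
      have h6 := hrank i.castSucc
      simp only [Fin.val_succ, Fin.val_castSucc] at h5 h6
      change Module.finrank ℝ (mapChain p g i.succ) = _ at h5
      change Module.finrank ℝ (mapChain p g i.castSucc) = _ at h6
      omega
    · rw [W_eq_range]
      exact ⟨g, rfl⟩

omit h in
open Polynomial in
theorem prod_stepWeight {P : ℤ → SIdx n} (g : G n) (hNC : ∀ k < n, NC P (smulRel g (r k))) :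
    ∏ k ∈ Finset.range n, stepWeight P r k g = X ^ nir (mapChain p g) := by
  classical
  rw [nir, Set.ncard_eq_toFinset_card', ← Finset.prod_const, Finset.prod_range, ← Finset.prod_filter_mul_prod_filter_not Finset.univ
    (fun i : Fin n => ¬ IsIntervalRefinement (mapChain p g i.castSucc) (mapChain p g i.succ))]
  have e1 : ∀ i : Fin n, stepWeight P r i g = if ¬ IsIntervalRefinement (mapChain p g i.castSucc) (mapChain p g i.succ) then X else 1 := by
    intro i
    have hle : mapChain p g i.succ ≤ mapChain p g i.castSucc :=
      Submodule.map_mono (hp.2.2.2 i).1.le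
    rw [isIntervalRefinement_iff hle, stepWeight, if_pos (hNC i i.2)]
    have h1 : rel (mapChain p g i.castSucc) = smulRel g (r i) := rel_mapChain hr g _
    have h2 : rel (mapChain p g i.succ) = smulRel g (r (i + 1)) := rel_mapChain hr g _
    rw [h1, h2, ite_not]
  simp only [e1]
  rw [Finset.prod_congr (g := fun _ => (X : ℤ[X])) rfl fun i hi => if_pos (Finset.mem_filter.1 hi).2,
    Finset.prod_congr (g := fun _ => (1 : ℤ[X])) rfl fun i hi => if_neg (Finset.mem_filter.1 hi).2,
    Finset.prod_const_one, mul_one]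
  congr 1
  ext i
  simp

open Polynomial in
-- Translates outside the class have weight 0, and the fibre of g ↦ `mapChain p g` over a chain of
-- the class is a coset of the stabilizer.
theorem sum_prod_stepWeight (hn : 1 ≤ n) {P : ℤ → SIdx n} (hP : IsCoxEnum P) {γ : G n}
    (hγ : ∀ k, P (k + 1) = γ.1 (P k)) (hfix : ∀ x, act γ x = x → x = 0)
    (hword : ∃ l : List (V n ≃ₗᵢ[ℝ] V n), (∀ t ∈ l, t ∈ reflections n) ∧ l.prod = act γ ∧
      l.length = n) :
    ∑ g, ∏ k ∈ Finset.range n, stepWeight P r k g =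
      ((chainStab r).card : ℤ[X]) * classGenFun (act γ) p := by
  classical
  have hiff := mapChain_mem_chainClass_iff hp h hr hn hP hγ hfix hword
  have e1 : ∀ g, ∏ k ∈ Finset.range n, stepWeight P r k g =
      if mapChain p g ∈ (chainClass_finite (act γ) p).toFinset then X ^ nir (mapChain p g)
        else 0 := by
    intro g
    by_cases h1 : mapChain p g ∈ (chainClass_finite (act γ) p).toFinset
    · rw [if_pos h1]
      rw [Set.Finite.mem_toFinset, hiff] at h1
      exact prod_stepWeight hp hr g h1
    · rw [if_neg h1]
      rw [Set.Finite.mem_toFinset, hiff] at h1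
      push Not at h1
      obtain ⟨k, hk, h2⟩ := h1
      exact Finset.prod_eq_zero (Finset.mem_range.2 hk) (if_neg h2)
  rw [Finset.sum_congr rfl fun g _ => e1 g, ← Finset.sum_filter, classGenFun, Finset.mul_sum,
    ← Finset.sum_fiberwise_of_maps_to (g := mapChain p) fun g hg => (Finset.mem_filter.1 hg).2]
  refine Finset.sum_congr rfl fun Ω hΩ => ?_
  rw [Finset.sum_congr rfl fun g hg => by rw [(Finset.mem_filter.1 hg).2], Finset.sum_const,
    nsmul_eq_mul]
  congr 2
  have hΩ' := (Set.Finite.mem_toFinset _).1 hΩ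
  obtain ⟨w, hw, hΩw⟩ := hΩ'.2
  rw [W_eq_range] at hw
  obtain ⟨g₀, rfl⟩ := hw
  have hΩ₀ : Ω = mapChain p g₀ := funext hΩw
  rw [← card_filter_smulRel_eq r g₀]
  congr 1
  ext g
  simp only [Finset.mem_filter, Finset.mem_univ, true_and]
  rw [← mapChain_eq_iff hp hr, ← hΩ₀]
  exact ⟨fun h => h.2, fun h => ⟨h ▸ hΩ, h⟩⟩

open Polynomial in
theorem classGenFun_mul_prod_symFactor (hn : 1 ≤ n) {P : ℤ → SIdx n} (hP : IsCoxEnum P) {γ : G n}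
    (hγ : ∀ k, P (k + 1) = γ.1 (P k)) (hfix : ∀ x, act γ x = x → x = 0)
    (hword : ∃ l : List (V n ≃ₗᵢ[ℝ] V n), (∀ t ∈ l, t ∈ reflections n) ∧ l.prod = act γ ∧
      l.length = n) :
    classGenFun (act γ) p * ∏ k ∈ Finset.range n, (symFactor b k : ℤ[X]) =
      ∏ k ∈ Finset.range n, (2 + X * (((b k).ncard : ℤ[X]) - 2)) := by
  classical
  have hex : ∀ k, ∃ M : ℕ, 0 < M ∧ ∀ (_ : k < n) (f : Set (SIdx n) → ℤ[X]) (g : G n),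
      ∑ t : classStab (h.part (k + 1)), f (smulSet (g * t) (S k)) =
        M * ∑ T : Set (SIdx n) with T ⊆ smulSet g (b k) ∧ T.ncard = (S k).ncard ∧
          ∀ x ∈ T, negIdx x ∉ T, f T := by
    intro k
    by_cases hk : k < n
    · obtain ⟨M, hM, hf⟩ := exists_sum_classStab (h.part (k + 1)) (h.piece k hk) ℤ[X]
      exact ⟨M, hM, fun _ => hf⟩
    · exact ⟨1, one_pos, fun h => (hk h).elim⟩
  choose M hM0 hM using hex
  have a1 := card_mul_sum_prod (fun k => classStab (h.part (k + 1))) (stepWeight P r)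
    (fun k => (M k : ℤ[X]) * (2 + X * (((b k).ncard : ℤ[X]) - 2))) n
    (fun k j hkj hj g t ht => stepWeight_mul h hkj hj g t ht)
    (fun k hk g hg => sum_stepWeight hn hP h hk (hM k hk) g hg)
  have a2 := card_mul_sum_prod (fun k => classStab (h.part (k + 1)))
    (fun k g => (if FixesPiece b S k g then 1 else 0 : ℤ[X]))
    (fun k => (M k : ℤ[X]) * (symFactor b k : ℤ[X])) n
    (fun k j hkj hj g t ht => by rw [if_congr (fixesPiece_mul h hkj hj g t ht) rfl rfl])
    (fun k hk g hg => sum_fixesPiece h hk (hM k hk) g hg)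
  rw [sum_prod_stepWeight hp h hr hn hP hγ hfix hword, Finset.prod_mul_distrib] at a1
  have e2 : ∑ g : G n, ∏ k ∈ Finset.range n, (if FixesPiece b S k g then 1 else 0 : ℤ[X]) =
      ((chainStab r).card : ℤ[X]) := by
    rw [chainStab, Finset.card_eq_sum_ones, Finset.sum_filter, Nat.cast_sum]
    refine Finset.sum_congr rfl fun g _ => ?_
    rw [Finset.prod_ite_zero]
    simp only [Finset.mem_range, Finset.prod_const_one, smulRel_eq_iff_fixesPiece h]
    split_ifs <;> simp
  rw [e2, Finset.prod_mul_distrib] at a2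
  have hG : (Fintype.card (G n) : ℤ[X]) ≠ 0 := Nat.cast_ne_zero.2 Fintype.card_ne_zero
  have hMne : ∏ k ∈ Finset.range n, (M k : ℤ[X]) ≠ 0 :=
    Finset.prod_ne_zero_iff.2 fun k _ => Nat.cast_ne_zero.2 (hM0 k).ne'
  -- The identity `a1` computes the order of the stabilizer times the generating function, and `a2`
  -- that order alone; eliminating it leaves only the common nonzero factors to cancel.
  refine mul_left_cancel₀ (mul_ne_zero hG hMne) ?_
  linear_combination a1 - classGenFun (act γ) p * a2

end

end
end TypeB

namespace TypeB
noncomputable section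

variable {n : ℕ}

/-! ### Inclusion of broken classes -/

/-- `c` or its opposite contains `d`. -/
def SubPair (d c : Set (SIdx n)) : Prop := d ⊆ c ∨ d ⊆ negBlock c

theorem negBlock_subset_iff {c d : Set (SIdx n)} : negBlock c ⊆ d ↔ c ⊆ negBlock d := by
  constructor
  · intro h x hx
    rw [mem_negBlock]
    exact h (by rwa [mem_negBlock, negIdx_negIdx])
  · intro h x hx
    have := h (mem_negBlock.1 hx)
    rwa [mem_negBlock, negIdx_negIdx] at this

theorem SubPair.refl (c : Set (SIdx n)) : SubPair c c := Or.inl subset_rfl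

theorem subPair_negBlock_right {c d : Set (SIdx n)} : SubPair d (negBlock c) ↔ SubPair d c := by
  rw [SubPair, SubPair, negBlock_negBlock, or_comm]

theorem subPair_negBlock_left {c d : Set (SIdx n)} : SubPair (negBlock d) c ↔ SubPair d c := by
  rw [SubPair, SubPair, negBlock_subset_iff, negBlock_subset_iff, negBlock_negBlock, or_comm]

theorem SubPair.trans {c d f : Set (SIdx n)} (h : SubPair c d) (h' : SubPair d f) :
    SubPair c f := by
  rcases h with h | h
  · exact h'.imp h.trans h.trans
  · have := subPair_negBlock_left.2 h'
    exact this.imp h.trans h.trans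

theorem subPair_iff {c d : Set (SIdx n)} :
    SubPair d c ↔ ∀ x ∈ ({d, negBlock d} : Set (Set (SIdx n))),
      ∃ y ∈ ({c, negBlock c} : Set (Set (SIdx n))), x ⊆ y := by
  constructor
  · rintro h x (rfl | rfl)
    · exact h.elim (fun h => ⟨c, by simp, h⟩) fun h => ⟨negBlock c, by simp, h⟩
    · exact (subPair_negBlock_left.2 h).elim (fun h => ⟨c, by simp, h⟩)
        fun h => ⟨negBlock c, by simp, h⟩
  · intro h
    obtain ⟨y, rfl | rfl, hy⟩ := h d (by simp)
    · exact Or.inl hy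
    · exact Or.inr hy

theorem subPair_of_mem {r r' : SIdx n → SIdx n → Prop} (hr : IsBPart r) (hr' : IsBPart r')
    (hle : ∀ x y, r x y → r' x y) {c d : Set (SIdx n)} (hd : IsCl r d) (hc : IsCl r' c)
    {x : SIdx n} (hxd : x ∈ d) (hxc : x ∈ c ∨ x ∈ negBlock c) : SubPair d c := by
  rcases hxc with hxc | hxc
  · left
    rw [hd.eq_of_mem hr hxd, hc.eq_of_mem hr' hxc]
    exact fun y => hle x y
  · right
    rw [hd.eq_of_mem hr hxd, (hc.negBlock hr').eq_of_mem hr' hxc]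
    exact fun y => hle x y

theorem SubPair.ncard_le {c d : Set (SIdx n)} (h : SubPair d c) : d.ncard ≤ c.ncard := by
  rcases h with h | h
  · exact Set.ncard_le_ncard h (Set.toFinite _)
  · rw [← ncard_negBlock c]
    exact Set.ncard_le_ncard h (Set.toFinite _)

theorem SubPair.mem {c d : Set (SIdx n)} (h : SubPair d c) {x : SIdx n} (hx : x ∈ d) :
    x ∈ c ∨ x ∈ negBlock c := h.imp (fun h => h hx) fun h => h hx

section

variable {r : ℕ → SIdx n → SIdx n → Prop} {b S : ℕ → Set (SIdx n)} (h : IsSplitChain r b S)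
include h

theorem IsSplitChain.isCl_b {k : ℕ} (hk : k < n) : IsCl (r (k + 1)) (b k) := (h.piece k hk).isClass

theorem IsSplitChain.not_isCl_b {k : ℕ} (hk : k < n) : ¬ IsCl (r k) (b k) := by
  rw [h.eq k hk]
  exact not_isCl_split (h.part (k + 1)) (h.piece k hk)

theorem IsSplitChain.b_nonempty {k : ℕ} (hk : k < n) : (b k).Nonempty :=
  (h.isCl_b hk).nonempty (h.part _)

/-- Were m ≤ u, all elements of b u would still be related in r u, although b u is broken there. -/
theorem IsSplitChain.lt_of_subPair {u m : ℕ} (hu : u < n) {c : Set (SIdx n)}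
    (hc : IsCl (r m) c) (hs : SubPair (b u) c) : u < m := by
  by_contra hlt
  have key : ∀ {c}, IsCl (r m) c → b u ⊆ c → False := by
    intro c hc hs
    obtain ⟨x, hx⟩ := h.b_nonempty hu
    refine h.not_isCl_b hu ⟨x, Set.Subset.antisymm (fun y hy => ?_) fun y hy => ?_⟩
    · exact h.mono (by omega) (by omega) (hc.rel (h.part m) (hs hx) (hs hy))
    · rw [(h.isCl_b hu).eq_of_mem (h.part _) hx]
      exact h.mono (Nat.le_succ u) (by omega) hy
  rcases hs with hs | hs
  · exact key hc hs
  · exact key (hc.negBlock (h.part m)) hs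

theorem IsSplitChain.le_of_subPair {u v : ℕ} (hu : u < n) (hv : v < n)
    (hs : SubPair (b u) (b v)) : u ≤ v :=
  Nat.lt_succ_iff.1 (h.lt_of_subPair hu (h.isCl_b hv) hs)

/-- Broken classes form a laminar family up to sign: two that contain a common one are nested. This
is what makes the containment order a tree. -/
theorem IsSplitChain.subPair_of_common {u v w : ℕ} (hvw : v ≤ w) (hu : u < n) (hw : w < n)
    (h1 : SubPair (b u) (b v)) (h2 : SubPair (b u) (b w)) : SubPair (b v) (b w) := by
  obtain ⟨x, hx⟩ := h.b_nonempty hu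
  have hle : ∀ x y, r (v + 1) x y → r (w + 1) x y := fun _ _ => h.mono (by omega) (by omega)
  rcases h1.mem hx with h3 | h3
  · exact subPair_of_mem (h.part _) (h.part _) hle (h.isCl_b (by omega)) (h.isCl_b hw) h3 (h2.mem hx)
  · exact subPair_negBlock_left.1 (subPair_of_mem (h.part _) (h.part _) hle
      ((h.isCl_b (by omega)).negBlock (h.part _)) (h.isCl_b hw) h3 (h2.mem hx))

theorem IsSplitChain.subPair_last {u v : ℕ} (hv : v + 1 = n) :
    SubPair (b u) (b v) := by
  obtain ⟨x, hx⟩ := h.b_nonempty (show v < n by omega)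
  left
  rw [(h.isCl_b (show v < n by omega)).eq_of_mem (h.part _) hx, hv]
  exact fun y _ => h.top _ _

/-- The class of `r v` containing a class broken before step `v` inside `b v`. -/
theorem IsSplitChain.exists_subPair {u v : ℕ} (huv : u < v) (hv : v < n)
    (hs : SubPair (b u) (b v)) : ∃ w, u ≤ w ∧ w < v ∧ SubPair (b u) (b w) ∧
      SubPair (b w) (b v) ∧ ((b w = S v ∨ b w = negBlock (S v)) ∨
        (b w = restOf (b v) (S v) ∨ b w = negBlock (restOf (b v) (S v)))) := by
  obtain ⟨x, hx⟩ := h.b_nonempty (show u < n by omega)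
  have hc : IsCl (r v) {y | r v x y} := ⟨x, rfl⟩
  have hxc : x ∈ {y | r v x y} := (h.part v).equiv.refl x
  have huc : SubPair (b u) {y | r v x y} := subPair_of_mem (h.part _) (h.part v)
    (fun _ _ => h.mono (by omega) (by omega)) (h.isCl_b (by omega)) hc hx (Or.inl hxc)
  have hcv : SubPair {y | r v x y} (b v) := subPair_of_mem (h.part v) (h.part (v + 1))
    (fun _ _ => h.mono (by omega) (by omega)) hc (h.isCl_b hv) hxc (hs.mem hx)
  have hc2 := (h.two_le_ncard_b (show u < n by omega)).trans huc.ncard_le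
  obtain ⟨w, hw, hcw⟩ := h.exists_eq_of_isCl hv.le hc hc2
  have hcases := isCl_split_cases (h.part (v + 1)) (h.piece v hv) (h.eq v hv ▸ hc)
  rw [← h.eq v hv] at hcases
  generalize {y | r v x y} = c at *
  have hne : ¬ (IsCl (r (v + 1)) c ∧ c ≠ b v ∧ c ≠ negBlock (b v)) := by
    rintro ⟨h1, h2, h3⟩
    rcases hcv.mem hxc with h4 | h4
    · exact h2 (h1.eq_of_inter (h.part _) (h.isCl_b hv) hxc h4)
    · exact h3 (h1.eq_of_inter (h.part _) ((h.isCl_b hv).negBlock (h.part _)) hxc h4)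
  have huw : SubPair (b u) (b w) := by
    rcases hcw with rfl | rfl
    · exact huc
    · exact subPair_negBlock_right.1 huc
  refine ⟨w, h.le_of_subPair (by omega) (by omega) huw, hw, huw, ?_, ?_⟩
  · rcases hcw with rfl | rfl
    · exact hcv
    · exact subPair_negBlock_left.1 hcv
  · rcases hcw with rfl | rfl
    · tauto
    · rw [← (negBlock_injective (n := n)).eq_iff, ← (negBlock_injective (n := n)).eq_iff (a := b w) (b := negBlock (S v)),
        ← (negBlock_injective (n := n)).eq_iff (a := b w) (b := restOf _ _),
        ← (negBlock_injective (n := n)).eq_iff (a := b w) (b := negBlock (restOf _ _)),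
        negBlock_negBlock, negBlock_negBlock]
      tauto

omit h in
theorem restOf_ssubset {r : SIdx n → SIdx n → Prop} {b S : Set (SIdx n)} (h : IsPiece r b S) :
    restOf b S ⊂ b := by
  refine ⟨Set.sdiff_subset, fun h' => ?_⟩
  obtain ⟨x, hx⟩ := h.nonempty
  exact (h' (h.subset hx)).2 (Or.inl hx)

/-! ### Hook lengths -/

omit h in
/-- The number of broken classes contained in `c` up to sign. -/
def numBroken (b : ℕ → Set (SIdx n)) (c : Set (SIdx n)) : ℕ :=
  {u : Fin n | SubPair (b u) c}.ncard

theorem setOf_subPair_b {m : ℕ} (hm : m < n) :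
    {u : Fin n | SubPair (b u) (b m)} = insert ⟨m, hm⟩ ({u : Fin n | SubPair (b u) (S m)} ∪
      {u : Fin n | SubPair (b u) (restOf (b m) (S m))}) := by
  have hp := h.piece m hm
  ext u
  simp only [Set.mem_ofPred_eq, Set.mem_insert_iff, Set.mem_union]
  constructor
  · intro hs
    rcases (h.le_of_subPair u.2 hm hs).lt_or_eq with h1 | h1
    · right
      obtain ⟨w, -, -, h2, -, h3⟩ := h.exists_subPair h1 hm hs
      rcases h3 with (h3 | h3) | (h3 | h3) <;> rw [h3] at h2
      · exact Or.inl h2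
      · exact Or.inl (subPair_negBlock_right.1 h2)
      · exact Or.inr h2
      · exact Or.inr (subPair_negBlock_right.1 h2)
    · exact Or.inl (Fin.ext h1)
  · rintro (rfl | h1 | h1)
    · exact SubPair.refl _
    · exact h1.trans (Or.inl hp.subset)
    · exact h1.trans (Or.inl Set.sdiff_subset)

theorem numBroken_b {m : ℕ} (hm : m < n) :
    numBroken b (b m) = 1 + numBroken b (S m) + numBroken b (restOf (b m) (S m)) := by
  have hp := h.piece m hm
  rw [numBroken, setOf_subPair_b h hm, Set.ncard_insert_of_notMem _ (Set.toFinite _),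
    Set.ncard_union_eq _ (Set.toFinite _) (Set.toFinite _), numBroken, numBroken]
  · ring
  · rw [Set.disjoint_left]
    intro u h1 h2
    obtain ⟨x, hx⟩ := h.b_nonempty u.2
    have h3 := SubPair.mem h1 hx
    have h4 := SubPair.mem h2 hx
    rw [negBlock_restOf] at h4
    rcases h4 with h4 | h4 <;> exact h4.2 h3
  · rintro (h1 | h1)
    · exact absurd (SubPair.ncard_le h1) (not_le.2 hp.ncard_lt)
    · exact absurd (SubPair.ncard_le h1)
        (not_le.2 (Set.ncard_lt_ncard (restOf_ssubset hp) (Set.toFinite _)))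

omit h in
theorem numBroken_negBlock (b : ℕ → Set (SIdx n)) (c : Set (SIdx n)) :
    numBroken b (negBlock c) = numBroken b c := by
  simp only [numBroken, subPair_negBlock_right]

theorem isCl_restOf {m : ℕ} (hm : m < n) (hne : (restOf (b m) (S m)).Nonempty) :
    IsCl (r m) (restOf (b m) (S m)) := by
  have hp := h.piece m hm
  obtain ⟨a, ha⟩ := hne
  refine ⟨a, ?_⟩
  rw [h.eq m hm, (h.isCl_b hm).eq_of_mem (h.part _) ha.1]
  have h1 := ha.2
  ext x
  simp only [restOf, Set.mem_sdiff, Set.mem_ofPred_eq, Set.mem_union, mem_negBlock, split] at h1 ⊢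
  tauto

/-- Breaking b yields the count 1 + N(S) + N(rest). An ordinary class satisfies N = size - 1, and
|b| = |S| + |rest| preserves this. A zero class satisfies N = size / 2, since 1 + (|S| - 1) + (|b| -
2|S|)/2 = |b|/2. -/
theorem numBroken_isCl {m : ℕ} (hm : m ≤ n) {c : Set (SIdx n)} (hc : IsCl (r m) c) :
    (negBlock c = c → 2 * numBroken b c = c.ncard) ∧
      (negBlock c ≠ c → numBroken b c + 1 = c.ncard) := by
  induction m generalizing c with
  | zero =>
    obtain ⟨a, rfl⟩ := hc
    have h1 : {x | r 0 a x} = {a} := by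
      ext x
      exact ⟨fun hx => (h.bot _ _ hx).symm, fun hx => by
        rw [Set.mem_singleton_iff.1 hx]; exact (h.part 0).equiv.refl a⟩
    rw [h1]
    have h2 : numBroken b {a} = 0 := by
      rw [numBroken, Set.ncard_eq_zero (Set.toFinite _), Set.eq_empty_iff_forall_notMem]
      intro u hu
      have h3 := SubPair.ncard_le hu
      rw [Set.ncard_singleton] at h3
      have := h.two_le_ncard_b u.2
      omega
    refine ⟨fun h3 => ?_, fun _ => by rw [h2, Set.ncard_singleton]⟩
    have h4 : negIdx a ∈ ({a} : Set (SIdx n)) := by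
      rw [← mem_negBlock, h3]; rfl
    exact (negIdx_ne a h4).elim
  | succ m ih =>
    by_cases h1 : c = b m ∨ c = negBlock (b m)
    · wlog h2 : c = b m generalizing c
      · have h3 := this (c := negBlock c) (hc.negBlock (h.part _))
          (by rcases h1 with rfl | rfl <;> simp [negBlock_negBlock])
          (by rcases h1 with rfl | rfl
              · exact (h2 rfl).elim
              · rw [negBlock_negBlock])
        rw [negBlock_negBlock, numBroken_negBlock, ncard_negBlock] at h3
        exact ⟨fun h4 => h3.1 h4.symm, fun h4 => h3.2 (Ne.symm h4)⟩
      subst h2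
      have hp := h.piece m (by omega)
      have hS := (ih (by omega) (h.cls m (by omega))).2 (by
        intro h3
        obtain ⟨x, hx⟩ := hp.nonempty
        refine hp.neg x hx ?_
        rw [← mem_negBlock, h3]
        exact hx)
      have hrest : negBlock (restOf (b m) (S m)) = restOf (negBlock (b m)) (S m) :=
        negBlock_restOf _ _
      have hempty : restOf (b m) (S m) = ∅ → numBroken b (restOf (b m) (S m)) = 0 ∧
          (restOf (b m) (S m)).ncard = 0 := by
        intro h3
        rw [h3, Set.ncard_empty, numBroken, Set.ncard_eq_zero (Set.toFinite _),
          Set.eq_empty_iff_forall_notMem]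
        refine ⟨fun u hu => ?_, rfl⟩
        have h3 := SubPair.ncard_le hu
        rw [Set.ncard_empty] at h3
        have := h.two_le_ncard_b u.2
        omega
      have hsum := numBroken_b h (show m < n by omega)
      constructor
      · intro hz
        rw [hz] at hrest
        have h3 : 2 * numBroken b (restOf (b m) (S m)) = (restOf (b m) (S m)).ncard := by
          rcases (restOf (b m) (S m)).eq_empty_or_nonempty with h4 | h4
          · have := hempty h4
            omega
          · exact (ih (by omega) (isCl_restOf h (by omega) h4)).1 hrest
        have h4 : negBlock (S m) ⊆ b m := by
          rw [← hz]
          exact Set.image_mono hp.subset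
        have h5 := Set.ncard_sdiff_add_ncard_of_subset (Set.union_subset hp.subset h4) (Set.toFinite _)
        have h6 : Disjoint (S m) (negBlock (S m)) :=
          Set.disjoint_left.2 fun x hx hx' => hp.neg x hx (mem_negBlock.1 hx')
        rw [Set.ncard_union_eq h6 (Set.toFinite _) (Set.toFinite _), ncard_negBlock] at h5
        rw [restOf] at *
        omega
      · intro hz
        have hdis : ∀ x ∈ b m, x ∉ negBlock (b m) := fun x hx hx' =>
          hz ((hc.negBlock (h.part _)).eq_of_inter (h.part _) hc hx' hx)
        have h7 : restOf (b m) (S m) = b m \ S m := by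
          ext x
          simp only [restOf, Set.mem_sdiff, Set.mem_union, not_or]
          refine ⟨fun h => ⟨h.1, h.2.1⟩, fun h => ⟨h.1, h.2, fun h' => ?_⟩⟩
          exact hdis x h.1 (Set.image_mono hp.subset h')
        have h4 : (restOf (b m) (S m)).Nonempty := by
          rw [h7]
          exact Set.exists_of_ssubset (hp.subset.ssubset_of_ne hp.ne)
        have h3 := (ih (by omega) (isCl_restOf h (by omega) h4)).2 (by
          intro h8
          obtain ⟨x, hx⟩ := h4
          have h9 := hx
          rw [← h8, hrest] at h9
          exact hdis x hx.1 h9.1)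
        have h5 := Set.ncard_sdiff_add_ncard_of_subset hp.subset (Set.toFinite _)
        rw [h7] at h3 hsum
        omega
    · rw [not_or] at h1
      have h2 := isCl_split_of_ne (h.part (m + 1)) (h.piece m (by omega)) hc h1.1 h1.2
      rw [← h.eq m (by omega)] at h2
      exact ih (by omega) h2

/-! ### The zero class -/

theorem negBlock_b_eq_of_zero_birth {k : ℕ} (hk : k < n) {x : SIdx n}
    (hx : r (k + 1) x (negIdx x)) (hno : ∀ y, ¬ r k y (negIdx y)) : negBlock (b k) = b k := by
  have hr := h.part (k + 1)
  have hc : IsCl (r (k + 1)) {y | r (k + 1) x y} := ⟨x, rfl⟩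
  have hz := negBlock_eq_of_mem hr hc (hr.equiv.refl x) hx
  by_cases h1 : {y | r (k + 1) x y} = b k
  · rwa [h1] at hz
  by_cases h2 : {y | r (k + 1) x y} = negBlock (b k)
  · rw [h2, negBlock_negBlock] at hz
    exact hz.symm
  have h3 := isCl_split_of_ne hr (h.piece k hk) hc h1 h2
  rw [← h.eq k hk] at h3
  exact (hno x (h3.rel (h.part k) (hr.equiv.refl x) hx)).elim

theorem restOf_eq_empty_of_zero_birth {k : ℕ} (hk : k < n) (hz : negBlock (b k) = b k)
    (hno : ∀ y, ¬ r k y (negIdx y)) : restOf (b k) (S k) = ∅ := by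
  by_contra hne
  obtain ⟨y, hy⟩ := Set.nonempty_iff_ne_empty.2 hne
  have h1 := isCl_restOf h hk ⟨y, hy⟩
  have h2 : negIdx y ∈ restOf (b k) (S k) := by
    rw [← mem_negBlock, negBlock_restOf, hz]
    exact hy
  exact hno y (h1.rel (h.part k) hy h2)

/-- Each partition has at most one zero class and these grow along the chain. Hence the ancestors of
the vertex where the zero block is born are exactly the vertices representing zero blocks. -/
theorem subPair_zero_birth_iff {k v : ℕ} (hk : k < n) (hv : v < n) {x : SIdx n}
    (hx : r (k + 1) x (negIdx x)) (hno : ∀ y, ¬ r k y (negIdx y)) :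
    SubPair (b k) (b v) ↔ negBlock (b v) = b v := by
  have hz := negBlock_b_eq_of_zero_birth h hk hx hno
  obtain ⟨y, hy⟩ := h.b_nonempty hk
  have hy' : negIdx y ∈ b k := by rwa [← mem_negBlock, hz]
  constructor
  · rintro (hs | hs)
    · exact negBlock_eq_of_mem (h.part _) (h.isCl_b hv) (hs hy) (hs hy')
    · have := negBlock_eq_of_mem (h.part _) ((h.isCl_b hv).negBlock (h.part _)) (hs hy) (hs hy')
      rw [negBlock_negBlock] at this
      exact this.symm
  · intro hv'
    obtain ⟨z, hz'⟩ := h.b_nonempty hv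
    have h1 : r (v + 1) z (negIdx z) := (h.isCl_b hv).rel (h.part _) hz' (by
      rwa [← mem_negBlock, hv'])
    have hkv : k ≤ v := by
      by_contra hlt
      exact hno z (h.mono (by omega) (by omega) h1)
    left
    intro w hw
    have h2 : r (v + 1) w (negIdx w) := h.mono (show k + 1 ≤ v + 1 by omega) (by omega)
      ((h.isCl_b hk).rel (h.part _) hw (by rwa [← mem_negBlock, hz]))
    rw [(h.isCl_b hv).eq_of_mem (h.part _) hz']
    exact (h.part _).zero _ _ h1 h2

theorem exists_zero_birth (hn : 1 ≤ n) :
    ∃ k < n, (∃ x, r (k + 1) x (negIdx x)) ∧ ∀ y, ¬ r k y (negIdx y) := by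
  classical
  have hex : ∃ m, ∃ x, r m x (negIdx x) := ⟨n, (⟨0, by omega⟩, 1), h.top _ _⟩
  have hle : Nat.find hex ≤ n := Nat.find_min' hex ⟨(⟨0, by omega⟩, 1), h.top _ _⟩
  have hpos : Nat.find hex ≠ 0 := by
    intro h0
    obtain ⟨x, hx⟩ := Nat.find_spec hex
    rw [h0] at hx
    exact negIdx_ne x (h.bot _ _ hx).symm
  refine ⟨Nat.find hex - 1, by omega, ?_, ?_⟩
  · rw [Nat.sub_add_cancel (by omega)]
    exact Nat.find_spec hex
  · intro y hy
    exact Nat.find_min hex (show Nat.find hex - 1 < Nat.find hex by omega) ⟨y, hy⟩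

end

end
end TypeB

namespace TypeB
noncomputable section

variable {n : ℕ}

/-! ### The tree of a chain -/

open Classical in
/-- The least later step whose broken class contains the class broken at step `u`. -/
def chainParent (b : ℕ → Set (SIdx n)) (u : Fin n) : Option (Fin n) :=
  if hne : (Finset.univ.filter fun v : Fin n => u < v ∧ SubPair (b u) (b v)).Nonempty then
    some (Finset.min' _ hne) else none

theorem chainParent_eq_some_iff {b : ℕ → Set (SIdx n)} {u v : Fin n} :
    chainParent b u = some v ↔ (u < v ∧ SubPair (b u) (b v)) ∧
      ∀ w : Fin n, u < w → SubPair (b u) (b w) → v ≤ w := by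
  classical
  unfold chainParent
  constructor
  · intro h
    split_ifs at h with hne
    rw [Option.some.injEq] at h
    subst h
    refine ⟨(Finset.mem_filter.1 (Finset.min'_mem _ hne)).2, fun w hw hw' => ?_⟩
    exact Finset.min'_le _ _ (Finset.mem_filter.2 ⟨Finset.mem_univ _, hw, hw'⟩)
  · rintro ⟨h1, h2⟩
    have hne : (Finset.univ.filter fun v : Fin n => u < v ∧ SubPair (b u) (b v)).Nonempty :=
      ⟨v, Finset.mem_filter.2 ⟨Finset.mem_univ _, h1⟩⟩
    rw [dif_pos hne, Option.some.injEq]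
    refine le_antisymm (Finset.min'_le _ v (Finset.mem_filter.2 ⟨Finset.mem_univ v, h1⟩)) ?_
    have := (Finset.mem_filter.1 (Finset.min'_mem _ hne)).2
    exact h2 _ this.1 this.2

theorem chainParent_eq_none_iff {b : ℕ → Set (SIdx n)} {u : Fin n} :
    chainParent b u = none ↔ ∀ w : Fin n, u < w → ¬ SubPair (b u) (b w) := by
  classical
  unfold chainParent
  split_ifs with hne
  · obtain ⟨w, hw⟩ := hne
    rw [Finset.mem_filter] at hw
    simp only [false_iff, not_forall, not_not]
    exact ⟨w, hw.2.1, hw.2.2⟩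
  · simp only [true_iff]
    intro w hw hw'
    exact hne ⟨w, Finset.mem_filter.2 ⟨Finset.mem_univ _, hw, hw'⟩⟩

section

variable {r : ℕ → SIdx n → SIdx n → Prop} {b S : ℕ → Set (SIdx n)} (h : IsSplitChain r b S)
include h

theorem eq_or_negBlock_of_chainParent {u v : Fin n} (huv : chainParent b u = some v) :
    (b u = S v ∨ b u = negBlock (S v)) ∨
      (b u = restOf (b v) (S v) ∨ b u = negBlock (restOf (b v) (S v))) := by
  obtain ⟨⟨h1, h2⟩, h3⟩ := chainParent_eq_some_iff.1 huv
  obtain ⟨w, huw, hwv, h4, -, h5⟩ := h.exists_subPair h1 v.2 h2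
  rcases huw.lt_or_eq with h6 | h6
  · have := h3 ⟨w, by omega⟩ h6 h4
    rw [Fin.le_def] at this
    exact absurd hwv (not_lt.2 this)
  · rwa [h6]

theorem eq_of_subPair_of_subPair {u v : Fin n} (h1 : SubPair (b u) (b v))
    (h2 : SubPair (b v) (b u)) : u = v :=
  le_antisymm (h.le_of_subPair u.2 v.2 h1) (h.le_of_subPair v.2 u.2 h2)

theorem eq_of_subPair_left {u v : Fin n} {c : Set (SIdx n)} (h1 : b u = c ∨ b u = negBlock c)
    (h2 : b v = c ∨ b v = negBlock c) : u = v := by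
  have h3 : SubPair (b u) (b v) ∧ SubPair (b v) (b u) := by
    rcases h1 with h1 | h1 <;> rcases h2 with h2 | h2 <;> rw [h1, h2]
    · exact ⟨SubPair.refl _, SubPair.refl _⟩
    · exact ⟨subPair_negBlock_right.2 (SubPair.refl _), subPair_negBlock_left.2 (SubPair.refl _)⟩
    · exact ⟨subPair_negBlock_left.2 (SubPair.refl _), subPair_negBlock_right.2 (SubPair.refl _)⟩
    · exact ⟨SubPair.refl _, SubPair.refl _⟩
  exact eq_of_subPair_of_subPair h h3.1 h3.2

theorem ncard_eq_or_negBlock_le_one (c : Set (SIdx n)) :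
    {u : Fin n | b u = c ∨ b u = negBlock c}.ncard ≤ 1 := by
  rw [Set.ncard_le_one (Set.toFinite _)]
  exact fun u hu v hv => eq_of_subPair_left h hu hv

theorem sons_subset (v : Fin n) : {u | chainParent b u = some v} ⊆
    {u : Fin n | b u = S v ∨ b u = negBlock (S v)} ∪
      {u : Fin n | b u = restOf (b v) (S v) ∨ b u = negBlock (restOf (b v) (S v))} :=
  fun _ hu => eq_or_negBlock_of_chainParent h hu

/-- The pointed André tree of a chain. -/
def chainTree (hn : 1 ≤ n) : PointedAndreTree n where
  parent := chainParent b
  pt := ⟨(exists_zero_birth h hn).choose, (exists_zero_birth h hn).choose_spec.1⟩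
  existsUnique_root := by
    refine ⟨⟨n - 1, by omega⟩, ?_, fun u hu => ?_⟩
    · refine chainParent_eq_none_iff.2 ?_
      intro w hw
      rw [Fin.lt_def] at hw
      have := w.2
      simp only at hw
      omega
    · by_contra hne
      have h1 : u < ⟨n - 1, by omega⟩ := by
        rw [Fin.lt_def]
        have := u.2
        have h2 : u.val ≠ n - 1 := fun h => hne (Fin.ext h)
        simp only
        omega
      exact chainParent_eq_none_iff.1 hu _ h1 (h.subPair_last (show n - 1 + 1 = n by omega))
  lt_of_parent u v huv := (chainParent_eq_some_iff.1 huv).1.1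
  sons_le_two v := by
    refine (Set.ncard_le_ncard (sons_subset h v) (Set.toFinite _)).trans
      ((Set.ncard_union_le _ _).trans ?_)
    have h1 := ncard_eq_or_negBlock_le_one h (S v)
    have h2 := ncard_eq_or_negBlock_le_one h (restOf (b v) (S v))
    omega
  -- When the zero block is born it is the union of the piece and its opposite, so nothing remains
  -- for a second son.
  pt_sons_le_one := by
    obtain ⟨hk, ⟨x, hx⟩, hno⟩ := (exists_zero_birth h hn).choose_spec
    have hz := negBlock_b_eq_of_zero_birth h hk hx hno
    have he := restOf_eq_empty_of_zero_birth h hk hz hno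
    refine (Set.ncard_le_ncard (fun u hu => ?_) (Set.toFinite _)).trans
      (ncard_eq_or_negBlock_le_one h (S (exists_zero_birth h hn).choose))
    rcases eq_or_negBlock_of_chainParent h hu with h1 | h1
    · exact h1
    · simp only [he] at h1
      have h2 : negBlock (∅ : Set (SIdx n)) = ∅ := Set.image_empty _
      rw [h2, or_self] at h1
      exact ((h.b_nonempty u.2).ne_empty h1).elim

/-- By laminarity the least class containing b u is contained in every other broken class containing
b u and born later than b u, so climbing from parent to parent reaches any prescribed container. -/
theorem chainTree_below_iff (hn : 1 ≤ n) {u v : Fin n} :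
    (chainTree h hn).Below u v ↔ SubPair (b u) (b v) := by
  constructor
  · intro huv
    induction huv with
    | refl => exact SubPair.refl _
    | tail _ h1 ih => exact ih.trans (chainParent_eq_some_iff.1 h1).1.2
  · intro huv
    induction hd : n - u.val using Nat.strong_induction_on generalizing u with
    | _ d ih =>
      rcases (show u ≤ v from h.le_of_subPair u.2 v.2 huv).lt_or_eq with h1 | rfl
      · obtain ⟨w, hw⟩ : ∃ w, chainParent b u = some w := by
          rw [← Option.ne_none_iff_exists']
          intro h2
          exact chainParent_eq_none_iff.1 h2 v h1 huv
        have h2 := chainParent_eq_some_iff.1 hw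
        have h3 := h.subPair_of_common (h2.2 v h1 huv) u.2 v.2 h2.1.2 huv
        have h4 := h2.1.1
        rw [Fin.lt_def] at h4
        have := u.2
        exact Relation.ReflTransGen.head hw (ih _ (by omega) h3 rfl)
      · exact Relation.ReflTransGen.refl

end

theorem simpleRoot_mem_posRoots (i : Fin n) : simpleRoot i ∈ posRoots n := by
  unfold simpleRoot
  split_ifs with hi
  · exact Or.inl ⟨i, rfl⟩
  · exact Or.inr ⟨⟨i.val - 1, by omega⟩, i, by rw [Fin.lt_def]; simp only; omega, Or.inl rfl⟩

/-! ### Stanley images -/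

theorem isBlock_iff {π : Submodule ℝ (V n)} {c : Set (SIdx n)} : IsBlock π c ↔ IsCl (rel π) c := by
  refine exists_congr fun a => ?_
  have : {a' | ∀ x ∈ π, coord a' x = coord a x} = {x | rel π a x} := by
    ext y
    exact forall₂_congr fun x _ => eq_comm
  rw [this]

/-- A zero block contains some x together with -x, so the size condition covers it too. -/
theorem isVertexBlock_iff {π : Submodule ℝ (V n)} {C : Set (Set (SIdx n))} :
    IsVertexBlock π C ↔ ∃ c, IsCl (rel π) c ∧ C = {c, negBlock c} ∧ 2 ≤ c.ncard := by
  refine exists_congr fun c => ?_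
  rw [isBlock_iff]
  refine and_congr_right fun hc => and_congr_right fun _ => or_iff_right_of_imp fun hz => ?_
  obtain ⟨x, hx⟩ := hc.nonempty (isBPart_rel π)
  have hx' : negIdx x ∈ c := by rwa [← mem_negBlock, hz]
  rw [← Set.ncard_pair (negIdx_ne x)]
  exact Set.ncard_le_ncard (Set.insert_subset hx' (Set.singleton_subset_iff.2 hx)) (Set.toFinite _)

theorem hasZeroBlock_iff {π : Submodule ℝ (V n)} :
    HasZeroBlock π ↔ ∃ x, rel π x (negIdx x) := by
  constructor
  · rintro ⟨c, hc, hz⟩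
    rw [isBlock_iff] at hc
    obtain ⟨x, hx⟩ := hc.nonempty (isBPart_rel π)
    exact ⟨x, hc.rel (isBPart_rel π) hx (by rwa [← mem_negBlock, hz])⟩
  · rintro ⟨x, hx⟩
    have hc : IsCl (rel π) {y | rel π x y} := ⟨x, rfl⟩
    exact ⟨_, isBlock_iff.2 hc,
      negBlock_eq_of_mem (isBPart_rel π) hc ((isBPart_rel π).equiv.refl x) hx⟩

theorem pair_eq_pair_iff {c d : Set (SIdx n)} :
    ({c, negBlock c} : Set (Set (SIdx n))) = {d, negBlock d} ↔ c = d ∨ c = negBlock d := by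
  constructor
  · intro h
    have : c ∈ ({d, negBlock d} : Set (Set (SIdx n))) := h ▸ Set.mem_insert _ _
    simpa using this
  · rintro (rfl | rfl)
    · rfl
    · rw [negBlock_negBlock, Set.pair_comm]

theorem PointedAndreTree.Below.le {T : PointedAndreTree n} {u v : Fin n} (h : T.Below u v) :
    u ≤ v := by
  induction h with
  | refl => exact le_rfl
  | tail _ h1 ih => exact ih.trans (T.lt_of_parent _ _ h1).le

/-- The parent is read off the order `Below` as the least strict ancestor. So the order and the
distinguished vertex determine the tree, which gives the uniqueness of the Stanley image. -/
theorem PointedAndreTree.parent_eq_some_iff (T : PointedAndreTree n) {u v : Fin n} :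
    T.parent u = some v ↔ u ≠ v ∧ T.Below u v ∧ ∀ w, T.Below u w → w ≠ u → T.Below v w := by
  constructor
  · intro h
    refine ⟨(T.lt_of_parent _ _ h).ne, Relation.ReflTransGen.single h, fun w hw hne => ?_⟩
    rcases hw.cases_head with h1 | ⟨x, hx, h1⟩
    · exact (hne h1.symm).elim
    · rw [h, Option.some.injEq] at hx
      exact hx ▸ h1
  · rintro ⟨hne, huv, hmin⟩
    rcases huv.cases_head with h1 | ⟨x, hx, h1⟩
    · exact (hne h1).elim
    · have h2 := hmin x (Relation.ReflTransGen.single hx) (T.lt_of_parent _ _ hx).ne'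
      have h3 : x ≤ v := PointedAndreTree.Below.le h1
      rw [hx, le_antisymm h3 (PointedAndreTree.Below.le h2)]

theorem PointedAndreTree.eq_of_below_iff {T T' : PointedAndreTree n}
    (h : ∀ u v, T.Below u v ↔ T'.Below u v) (hpt : T.pt = T'.pt) : T = T' := by
  refine PointedAndreTree.ext (funext fun u => Option.ext fun v => ?_) hpt
  rw [T.parent_eq_some_iff, T'.parent_eq_some_iff]
  simp only [h]

section

variable {p : Fin (n + 1) → Submodule ℝ (V n)}
  {r : ℕ → SIdx n → SIdx n → Prop} {b S : ℕ → Set (SIdx n)} (h : IsSplitChain r b S)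
  (hr : ∀ k (hk : k < n + 1), r k = rel (p ⟨k, hk⟩))
include h hr

theorem vertexBlock_birth_iff (i : Fin n) (C : Set (Set (SIdx n))) :
    (IsVertexBlock (p i.succ) C ∧ ¬ IsVertexBlock (p i.castSucc) C) ↔
      C = {b i, negBlock (b i)} := by
  have h1 : rel (p i.castSucc) = r i := (hr i (by omega)).symm
  have h2 : rel (p i.succ) = r (i + 1) := (hr (i + 1) (by omega)).symm
  rw [isVertexBlock_iff, isVertexBlock_iff, h1, h2]
  constructor
  · rintro ⟨⟨c, hc, rfl, hc2⟩, hno⟩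
    rw [pair_eq_pair_iff]
    by_contra hcon
    rw [not_or] at hcon
    refine hno ⟨c, ?_, rfl, hc2⟩
    rw [h.eq i i.2]
    exact isCl_split_of_ne (h.part _) (h.piece i i.2) hc hcon.1 hcon.2
  · rintro rfl
    refine ⟨⟨b i, h.isCl_b i.2, rfl, h.two_le_ncard_b i.2⟩, ?_⟩
    rintro ⟨c, hc, h3, -⟩
    rw [pair_eq_pair_iff] at h3
    rcases h3 with h3 | h3
    · exact h.not_isCl_b i.2 (h3 ▸ hc)
    · exact h.not_isCl_b i.2 (h3 ▸ hc.negBlock (h.part _))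

omit h in
theorem zeroBlock_birth_iff (i : Fin n) :
    (HasZeroBlock (p i.succ) ∧ ¬ HasZeroBlock (p i.castSucc)) ↔
      (∃ x, r (i + 1) x (negIdx x)) ∧ ∀ y, ¬ r i y (negIdx y) := by
  have h1 : rel (p i.castSucc) = r i := (hr i (by omega)).symm
  have h2 : rel (p i.succ) = r (i + 1) := (hr (i + 1) (by omega)).symm
  rw [hasZeroBlock_iff, hasZeroBlock_iff, h1, h2, not_exists]

theorem isStanleyImage_iff {T : PointedAndreTree n} : IsStanleyImage p T ↔
    (∀ u v : Fin n, T.Below u v ↔ SubPair (b u) (b v)) ∧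
      ∀ i : Fin n, i = T.pt ↔ (∃ x, r (i + 1) x (negIdx x)) ∧ ∀ y, ¬ r i y (negIdx y) := by
  constructor
  · rintro ⟨B, h1, h2, h3⟩
    have hB : ∀ i, B i = {b i, negBlock (b i)} := fun i =>
      (vertexBlock_birth_iff h hr i _).1 ((h1 i _).2 rfl)
    refine ⟨fun u v => ?_, fun i => by rw [h3, zeroBlock_birth_iff hr]⟩
    rw [h2, hB, hB, subPair_iff]
  · rintro ⟨h2, h3⟩
    refine ⟨fun i => {b i, negBlock (b i)}, vertexBlock_birth_iff h hr, fun u v => ?_, fun i => ?_⟩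
    · rw [h2, subPair_iff]
    · rw [h3, zeroBlock_birth_iff hr]

theorem isStanleyImage_chainTree (hn : 1 ≤ n) : IsStanleyImage p (chainTree h hn) := by
  rw [isStanleyImage_iff h hr]
  refine ⟨fun u v => chainTree_below_iff h hn, fun i => ?_⟩
  obtain ⟨hk, hx, hno⟩ := (exists_zero_birth h hn).choose_spec
  constructor
  · rintro rfl
    exact ⟨hx, hno⟩
  · rintro ⟨⟨y, hy⟩, hno'⟩
    obtain ⟨x, hx⟩ := hx
    refine Fin.ext (le_antisymm ?_ ?_)
    · by_contra hlt
      have : (exists_zero_birth h hn).choose < i.val := not_le.1 hlt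
      exact hno' x (h.mono (by omega) (by omega) hx)
    · by_contra hlt
      have : i.val < (exists_zero_birth h hn).choose := not_le.1 hlt
      exact hno y (h.mono (by omega) (by omega) hy)

theorem existsUnique_isStanleyImage (hn : 1 ≤ n) : ∃! T, IsStanleyImage p T := by
  refine ⟨chainTree h hn, isStanleyImage_chainTree h hr hn, fun T hT => ?_⟩
  replace hT := (isStanleyImage_iff h hr).1 hT
  have h1 := (isStanleyImage_iff h hr).1 (isStanleyImage_chainTree h hr hn)
  refine PointedAndreTree.eq_of_below_iff (fun u v => (hT.1 u v).trans (h1.1 u v).symm) ?_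
  exact (h1.2 _).2 ((hT.2 _).1 rfl)

open Polynomial in
open Classical in
-- With hook length h, a zero block has 2h elements and factor 2, so 2 + q(2h - 2) = 2(1 + q(h -
-- 1)). Any other class has h + 1 elements and gives 2 + q(h - 1) with factor 1, except that at h =
-- 1 it is a pair and the value 2 is entirely absorbed by the factor.
theorem symFactor_mul_beta {T : PointedAndreTree n} (hT : IsStanleyImage p T) (v : Fin n) :
    2 + X * (((b v).ncard : ℤ[X]) - 2) =
      (symFactor b v : ℤ[X]) * if T.hook v ≠ 1 then T.beta v else 1 := by
  rw [isStanleyImage_iff h hr] at hT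
  obtain ⟨⟨x, hx⟩, hno⟩ := (hT.2 _).1 rfl
  have hhook : T.hook v = numBroken b (b v) := by
    unfold PointedAndreTree.hook numBroken
    simp only [hT.1]
  have hbelow : T.Below T.pt v ↔ negBlock (b v) = b v := by
    rw [hT.1]
    exact subPair_zero_birth_iff h T.pt.2 v.2 hx hno
  have hcard := numBroken_isCl h (show v.val + 1 ≤ n by omega) (h.isCl_b v.2)
  rw [← hhook] at hcard
  unfold PointedAndreTree.beta symFactor
  rw [if_congr hbelow rfl rfl]
  by_cases hz : negBlock (b v) = b v
  · have h1 := hcard.1 hz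
    rw [if_pos (Or.inl hz), if_pos hz, ← h1]
    split_ifs with h2
    · push_cast
      ring
    · rw [not_not] at h2
      rw [h2]
      push_cast
      ring
  · have h1 := hcard.2 hz
    rw [if_neg hz, ← h1]
    by_cases h2 : T.hook v = 1
    · rw [if_pos (Or.inr (by omega)), if_neg (not_not.2 h2), h2]
      push_cast
      ring
    · rw [if_neg (show ¬ (negBlock (b v) = b v ∨ T.hook v + 1 = 2) by
        rintro (h3 | h3)
        · exact hz h3
        · omega), if_pos h2]
      push_cast
      ring

end

end
end TypeB

theorem mainTheorem9 (n : ℕ) (hn : 1 ≤ n) (σ : Equiv.Perm (Fin n))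
    (p : Fin (n + 1) → Submodule ℝ (TypeB.V n))
    (hp : TypeB.IsMaximalChain (TypeB.setPartitions n) p) :
    (∃! T : TypeB.PointedAndreTree n, TypeB.IsStanleyImage p T) ∧
    ∀ T : TypeB.PointedAndreTree n, TypeB.IsStanleyImage p T →
      TypeB.classGenFun (TypeB.coxeterElement σ) p =
        ∏ v ∈ Finset.univ.filter (fun v : Fin n => T.hook v ≠ 1), T.beta v := by
  classical
  obtain ⟨r, b, S, h, hr⟩ := TypeB.exists_splitChain hp
  refine ⟨TypeB.existsUnique_isStanleyImage h hr hn, fun T hT => ?_⟩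
  obtain ⟨γ, P, hγ, hP, hstep⟩ := TypeB.exists_isCoxEnum hn σ
  have hword : ∃ l : List (TypeB.V n ≃ₗᵢ[ℝ] TypeB.V n), (∀ t ∈ l, t ∈ TypeB.reflections n) ∧
      l.prod = TypeB.act γ ∧ l.length = n := by
    refine ⟨List.ofFn fun i => TypeB.refl (TypeB.simpleRoot (σ i)), fun t ht => ?_, hγ,
      List.length_ofFn⟩
    obtain ⟨i, rfl⟩ := (List.mem_ofFn' _ _).1 ht
    exact ⟨_, TypeB.simpleRoot_mem_posRoots _, rfl⟩
  have hmul := TypeB.classGenFun_mul_prod_symFactor hp h hr hn hP hstep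
    (fun x hx => TypeB.coxeterElement_fixed σ x (hγ ▸ hx)) hword
  rw [← hγ, Finset.prod_range, Finset.prod_range,
    Finset.prod_congr rfl fun v _ => TypeB.symFactor_mul_beta h hr hT v, Finset.prod_mul_distrib,
    mul_comm] at hmul
  have hne : ∏ i : Fin n, (TypeB.symFactor b i : Polynomial ℤ) ≠ 0 := by
    refine Finset.prod_ne_zero_iff.2 fun i _ => Nat.cast_ne_zero.2 ?_
    unfold TypeB.symFactor
    split_ifs <;> norm_num
  rw [Finset.prod_filter]
  exact mul_left_cancel₀ hne hmul
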